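/- **Setting.** Let $d\ge 2$, let $\mathbb B=B(0,1)\subset\mathbb R^d$ with outer unit normal $\nu$ on $\partial\mathbb B$ and surface measure $dS$, and let $H^{1/2}(\partial\mathbb B)$ be the space of traces of (complex-valued) $H^1(\mathbb B)$ functions, with the quotient norm; $H^{-1/2}(\partial\mathbb B)$ is the space of linear functionals on $C^\infty(\partial\mathbb B)$ that are bounded in the $H^{1/2}(\partial\mathbb B)$ norm, and a function $f\in L^1(\partial\mathbb B)$ is identified with the functional $\varphi\mapsto\int_{\partial\mathbb B}f\varphi\,dS$. For a ball $B(C,R)$ with $\overline{B(C,R)}\subset\mathbb B$ and $f\in H^{1/2}(\partial\mathbb B)$ let $u\in H^1(\mathbb B\setminus\overline{B(C,R)})$ be the weak solution of $\Delta u=0$ in $\mathbb B\setminus\overline{B(C,R)}$, $u=f$ on $\partial\mathbb B$, $u=0$ on $\partial B(C,R)$, and put $\Lambda_{C,R}f=\nu\cdot\nabla u|_{\partial\mathbb B}\in H^{-1/2}(\partial\mathbb B)$. Let $\Lambda_1f=\nu\cdot\nabla w|_{\partial\mathbb B}\in H^{-1/2}(\partial\mathbb B)$, where $w\in H^1(\mathbb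 B)$ is the weak solution of $\Delta w=0$ in $\mathbb B$, $w=f$ on $\partial\mathbb B$. (The normal derivatives are defined by Green's formula.) For $a\in\mathbb B\setminus\{0\}$ let $\hat a=a/|a|^2$, $b=(|a|^{-2}-1)^{1/2}$, let $I_a(x)=b^2\frac{x-\hat a}{|x-\hat a|^2}+\hat a$ be the inversion in the sphere $S(\hat a,b)$, and let $g_a(x)=b/|x-\hat a|$. For functions on $\partial\mathbb B$ put $$G_af=g_af,\qquad K_af=g_a^{d-2}\,(f\circ I_a),\qquad H_af(x)=x\cdot\frac{x-\hat a}{|x-\hat a|^2}\,f(x),$$ and for linear functionals $T$ on $C^\infty(\partial\mathbb B)$ put $\langle G_aT,\varphi\rangle=\langle T,G_a\varphi\rangle$ and $\langle K_aT,\varphi\rangle=\langle T,G_a^2K_a\varphi\rangle$. **Theorem.** Let $a\in\mathbb B\setminus\{0\}$, $r\in(0,1)$ and $B(C,R)=I_a(B(0,r))$. Then $K_a$ maps $H^{1/2}(\partial\mathbb B)$ into itself, the Dirichlet-to-Neumann maps $\Lambda_{C,R},\Lambda_{0,r},\Lambda_1:H^{1/2}(\partial\mathbb B)\to H^{-1/2}(\partial\mathbb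 B)$ are well defined, and on $H^{1/2}(\partial\mathbb B)$ $$\Lambda_{C,R}=G_a^2K_a\Lambda_{0,r}K_a+(2-d)H_a .$$ Furthermore, $$\Lambda_{C,R}-\Lambda_1=G_a^2K_a(\Lambda_{0,r}-\Lambda_1)K_a,\qquad \Lambda_{0,r}-\Lambda_1=G_a^2K_a(\Lambda_{C,R}-\Lambda_1)K_a .$$ -/

import Mathlib

open MeasureTheory Metric Set
open scoped ContDiff

noncomputable section

namespace DNKelvin

/-- Euclidean space of dimension `d`. -/
abbrev Euc (d : ℕ) := EuclideanSpace ℝ (Fin d)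

/-- The unit sphere, i.e. the boundary of the unit ball. -/
abbrev Sph (d : ℕ) := sphere (0 : Euc d) 1

/-- The (unnormalized) surface measure on the unit sphere. -/
def surf (d : ℕ) : Measure (Sph d) := (volume : Measure (Euc d)).toSphere

/-- The partial derivative of `φ` in the `i`-th coordinate direction. -/
def partialD {d : ℕ} (i : Fin d) (φ : Euc d → ℂ) (x : Euc d) : ℂ :=
  fderiv ℝ φ x (EuclideanSpace.single i 1)

/-! ### Sobolev functions of order one and their boundary values -/

/-- An element of `H¹(U)`: a square integrable function on `U` together with its square
integrable weak partial derivatives. (Values outside `U` are irrelevant.) -/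
structure H1 {d : ℕ} (U : Set (Euc d)) where
  val : Euc d → ℂ
  grad : Fin d → Euc d → ℂ
  memLp_val : MemLp val 2 (volume.restrict U)
  memLp_grad : ∀ i, MemLp (grad i) 2 (volume.restrict U)
  weak : ∀ (i : Fin d) (φ : Euc d → ℂ), ContDiff ℝ ∞ φ → HasCompactSupport φ → tsupport φ ⊆ U →
    ∫ x in U, val x * partialD i φ x = - ∫ x in U, grad i x * φ x

/-- The `H¹(U)` norm. -/
def H1.norm {d : ℕ} {U : Set (Euc d)} (v : H1 U) : ℝ :=
  Real.sqrt (∫ x in U, (‖v.val x‖ ^ 2 + ∑ i, ‖v.grad i x‖ ^ 2))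

/-- The bilinear Dirichlet form `∫_U ∇u · ∇v dx`. -/
def dirichlet {d : ℕ} {U : Set (Euc d)} (u v : H1 U) : ℂ :=
  ∫ x in U, ∑ i, u.grad i x * v.grad i x

/-- `f` is the trace of `u ∈ H¹(𝔹)` on `∂𝔹`: the function `f ∈ L²(∂𝔹)` is the boundary term in
the integration by parts formula against every smooth function. The outer unit normal at
`x ∈ ∂𝔹` is `x`. -/
def HasTrace {d : ℕ} (u : H1 (ball (0 : Euc d) 1)) (f : Sph d → ℂ) : Prop :=
  MemLp f 2 (surf d) ∧
  ∀ (i : Fin d) (ψ : Euc d → ℂ), ContDiff ℝ ∞ ψ →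
    ∫ x in ball (0 : Euc d) 1, (u.val x * partialD i ψ x + u.grad i x * ψ x) =
      ∫ x : Sph d, f x * ψ x * ((x : Euc d) i : ℂ) ∂(surf d)

/-- The unit ball with the closed ball `B(C,R)` removed. -/
def holed {d : ℕ} (C : Euc d) (R : ℝ) : Set (Euc d) := ball 0 1 \ closedBall C R

/-- `u ∈ H¹(𝔹 \ closure B(C,R))` has trace `f` on `∂𝔹` and trace `h` on `∂B(C,R)`, where
`h y` is the boundary value at the point `C + R y`, at which the outer unit normal of the
domain is `-y` and the surface element is `R^(d-1) dS(y)`. -/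
def HasTraces {d : ℕ} (C : Euc d) (R : ℝ) (u : H1 (holed C R)) (f h : Sph d → ℂ) : Prop :=
  MemLp f 2 (surf d) ∧ MemLp h 2 (surf d) ∧
  ∀ (i : Fin d) (ψ : Euc d → ℂ), ContDiff ℝ ∞ ψ →
    ∫ x in holed C R, (u.val x * partialD i ψ x + u.grad i x * ψ x) =
      (∫ x : Sph d, f x * ψ x * ((x : Euc d) i : ℂ) ∂(surf d)) -
      (R : ℂ) ^ (d - 1) *
        ∫ y : Sph d, h y * ψ (C + R • (y : Euc d)) * ((y : Euc d) i : ℂ) ∂(surf d)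

/-- The space `H^{1/2}(∂𝔹)` of traces of functions in `H¹(𝔹)`. -/
def MemHHalf {d : ℕ} (f : Sph d → ℂ) : Prop :=
  ∃ u : H1 (ball (0 : Euc d) 1), HasTrace u f

/-! ### Test functions and functionals on the unit sphere -/

/-- `C^∞(∂𝔹)`: restrictions to the sphere of functions that are smooth near the sphere. -/
def Smooth (d : ℕ) : Submodule ℂ (Sph d → ℂ) where
  carrier := {φ | ∃ (U : Set (Euc d)) (Φ : Euc d → ℂ), IsOpen U ∧ sphere (0 : Euc d) 1 ⊆ U ∧
    ContDiffOn ℝ ∞ Φ U ∧ ∀ x : Sph d, φ x = Φ x}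
  zero_mem' := ⟨univ, fun _ => 0, isOpen_univ, subset_univ _, contDiffOn_const, fun _ => rfl⟩
  add_mem' := by
    rintro φ ψ ⟨U, Φ, hU, hs, hΦ, h⟩ ⟨V, Ψ, hV, ht, hΨ, k⟩
    exact ⟨U ∩ V, fun x => Φ x + Ψ x, hU.inter hV, subset_inter hs ht,
      (hΦ.mono inter_subset_left).add (hΨ.mono inter_subset_right),
      fun x => by simp [h x, k x]⟩
  smul_mem' := by
    rintro c φ ⟨U, Φ, hU, hs, hΦ, h⟩
    exact ⟨U, fun x => c * Φ x, hU, hs, contDiffOn_const.mul hΦ, fun x => by simp [h x]⟩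

/-- Linear functionals on `C^∞(∂𝔹)`; all functionals used below act through the bilinear
pairing that extends `∫ f φ dS`. -/
abbrev Functional (d : ℕ) := Smooth d →ₗ[ℂ] ℂ

/-- `H^{-1/2}(∂𝔹)`: the functionals that are bounded in the quotient norm
`‖φ‖_{1/2} = inf {‖v‖_{H¹(𝔹)} : v|_{∂𝔹} = φ}` of `H^{1/2}(∂𝔹)`. -/
def MemHNegHalf {d : ℕ} (g : Functional d) : Prop :=
  ∃ M : ℝ, ∀ (φ : Smooth d) (v : H1 (ball (0 : Euc d) 1)), HasTrace v φ → ‖g φ‖ ≤ M * v.norm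

theorem smooth_continuous {d : ℕ} (φ : Smooth d) : Continuous (φ : Sph d → ℂ) := by
  obtain ⟨U, Φ, hU, hs, hΦ, h⟩ := φ.2
  have h2 : (φ : Sph d → ℂ) = fun x : Sph d => Φ x := funext h
  rw [h2]
  exact hΦ.continuousOn.comp_continuous continuous_subtype_val fun x => hs x.2

theorem integrable_mul_smooth {d : ℕ} {f : Sph d → ℂ} (hf : Integrable f (surf d))
    (φ : Smooth d) : Integrable (fun x => f x * (φ : Sph d → ℂ) x) (surf d) := by
  obtain ⟨M, hM⟩ := (isCompact_range (smooth_continuous φ)).isBounded.exists_norm_le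
  exact hf.mul_bdd (c := M) (smooth_continuous φ).aestronglyMeasurable
    (Filter.Eventually.of_forall fun x => hM _ ⟨x, rfl⟩)

open Classical in
/-- The functional `φ ↦ ∫ f φ dS` of an integrable function `f` on the sphere
(zero if `f` is not integrable). -/
def ofFun {d : ℕ} (f : Sph d → ℂ) : Functional d :=
  if hf : Integrable f (surf d) then
    { toFun := fun φ => ∫ x, f x * (φ : Sph d → ℂ) x ∂(surf d)
      map_add' := fun φ ψ => by
        rw [← integral_add (integrable_mul_smooth hf φ) (integrable_mul_smooth hf ψ)]
        congr 1; ext x; simp [mul_add]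
      map_smul' := fun c φ => by
        rw [RingHom.id_apply, smul_eq_mul, ← integral_const_mul]
        congr 1; ext x; simp; ring }
  else 0

/-! ### Dirichlet-to-Neumann maps -/

/-- Let `T u f` express the boundary condition `u = f` on `∂𝔹` and `u = 0` on the remaining part
of the boundary of `U`. Then `IsDN T f g` says that `g ∈ H^{-1/2}(∂𝔹)` is the Neumann trace on
`∂𝔹` of a weak solution `u ∈ H¹(U)` of `Δu = 0` in `U` with `T u f`. The weak form is tested
against all `v ∈ H¹(U)` vanishing on the whole boundary, and the Neumann trace is given by
Green's formula `⟨g, φ⟩ = ∫_U ∇u · ∇v dx` for all `v ∈ H¹(U)` that equal `φ` on `∂𝔹` and vanish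
on the rest of the boundary. -/
def IsDN {d : ℕ} {U : Set (Euc d)} (T : H1 U → (Sph d → ℂ) → Prop)
    (f : Sph d → ℂ) (g : Functional d) : Prop :=
  MemHNegHalf g ∧ ∃ u : H1 U, T u f ∧ (∀ v : H1 U, T v 0 → dirichlet u v = 0) ∧
    ∀ (φ : Smooth d) (v : H1 U), T v φ → g φ = dirichlet u v

/-- Boundary condition for the perfectly conducting inclusion `B(C,R)`. -/
def BCHoled {d : ℕ} (C : Euc d) (R : ℝ) (u : H1 (holed C R)) (f : Sph d → ℂ) : Prop :=
  HasTraces C R u f 0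

open Classical in
/-- The Dirichlet-to-Neumann map `Λ_{C,R}` of the perfectly conducting inclusion `B(C,R)`. -/
def dnMap {d : ℕ} (C : Euc d) (R : ℝ) (f : Sph d → ℂ) : Functional d :=
  if h : ∃ g, IsDN (BCHoled C R) f g then h.choose else 0

open Classical in
/-- The inclusion-free Dirichlet-to-Neumann map `Λ₁`. -/
def dnMapOne {d : ℕ} (f : Sph d → ℂ) : Functional d :=
  if h : ∃ g, IsDN (HasTrace (d := d)) f g then h.choose else 0

/-! ### Inversions and Kelvin transformations -/

/-- The punctured unit ball `𝔹 \ {0}`. -/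
abbrev PBall (d : ℕ) := {a : Euc d // a ≠ 0 ∧ ‖a‖ < 1}

/-- `â`, the image of `a` under the inversion in the unit sphere. -/
def hat {d : ℕ} (a : PBall d) : Euc d := EuclideanGeometry.inversion 0 1 (a : Euc d)

/-- `b = (|a|⁻² - 1)^{1/2}`. -/
def bRad {d : ℕ} (a : PBall d) : ℝ := Real.sqrt (‖(a : Euc d)‖⁻¹ ^ 2 - 1)

/-- `I_a`, the inversion in the sphere `S(â,b)`. -/
def invA {d : ℕ} (a : PBall d) (x : Euc d) : Euc d :=
  EuclideanGeometry.inversion (hat a) (bRad a) x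

/-- `g_a(x) = b / |x - â|`. -/
def gFun {d : ℕ} (a : PBall d) (x : Euc d) : ℝ := bRad a / ‖x - hat a‖

theorem norm_hat {d : ℕ} (a : PBall d) : ‖hat a‖ = ‖(a : Euc d)‖⁻¹ := by
  have h : ‖(a : Euc d)‖ ≠ 0 := norm_ne_zero_iff.2 a.2.1
  have := EuclideanGeometry.dist_inversion_center (0 : Euc d) (a : Euc d) 1
  simpa [hat, dist_zero_right] using this

theorem one_lt_norm_hat {d : ℕ} (a : PBall d) : 1 < ‖hat a‖ := by
  rw [norm_hat]
  exact (one_lt_inv₀ (norm_pos_iff.2 a.2.1)).2 a.2.2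

theorem ne_hat {d : ℕ} (a : PBall d) (x : Sph d) : (x : Euc d) ≠ hat a := by
  intro h
  have h1 := one_lt_norm_hat a
  have h2 : ‖(x : Euc d)‖ = 1 := by simp
  rw [← h, h2] at h1
  exact lt_irrefl _ h1

theorem bRad_sq {d : ℕ} (a : PBall d) : bRad a ^ 2 = ‖hat a‖ ^ 2 - 1 := by
  rw [bRad, ← norm_hat, Real.sq_sqrt]
  nlinarith [one_lt_norm_hat a]

theorem inv_mem {d : ℕ} (a : PBall d) (x : Sph d) : invA a x ∈ sphere (0 : Euc d) 1 := by
  have hn : ‖(x : Euc d) - hat a‖ ≠ 0 := norm_ne_zero_iff.2 (sub_ne_zero.2 (ne_hat a x))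
  have hx : ‖(x : Euc d)‖ = 1 := by simp
  have hs : ‖(x : Euc d) - hat a‖ ^ 2 = 1 - 2 * inner ℝ (x : Euc d) (hat a) + ‖hat a‖ ^ 2 := by
    rw [norm_sub_sq_real, hx]; ring
  have hi : inner ℝ ((x : Euc d) - hat a) (hat a) = inner ℝ (x : Euc d) (hat a) - ‖hat a‖ ^ 2 := by
    rw [inner_sub_left, real_inner_self_eq_norm_sq]
  have key : ‖invA a x‖ ^ 2 = 1 := by
    rw [invA, EuclideanGeometry.inversion, vsub_eq_sub, vadd_eq_add, norm_add_sq_real, norm_smul,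
      real_inner_smul_left, dist_eq_norm, hi, div_pow, bRad_sq, Real.norm_eq_abs, mul_pow, sq_abs]
    field_simp
    rw [hs]
    ring
  rw [mem_sphere_zero_iff_norm]
  nlinarith [norm_nonneg (invA a x)]

/-- The restriction of `I_a` to the unit sphere. -/
def invSph {d : ℕ} (a : PBall d) (x : Sph d) : Sph d := ⟨invA a x, inv_mem a x⟩

/-- The Kelvin transformation `K_a f = g_a^{d-2} (f ∘ I_a)` of functions on the sphere
(used for `2 ≤ d`). -/
def kelvin {d : ℕ} (a : PBall d) (f : Sph d → ℂ) (x : Sph d) : ℂ :=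
  (gFun a x : ℂ) ^ (d - 2) * f (invSph a x)

/-- `H_a f (x) = (x · (x - â) / |x - â|²) f(x)`. -/
def hMul {d : ℕ} (a : PBall d) (f : Sph d → ℂ) (x : Sph d) : ℂ :=
  ((inner ℝ (x : Euc d) ((x : Euc d) - hat a) / ‖(x : Euc d) - hat a‖ ^ 2 : ℝ) : ℂ) * f x

theorem contDiffOn_gFun {d : ℕ} (a : PBall d) :
    ContDiffOn ℝ ∞ (fun x => (gFun a x : ℂ)) {hat a}ᶜ := by
  have h : ContDiffOn ℝ ∞ (gFun a) {hat a}ᶜ := by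
    intro x hx
    have hx' : x - hat a ≠ 0 := sub_ne_zero.2 hx
    exact (contDiffAt_const.div ((contDiffAt_id.sub contDiffAt_const).norm ℝ hx')
      (norm_ne_zero_iff.2 hx')).contDiffWithinAt
  exact Complex.ofRealCLM.contDiff.comp_contDiffOn h

theorem contDiffOn_inv {d : ℕ} (a : PBall d) : ContDiffOn ℝ ∞ (invA a) {hat a}ᶜ := fun _ hx =>
  (contDiffAt_const.inversion contDiffAt_const contDiffAt_id hx).contDiffWithinAt

/-- Multiplication by `g_a` on `C^∞(∂𝔹)`. -/
def gTest {d : ℕ} (a : PBall d) : Smooth d →ₗ[ℂ] Smooth d where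
  toFun φ := ⟨fun x => (gFun a x : ℂ) * (φ : Sph d → ℂ) x, by
    obtain ⟨U, Φ, hU, hs, hΦ, h⟩ := φ.2
    exact ⟨U ∩ {hat a}ᶜ, fun x => (gFun a x : ℂ) * Φ x, hU.inter isOpen_compl_singleton,
      fun x hx => ⟨hs hx, ne_hat a ⟨x, hx⟩⟩,
      ((contDiffOn_gFun a).mono inter_subset_right).mul (hΦ.mono inter_subset_left),
      fun x => by simp only [h x]⟩⟩
  map_add' φ ψ := by ext x; simp [mul_add]
  map_smul' c φ := by ext x; simp; ring

/-- The Kelvin transformation on `C^∞(∂𝔹)`. -/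
def kelvinTest {d : ℕ} (a : PBall d) : Smooth d →ₗ[ℂ] Smooth d where
  toFun φ := ⟨kelvin a φ, by
    obtain ⟨U, Φ, hU, hs, hΦ, h⟩ := φ.2
    exact ⟨{hat a}ᶜ ∩ invA a ⁻¹' U, fun x => (gFun a x : ℂ) ^ (d - 2) * Φ (invA a x),
      (contDiffOn_inv a).continuousOn.isOpen_inter_preimage isOpen_compl_singleton hU,
      fun x hx => ⟨ne_hat a ⟨x, hx⟩, hs (inv_mem a ⟨x, hx⟩)⟩,
      (((contDiffOn_gFun a).mono inter_subset_left).pow _).mul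
        (hΦ.comp ((contDiffOn_inv a).mono inter_subset_left) fun _ hx => hx.2),
      fun x => by simp only [kelvin]; rw [h]; rfl⟩⟩
  map_add' φ ψ := by ext x; simp [kelvin, mul_add]
  map_smul' c φ := by ext x; simp [kelvin]; ring

/-- `G_a` on functionals: `⟨G_a T, φ⟩ = ⟨T, G_a φ⟩`. -/
def gDual {d : ℕ} (a : PBall d) (T : Functional d) : Functional d := T ∘ₗ gTest a

/-- `K_a` on functionals: `⟨K_a T, φ⟩ = ⟨T, G_a² K_a φ⟩`. -/
def kelvinDual {d : ℕ} (a : PBall d) (T : Functional d) : Functional d :=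
  T ∘ₗ gTest a ∘ₗ gTest a ∘ₗ kelvinTest a

end DNKelvin

end

open DNKelvin

/-! Write `g`, `I`, `K`, `H` for `g_a`, `I_a`, `K_a`, `H_a`. Since `|â|² = b² + 1`, the inversion
sphere is orthogonal to the unit sphere, so `I` preserves the unit ball and carries the ball with
hole `B(0,r)` to the ball with hole `B(C,R)`. It is conformal: its derivative is `g²` times the
reflection along `x - â`. Hence the Dirichlet form transforms almost invariantly under `u ↦ g^(d-2)
(u ∘ I)`. The change of variables gives, for `U' = I(U)`, `∫_U' ∇(Ku)·∇w = ∫_U ∇u·∇(Kw) + (d-2) ∫_U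
∇(u (w∘I)) · g^(d-2) (x-â)/|x-â|²`. The last field is divergence free, as `(2-d)` times it is the
gradient of the harmonic function `g^(d-2)` (and by direct computation also for `d = 2`). The last
integral is therefore the boundary term `∫ (H f)(K ψ) dS`, where `f` and `ψ` are the traces of `u`
and `w`. This is `exists_dirichlet_kelvin`.

The transformation law `isDN_kelvin` follows by choosing `w` harmonic with trace `K φ`: against a
harmonic function, the Dirichlet form depends only on the trace of the other argument, so `Ku` may
replace the solution with data `K f`. No proof that `Ku` is harmonic is needed. The law is used for
both holed domains and for the full ball; the term with `H` is the same each time and cancels in the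
differences.

The analysis underneath rests on traces defined by integration by parts. The divergence theorem in
the ball (`integral_ball_partialD`) supplies smooth functions with traces; mollification of
extensions by zero gives a product rule with boundary term (`BdryTrace.integral_mul_mul`); this
yields a Poincaré inequality, and orthogonal projection of gradients then solves the Dirichlet
problem (`exists_weak_solution`). The Piola identity (`sum_partialD_piola`) transports integration
by parts through the inversion, and applied to the constant `1` it also produces the Jacobian of `I`
on the sphere. -/

open MeasureTheory Metric Set
open scoped ContDiff

noncomputable section

namespace DNKelvin

/-! ### Calculus of partial derivatives -/

section Calculus

variable {d : ℕ}

/-- The `i`-th coordinate as a complex valued function. -/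
def coord (i : Fin d) (x : Euc d) : ℂ := ((x i : ℝ) : ℂ)

theorem contDiff_coord (i : Fin d) : ContDiff ℝ ∞ (coord i) :=
  Complex.ofRealCLM.contDiff.comp (EuclideanSpace.proj (𝕜 := ℝ) i).contDiff

theorem partialD_coord (i j : Fin d) (x : Euc d) :
    partialD i (coord j) x = if i = j then 1 else 0 := by
  have h : HasFDerivAt (coord j) (Complex.ofRealCLM ∘L (EuclideanSpace.proj (𝕜 := ℝ) j)) x :=
    (Complex.ofRealCLM ∘L (EuclideanSpace.proj (𝕜 := ℝ) j)).hasFDerivAt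
  rw [partialD, h.fderiv]
  by_cases hij : i = j
  · subst hij; simp
  · simp [hij, Ne.symm hij]

theorem contDiff_partialD {φ : Euc d → ℂ} (h : ContDiff ℝ ∞ φ) (i : Fin d) :
    ContDiff ℝ ∞ (partialD i φ) :=
  (h.fderiv_right (m := ∞) (by simp)).clm_apply contDiff_const

theorem partialD_mul {φ ψ : Euc d → ℂ} {x : Euc d} (i : Fin d) (hφ : DifferentiableAt ℝ φ x)
    (hψ : DifferentiableAt ℝ ψ x) :
    partialD i (fun x => φ x * ψ x) x = partialD i φ x * ψ x + φ x * partialD i ψ x := by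
  rw [partialD, fderiv_fun_mul hφ hψ]
  simp [partialD]; ring

theorem partialD_add {φ ψ : Euc d → ℂ} {x : Euc d} (i : Fin d) (hφ : DifferentiableAt ℝ φ x)
    (hψ : DifferentiableAt ℝ ψ x) :
    partialD i (fun x => φ x + ψ x) x = partialD i φ x + partialD i ψ x := by
  rw [partialD, fderiv_fun_add hφ hψ]; rfl

theorem partialD_const (c : ℂ) (i : Fin d) (x : Euc d) : partialD i (fun _ => c) x = 0 := by
  simp [partialD]

theorem partialD_congr {φ ψ : Euc d → ℂ} {x : Euc d} (i : Fin d) (h : φ =ᶠ[nhds x] ψ) :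
    partialD i φ x = partialD i ψ x := by
  rw [partialD, partialD, h.fderiv_eq]

theorem sum_coord_smul (v : Euc d) :
    ∑ i, v i • (EuclideanSpace.single i (1 : ℝ) : Euc d) = v := by
  ext j
  simp [Finset.sum_apply, Pi.single_apply]

theorem clm_eq_sum (L : Euc d →L[ℝ] ℂ) (v : Euc d) :
    L v = ∑ i, coord i v * L (EuclideanSpace.single i 1) := by
  conv_lhs => rw [← sum_coord_smul v]
  simp [coord]

theorem fderiv_eq_sum (φ : Euc d → ℂ) (x v : Euc d) :
    fderiv ℝ φ x v = ∑ i, coord i v * partialD i φ x := clm_eq_sum _ _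

theorem tsupport_partialD_subset (φ : Euc d → ℂ) (i : Fin d) :
    tsupport (partialD i φ) ⊆ tsupport φ := by
  refine closure_minimal (fun x hx => ?_) (isClosed_tsupport _)
  by_contra h
  apply hx
  have := (notMem_tsupport_iff_eventuallyEq.1 h).fderiv_eq (𝕜 := ℝ)
  simp [partialD, this]

theorem hasCompactSupport_partialD {φ : Euc d → ℂ} (h : HasCompactSupport φ) (i : Fin d) :
    HasCompactSupport (partialD i φ) :=
  h.of_isClosed_subset (isClosed_tsupport _) (tsupport_partialD_subset φ i)

theorem integral_partialD_eq_zero {φ : Euc d → ℂ} (h : ContDiff ℝ ∞ φ) (hc : HasCompactSupport φ)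
    (i : Fin d) : ∫ x, partialD i φ x = 0 := by
  have h1 : Integrable (partialD i φ) :=
    (contDiff_partialD h i).continuous.integrable_of_hasCompactSupport
      (hasCompactSupport_partialD hc i)
  have := integral_mul_fderiv_eq_neg_fderiv_mul_of_integrable (μ := (volume : Measure (Euc d)))
    (f := fun _ => (1 : ℂ)) (g := φ) (v := EuclideanSpace.single i 1) (by simp)
    (by simp only [one_mul]; exact h1)
    (by simpa using h.continuous.integrable_of_hasCompactSupport hc) (by simp)
    (fun x _ => (h.differentiable (by simp)).differentiableAt)
  simpa [partialD] using this

end Calculus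

/-! ### The divergence theorem in the unit ball -/

section Divergence

variable {d : ℕ}

instance : IsFiniteMeasure (surf d) := by unfold surf; infer_instance

/-- The polar coordinate homeomorphism of the punctured space onto sphere times half-line preserves
measure when the half-line carries the density `r^(d-1)`, and the origin is a null set. -/
theorem integral_polar [Nonempty (Fin d)] {F : Euc d → ℂ} (hF : Integrable F) :
    ∫ x, F x = ∫ y : Sph d, ∫ r in Ioi (0 : ℝ), (r ^ (d - 1)) • F (r • (y : Euc d)) ∂(volume)
      ∂(surf d) := by
  have : Nontrivial (Euc d) := inferInstance
  have hfr : Module.finrank ℝ (Euc d) = d := by simp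
  have mp := (volume : Measure (Euc d)).measurePreserving_homeomorphUnitSphereProd
  have emb := (Homeomorph.measurableEmbedding (homeomorphUnitSphereProd (Euc d)))
  let G : Sph d × Ioi (0 : ℝ) → ℂ := fun p => F (p.2.1 • (p.1 : Euc d))
  have hG : ∀ x : ({0}ᶜ : Set (Euc d)), G (homeomorphUnitSphereProd (Euc d) x) = F x := by
    intro x
    have := (homeomorphUnitSphereProd (Euc d)).symm_apply_apply x
    have h2 := congrArg Subtype.val this
    simp only [homeomorphUnitSphereProd_symm_apply_coe] at h2
    simp only [G, h2]
  have hI : Integrable G ((surf d).prod (.volumeIoiPow (Module.finrank ℝ (Euc d) - 1))) := by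
    rw [surf, ← mp.integrable_comp_emb emb]
    have : (G ∘ homeomorphUnitSphereProd (Euc d)) = F ∘ Subtype.val := funext hG
    rw [this, ← integrableOn_iff_comap_subtypeVal (by measurability)]
    exact hF.integrableOn
  calc
    ∫ x, F x = ∫ x : ({(0)}ᶜ : Set (Euc d)), F x ∂((volume : Measure (Euc d)).comap (↑)) := by
      rw [integral_subtype_comap (measurableSet_singleton _).compl fun x ↦ F x,
        restrict_compl_singleton]
    _ = ∫ p, G p ∂((surf d).prod (.volumeIoiPow (Module.finrank ℝ (Euc d) - 1))) := by
      rw [surf, ← mp.integral_comp emb]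
      simp only [hG]
    _ = ∫ y : Sph d, ∫ r : Ioi (0 : ℝ), F (r.1 • (y : Euc d))
          ∂(.volumeIoiPow (Module.finrank ℝ (Euc d) - 1)) ∂(surf d) := by
      rw [integral_prod _ hI]
    _ = _ := by
      congr 1
      ext y
      simp only [Measure.volumeIoiPow, ENNReal.ofReal]
      rw [integral_withDensity_eq_integral_smul,
        integral_subtype_comap measurableSet_Ioi
          fun a ↦ Real.toNNReal (a ^ (Module.finrank ℝ (Euc d) - 1)) • F (a • (y : Euc d)),
        setIntegral_congr_fun measurableSet_Ioi fun x hx ↦ ?_]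
      · rw [NNReal.smul_def, Real.coe_toNNReal _ (pow_nonneg hx.out.le _), hfr]
      · exact (measurable_subtype_coe.pow_const _).real_toNNReal

theorem setIntegral_ball_polar [Nonempty (Fin d)] {F : Euc d → ℂ} (hF : Continuous F) :
    ∫ x in ball (0 : Euc d) 1, F x =
      ∫ y : Sph d, ∫ r in (0 : ℝ)..1, (r ^ (d - 1)) • F (r • (y : Euc d)) ∂(volume) ∂(surf d) := by
  have hi : IntegrableOn F (ball (0 : Euc d) 1) :=
    (hF.continuousOn.integrableOn_compact (isCompact_closedBall _ _)).mono_set ball_subset_closedBall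
  rw [← integral_indicator measurableSet_ball,
    integral_polar ((integrable_indicator_iff measurableSet_ball).2 hi)]
  congr 1
  ext y
  have hy : ‖(y : Euc d)‖ = 1 := by simp
  rw [intervalIntegral.integral_of_le zero_le_one, integral_Ioc_eq_integral_Ioo,
    ← integral_indicator measurableSet_Ioi, ← integral_indicator measurableSet_Ioo]
  congr 1
  ext r
  by_cases h0 : 0 < r
  · by_cases h1 : r < 1
    · have : r • (y : Euc d) ∈ ball (0 : Euc d) 1 := by
        simp [norm_smul, hy, abs_of_pos h0, h1]
      simp [h0, h1, indicator_of_mem this]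
    · have : r • (y : Euc d) ∉ ball (0 : Euc d) 1 := by
        simpa [norm_smul, hy, abs_of_pos h0] using h1
      simp [h1, indicator_of_notMem this]
  · simp [h0]

/-- This is the divergence theorem for the radial field `h(x) x`. Along each ray the integrand times
`r^(d-1)` is the derivative of `r^d h(r y)`, so polar coordinates and the fundamental theorem of
calculus suffice. -/
theorem integral_sphere_eq_integral_ball [Nonempty (Fin d)] {h : Euc d → ℂ} (hh : ContDiff ℝ ∞ h) :
    ∫ y : Sph d, h y ∂(surf d) = ∫ x in ball (0 : Euc d) 1, ((d : ℂ) * h x + fderiv ℝ h x x) := by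
  have hd : d ≠ 0 := by
    rintro rfl
    exact Fin.elim0 (Classical.arbitrary (Fin 0))
  have hc : Continuous fun x => (d : ℂ) * h x + fderiv ℝ h x x :=
    (continuous_const.mul hh.continuous).add
      ((hh.continuous_fderiv (by simp)).clm_apply continuous_id)
  rw [setIntegral_ball_polar hc]
  congr 1
  ext y
  have key : ∀ r : ℝ, HasDerivAt (fun r : ℝ => ((r ^ d : ℝ) : ℂ) * h (r • (y : Euc d)))
      (r ^ (d - 1) • ((d : ℂ) * h (r • (y : Euc d)) +
        fderiv ℝ h (r • (y : Euc d)) (r • (y : Euc d)))) r := by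
    intro r
    have h1 : HasDerivAt (fun r : ℝ => ((r ^ d : ℝ) : ℂ)) (((d : ℝ) * r ^ (d - 1) : ℝ) : ℂ) r :=
      (hasDerivAt_pow d r).ofReal_comp
    have h2 : HasDerivAt (fun r : ℝ => h (r • (y : Euc d)))
        (fderiv ℝ h (r • (y : Euc d)) (y : Euc d)) r := by
      have := ((hh.differentiable (by simp)) (r • (y : Euc d))).hasFDerivAt.comp_hasDerivAt r
        ((hasDerivAt_id r).smul_const (y : Euc d))
      simpa [Function.comp_def] using this
    refine (h1.fun_mul h2).congr_deriv ?_
    have : r ^ d = r ^ (d - 1) * r := (pow_sub_one_mul hd r).symm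
    rw [this]
    simp only [map_smul, Complex.real_smul, Complex.ofReal_mul, Complex.ofReal_pow,
      Complex.ofReal_natCast]
    ring
  rw [intervalIntegral.integral_eq_sub_of_hasDerivAt (fun r _ => key r)]
  · simp [hd]
  · apply Continuous.intervalIntegrable
    exact (continuous_pow _).smul (hc.comp (continuous_id.smul continuous_const))

/-- A smooth radial cutoff function, supported in the unit ball. -/
def ballCutoff (n : ℕ) (x : Euc d) : ℂ :=
  (Real.smoothTransition ((n + 2 : ℝ) * (1 - ‖x‖ ^ 2)) : ℝ)

theorem contDiff_ballCutoff (n : ℕ) : ContDiff ℝ ∞ (ballCutoff n : Euc d → ℂ) := by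
  refine Complex.ofRealCLM.contDiff.comp (Real.smoothTransition.contDiff.comp ?_)
  exact contDiff_const.mul (contDiff_const.sub (contDiff_norm_sq ℝ))

theorem ballCutoff_eq_zero (n : ℕ) {x : Euc d} (hx : 1 ≤ ‖x‖) : ballCutoff n x = 0 := by
  have : (n + 2 : ℝ) * (1 - ‖x‖ ^ 2) ≤ 0 := by
    have : 1 - ‖x‖ ^ 2 ≤ 0 := by nlinarith
    have h2 : (0 : ℝ) ≤ n + 2 := by positivity
    nlinarith
  simp [ballCutoff, Real.smoothTransition.zero_of_nonpos this]

theorem hasCompactSupport_ballCutoff (n : ℕ) : HasCompactSupport (ballCutoff n : Euc d → ℂ) := by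
  refine HasCompactSupport.intro (isCompact_closedBall (0 : Euc d) 1) fun x hx => ?_
  exact ballCutoff_eq_zero n (by simpa using (not_le.1 (by simpa using hx)).le)

theorem tendsto_integral_ballCutoff {F : Euc d → ℂ} (hF : Continuous F) :
    Filter.Tendsto (fun n => ∫ x, ballCutoff n x * F x) Filter.atTop
      (nhds (∫ x in ball (0 : Euc d) 1, F x)) := by
  rw [← integral_indicator measurableSet_ball]
  refine tendsto_integral_of_dominated_convergence
    (indicator (closedBall (0 : Euc d) 1) fun x => ‖F x‖) ?_ ?_ ?_ ?_
  · exact fun n => ((contDiff_ballCutoff n).continuous.mul hF).aestronglyMeasurable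
  · exact (integrable_indicator_iff measurableSet_closedBall).2
      (hF.norm.continuousOn.integrableOn_compact (isCompact_closedBall _ _))
  · refine fun n => Filter.Eventually.of_forall fun x => ?_
    by_cases hx : x ∈ closedBall (0 : Euc d) 1
    · rw [indicator_of_mem hx, norm_mul]
      refine mul_le_of_le_one_left (norm_nonneg _) ?_
      rw [ballCutoff, Complex.norm_real, Real.norm_eq_abs,
        abs_of_nonneg (Real.smoothTransition.nonneg _)]
      exact Real.smoothTransition.le_one _
    · rw [indicator_of_notMem hx, ballCutoff_eq_zero n, zero_mul, norm_zero]
      simpa using (not_le.1 (by simpa using hx)).le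
  · refine Filter.Eventually.of_forall fun x => ?_
    by_cases hx : x ∈ ball (0 : Euc d) 1
    · have hx' : ‖x‖ < 1 := by simpa using hx
      have hpos : 0 < 1 - ‖x‖ ^ 2 := by nlinarith [norm_nonneg x]
      rw [indicator_of_mem hx]
      apply tendsto_const_nhds.congr'
      obtain ⟨N, hN⟩ := exists_nat_gt (1 - ‖x‖ ^ 2)⁻¹
      filter_upwards [Filter.eventually_ge_atTop N] with n hn
      have h2 : 1 ≤ (n + 2 : ℝ) * (1 - ‖x‖ ^ 2) := by
        have h3 : (1 - ‖x‖ ^ 2)⁻¹ ≤ (n : ℝ) + 2 := by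
          have : (N : ℝ) ≤ n := by exact_mod_cast hn
          linarith
        calc (1 : ℝ) = (1 - ‖x‖ ^ 2)⁻¹ * (1 - ‖x‖ ^ 2) := (inv_mul_cancel₀ hpos.ne').symm
          _ ≤ _ := by gcongr
      simp [ballCutoff, Real.smoothTransition.one_of_one_le h2]
    · rw [indicator_of_notMem hx]
      apply tendsto_const_nhds.congr
      intro n
      rw [ballCutoff_eq_zero n (by simpa using hx), zero_mul]

/-- A radial function has a radial gradient. The factor `n + 2 ≥ 2` makes the cutoff identically `1`
for `|x| < 1/2`, so its gradient vanishes exactly where `invNormSq` may differ from `|x|⁻²`. -/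
theorem exists_partialD_ballCutoff (n : ℕ) (x : Euc d) :
    ∃ c : ℂ, (‖x‖ < 1 / 2 → c = 0) ∧ ∀ i, partialD i (ballCutoff n) x = c * coord i x := by
  let f : ℝ → ℝ := fun s => Real.smoothTransition ((n + 2 : ℝ) * (1 - s))
  have hf : Differentiable ℝ f :=
    (Real.smoothTransition.contDiff (n := 1)).differentiable one_ne_zero |>.comp (by fun_prop)
  refine ⟨((2 * deriv f (‖x‖ ^ 2) : ℝ) : ℂ), fun hx => ?_, fun i => ?_⟩
  · have : f =ᶠ[nhds (‖x‖ ^ 2)] fun _ => 1 := by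
      have h1 : ‖x‖ ^ 2 < 1 / 2 := by nlinarith [norm_nonneg x]
      filter_upwards [gt_mem_nhds h1] with s hs
      apply Real.smoothTransition.one_of_one_le
      have : (0 : ℝ) ≤ n := by positivity
      nlinarith
    simp [this.deriv_eq]
  · have h1 : HasFDerivAt (fun x : Euc d => f (‖x‖ ^ 2))
        (deriv f (‖x‖ ^ 2) • (2 • (innerSL ℝ x))) x :=
      (hf _).hasDerivAt.comp_hasFDerivAt x (hasStrictFDerivAt_norm_sq x).hasFDerivAt
    have h2 : HasFDerivAt (ballCutoff n : Euc d → ℂ)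
        (Complex.ofRealCLM ∘L (deriv f (‖x‖ ^ 2) • (2 • (innerSL ℝ x)))) x :=
      Complex.ofRealCLM.hasFDerivAt.comp x h1
    rw [partialD, h2.fderiv]
    simp [coord, EuclideanSpace.inner_single_right]
    ring

theorem sum_partialD_coord_mul {h : Euc d → ℂ} {x : Euc d} (hh : DifferentiableAt ℝ h x) :
    ∑ j, partialD j (fun x => coord j x * h x) x = d * h x + fderiv ℝ h x x := by
  have : ∀ j, partialD j (fun x => coord j x * h x) x = h x + coord j x * partialD j h x := by
    intro j
    rw [partialD_mul j ((contDiff_coord j).differentiable (by simp) x) hh, partialD_coord]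
    simp
  simp [this, Finset.sum_add_distrib, fderiv_eq_sum]

theorem integral_mul_partialD {f g : Euc d → ℂ} (hf : ContDiff ℝ ∞ f) (hg : ContDiff ℝ ∞ g)
    (hc : HasCompactSupport f) (i : Fin d) :
    ∫ x, f x * partialD i g x = - ∫ x, partialD i f x * g x := by
  have h := integral_partialD_eq_zero (hf.mul hg) (hc.mul_right (f' := g)) i
  have h2 : ∀ x, partialD i (fun x => f x * g x) x = partialD i f x * g x + f x * partialD i g x :=
    fun x => partialD_mul i (hf.differentiable (by simp) x) (hg.differentiable (by simp) x)
  change ∫ x, partialD i (fun x => f x * g x) x = 0 at h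
  simp only [h2] at h
  rw [integral_add] at h
  · linear_combination h
  · exact ((contDiff_partialD hf i).continuous.mul hg.continuous).integrable_of_hasCompactSupport
      ((hasCompactSupport_partialD hc i).mul_right)
  · exact (hf.continuous.mul (contDiff_partialD hg i).continuous).integrable_of_hasCompactSupport
      hc.mul_right

/-- A smooth function that equals `|x|⁻²` outside the ball of radius `1/2`. -/
def invNormSq (x : Euc d) : ℂ :=
  (((‖x‖ ^ 2 + (1 - Real.smoothTransition (4 * ‖x‖ ^ 2)))⁻¹ : ℝ) : ℂ)

theorem contDiff_invNormSq : ContDiff ℝ ∞ (invNormSq : Euc d → ℂ) := by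
  refine Complex.ofRealCLM.contDiff.comp (ContDiff.inv ?_ fun x => ?_)
  · exact (contDiff_norm_sq ℝ).add (contDiff_const.sub
      (Real.smoothTransition.contDiff.comp (contDiff_const.mul (contDiff_norm_sq ℝ))))
  · have h1 := Real.smoothTransition.le_one (4 * ‖x‖ ^ 2)
    by_cases hx : x = 0
    · simp [hx]
    · have : 0 < ‖x‖ := norm_pos_iff.2 hx
      positivity [sub_nonneg.2 h1]

theorem invNormSq_eq {x : Euc d} (hx : 1 / 2 ≤ ‖x‖) : invNormSq x = ((‖x‖ ^ 2)⁻¹ : ℝ) := by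
  have : 1 ≤ 4 * ‖x‖ ^ 2 := by nlinarith
  simp [invNormSq, Real.smoothTransition.one_of_one_le this]

theorem sum_coord_mul_coord (x : Euc d) : ∑ j, coord j x * coord j x = ((‖x‖ ^ 2 : ℝ) : ℂ) := by
  rw [EuclideanSpace.norm_sq_eq]
  simp [coord, pow_two]

/-- The divergence theorem in the unit ball. -/
theorem integral_ball_partialD [Nonempty (Fin d)] {φ : Euc d → ℂ} (hφ : ContDiff ℝ ∞ φ)
    (i : Fin d) :
    ∫ x in ball (0 : Euc d) 1, partialD i φ x = ∫ y : Sph d, φ y * coord i y ∂(surf d) := by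
  -- The radial field `h x` has, for `|x| ≥ 1/2`, the same radial component as the field `φ e_i`.
  -- Since gradients of radial cutoffs see only that component, the two divergences have the same
  -- integral over the ball, and the radial case is already known.
  set h : Euc d → ℂ := fun x => invNormSq x * coord i x * φ x with h_def
  have hh : ContDiff ℝ ∞ h := (contDiff_invNormSq.mul (contDiff_coord i)).mul hφ
  have hS : ∫ y : Sph d, φ y * coord i y ∂(surf d) = ∫ y : Sph d, h y ∂(surf d) := by
    congr 1
    ext y
    have : ‖(y : Euc d)‖ = 1 := by simp
    rw [h_def]
    simp only
    rw [invNormSq_eq (by rw [this]; norm_num), this]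
    simp; ring
  rw [hS, integral_sphere_eq_integral_ball hh]
  have hc : Continuous fun x => (d : ℂ) * h x + fderiv ℝ h x x :=
    (continuous_const.mul hh.continuous).add
      ((hh.continuous_fderiv (by simp)).clm_apply continuous_id)
  refine tendsto_nhds_unique (tendsto_integral_ballCutoff (contDiff_partialD hφ i).continuous) ?_
  refine (tendsto_integral_ballCutoff hc).congr fun n => ?_
  have hχ := contDiff_ballCutoff (d := d) n
  have hχc := hasCompactSupport_ballCutoff (d := d) n
  rw [integral_mul_partialD hχ hφ hχc]
  have h1 : ∀ x, ballCutoff n x * ((d : ℂ) * h x + fderiv ℝ h x x) =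
      ∑ j, ballCutoff n x * partialD j (fun x => coord j x * h x) x := fun x => by
    rw [← Finset.mul_sum, sum_partialD_coord_mul (hh.differentiable (by simp) x)]
  have hjs : ∀ j : Fin d, ContDiff ℝ ∞ (fun x => coord j x * h x) :=
    fun j => (contDiff_coord j).mul hh
  simp only [h1]
  rw [integral_finsetSum]
  · simp only [integral_mul_partialD hχ (hjs _) hχc]
    rw [Finset.sum_neg_distrib, ← integral_finsetSum]
    · congr 2
      ext x
      -- With cutoff gradient `c x`, both integrands equal `c x_i φ`: either `c = 0` or `|x|²`
      -- cancels against `invNormSq`.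
      obtain ⟨c, hc0, hc⟩ := exists_partialD_ballCutoff n x
      simp only [hc]
      have : ∑ j, c * coord j x * (coord j x * h x) = c * h x * ∑ j, coord j x * coord j x := by
        rw [Finset.mul_sum]; congr 1; ext j; ring
      rw [this, sum_coord_mul_coord]
      by_cases hx : ‖x‖ < 1 / 2
      · simp [hc0 hx]
      · rw [h_def]
        simp only
        rw [invNormSq_eq (not_lt.1 hx)]
        have : (‖x‖ : ℂ) ≠ 0 := by
          intro h0
          have : ‖x‖ = 0 := by exact_mod_cast h0
          rw [this] at hx
          norm_num at hx
        push_cast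
        field_simp
    · exact fun j _ => ((contDiff_partialD hχ j).continuous.mul
        (hjs j).continuous).integrable_of_hasCompactSupport
        (hasCompactSupport_partialD hχc j).mul_right
  · exact fun j _ => (hχ.continuous.mul
      (contDiff_partialD (hjs j) j).continuous).integrable_of_hasCompactSupport hχc.mul_right

end Divergence

/-! ### Functions that are smooth near the closed unit ball -/

section SmoothNear

variable {d : ℕ}

/-- Multiply by a smooth cutoff that is `1` near `K` and vanishes off a compact subset of `O`.
Agreement on neighbourhoods, rather than only on `K`, transfers to derivatives. -/
theorem exists_contDiff_eventuallyEq {K O : Set (Euc d)} (hK : IsCompact K) (hO : IsOpen O)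
    (hKO : K ⊆ O) {φ : Euc d → ℂ} (hφ : ContDiffOn ℝ ∞ φ O) :
    ∃ ψ : Euc d → ℂ, ContDiff ℝ ∞ ψ ∧ HasCompactSupport ψ ∧ tsupport ψ ⊆ O ∧
      ∀ x ∈ K, ψ =ᶠ[nhds x] φ := by
  obtain ⟨T, hT, hKT, hTO⟩ := exists_compact_between hK hO hKO
  obtain ⟨f, hf1, hf0, -⟩ := exists_contMDiffMap_one_nhds_of_subset_interior (n := ⊤)
    (modelWithCornersSelf ℝ (Euc d)) hK.isClosed hKT
  have hf : ContDiff ℝ ∞ (f : Euc d → ℝ) := f.contMDiff.contDiff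
  have hsupp : tsupport (fun x => ((f x : ℝ) : ℂ) * φ x) ⊆ T := by
    refine closure_minimal (fun x hx => ?_) hT.isClosed
    by_contra h
    exact hx (by simp [hf0 x h])
  refine ⟨fun x => ((f x : ℝ) : ℂ) * φ x, contDiff_iff_contDiffAt.2 fun x => ?_,
    hT.of_isClosed_subset (isClosed_tsupport _) hsupp, hsupp.trans hTO, fun x hx => ?_⟩
  · by_cases hx : x ∈ O
    · exact (Complex.ofRealCLM.contDiff.comp hf).contDiffAt.mul (hφ.contDiffAt (hO.mem_nhds hx))
    · have h1 : x ∉ tsupport (fun x => ((f x : ℝ) : ℂ) * φ x) := fun h => hx (hTO (hsupp h))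
      exact contDiffAt_const.congr_of_eventuallyEq (notMem_tsupport_iff_eventuallyEq.1 h1)
  · filter_upwards [Filter.Eventually.filter_mono (nhds_le_nhdsSet hx) hf1] with y hy
    simp [hy]

/-- The function `φ` is smooth in a neighbourhood of the closed unit ball. -/
def SmoothNear (φ : Euc d → ℂ) : Prop :=
  ∃ O : Set (Euc d), IsOpen O ∧ closedBall 0 1 ⊆ O ∧ ContDiffOn ℝ ∞ φ O

namespace SmoothNear

variable {φ ψ : Euc d → ℂ}

theorem of_contDiff (h : ContDiff ℝ ∞ φ) : SmoothNear φ :=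
  ⟨univ, isOpen_univ, subset_univ _, h.contDiffOn⟩

theorem const (c : ℂ) : SmoothNear (fun _ : Euc d => c) := of_contDiff contDiff_const

theorem mul (hφ : SmoothNear φ) (hψ : SmoothNear ψ) : SmoothNear fun x => φ x * ψ x := by
  obtain ⟨O, hO, hs, h⟩ := hφ
  obtain ⟨P, hP, ht, k⟩ := hψ
  exact ⟨O ∩ P, hO.inter hP, subset_inter hs ht,
    (h.mono inter_subset_left).mul (k.mono inter_subset_right)⟩

theorem exists_contDiff (hφ : SmoothNear φ) :
    ∃ ψ : Euc d → ℂ, ContDiff ℝ ∞ ψ ∧ HasCompactSupport ψ ∧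
      ∀ x ∈ closedBall (0 : Euc d) 1, ψ =ᶠ[nhds x] φ := by
  obtain ⟨O, hO, hs, h⟩ := hφ
  obtain ⟨ψ, h1, h2, -, h3⟩ := exists_contDiff_eventuallyEq (isCompact_closedBall _ _) hO hs h
  exact ⟨ψ, h1, h2, h3⟩

theorem differentiableAt (hφ : SmoothNear φ) {x : Euc d} (hx : x ∈ closedBall (0 : Euc d) 1) :
    DifferentiableAt ℝ φ x := by
  obtain ⟨O, hO, hs, h⟩ := hφ
  exact (h.contDiffAt (hO.mem_nhds (hs hx))).differentiableAt (by simp)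

theorem partialD (hφ : SmoothNear φ) (i : Fin d) : SmoothNear (partialD i φ) := by
  obtain ⟨O, hO, hs, h⟩ := hφ
  refine ⟨O, hO, hs, ?_⟩
  have h1 : ContDiffOn ℝ ∞ (fun x => fderiv ℝ φ x) O := h.fderiv_of_isOpen hO (by simp)
  exact h1.clm_apply contDiffOn_const

theorem continuousOn (hφ : SmoothNear φ) : ContinuousOn φ (closedBall 0 1) := by
  obtain ⟨O, hO, hs, h⟩ := hφ
  exact h.continuousOn.mono hs

theorem continuous_sphere (hφ : SmoothNear φ) : Continuous fun x : Sph d => φ x :=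
  hφ.continuousOn.comp_continuous continuous_subtype_val fun x => sphere_subset_closedBall x.2

theorem mem_smooth (hφ : SmoothNear φ) : (fun x : Sph d => φ x) ∈ Smooth d := by
  obtain ⟨O, hO, hs, h⟩ := hφ
  exact ⟨O, φ, hO, sphere_subset_closedBall.trans hs, h, fun _ => rfl⟩

end SmoothNear

theorem smoothNear_coord (i : Fin d) : SmoothNear (coord i) :=
  SmoothNear.of_contDiff (contDiff_coord i)

end SmoothNear

/-! ### Square integrable functions -/

section L2

variable {α : Type*} [MeasurableSpace α] {μ : Measure α}

/-- Cauchy–Schwarz; the pairing here is bilinear, so the first factor is conjugated before the `L²`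
inner product is used. -/
theorem norm_integral_mul_le {f g : α → ℂ} (hf : MemLp f 2 μ) (hg : MemLp g 2 μ) :
    ‖∫ x, f x * g x ∂μ‖ ≤ (eLpNorm f 2 μ).toReal * (eLpNorm g 2 μ).toReal := by
  have hs : MemLp (fun x => star (f x)) 2 μ := hf.star
  have h := norm_inner_le_norm (𝕜 := ℂ) (hs.toLp _) (hg.toLp _)
  rw [L2.inner_def, Lp.norm_toLp, Lp.norm_toLp] at h
  have h1 : eLpNorm (fun x => star (f x)) 2 μ = eLpNorm f 2 μ :=
    eLpNorm_congr_norm_ae (Filter.Eventually.of_forall fun x => by simp)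
  rw [h1] at h
  refine le_of_eq_of_le (congrArg norm (integral_congr_ae ?_)) h
  filter_upwards [hs.coeFn_toLp, hg.coeFn_toLp] with x h2 h3
  rw [h2, h3]
  simp [mul_comm]

theorem MemLp.integrable_mul' {f g : α → ℂ} (hf : MemLp f 2 μ) (hg : MemLp g 2 μ) :
    Integrable (fun x => f x * g x) μ := hf.integrable_mul hg

/-- Convergence of a sequence in `L²`. -/
def TendstoL2 (μ : Measure α) (f : ℕ → α → ℂ) (g : α → ℂ) : Prop :=
  (∀ n, MemLp (f n) 2 μ) ∧ MemLp g 2 μ ∧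
    Filter.Tendsto (fun n => eLpNorm (fun x => f n x - g x) 2 μ) Filter.atTop (nhds 0)

theorem TendstoL2.toReal {f : ℕ → α → ℂ} {g : α → ℂ} (h : TendstoL2 μ f g) :
    Filter.Tendsto (fun n => (eLpNorm (fun x => f n x - g x) 2 μ).toReal) Filter.atTop
      (nhds 0) := by
  have := (ENNReal.tendsto_toReal (ENNReal.zero_ne_top)).comp h.2.2
  simpa [Function.comp_def] using this

theorem TendstoL2.integral_mul {f f' : ℕ → α → ℂ} {g g' : α → ℂ} (h : TendstoL2 μ f g)
    (h' : TendstoL2 μ f' g') :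
    Filter.Tendsto (fun n => ∫ x, f n x * f' n x ∂μ) Filter.atTop
      (nhds (∫ x, g x * g' x ∂μ)) := by
  rw [tendsto_iff_norm_sub_tendsto_zero]
  have hb : ∀ n, ‖(∫ x, f n x * f' n x ∂μ) - ∫ x, g x * g' x ∂μ‖ ≤
      (eLpNorm (fun x => f n x - g x) 2 μ).toReal * (eLpNorm (fun x => f' n x - g' x) 2 μ).toReal
      + (eLpNorm (fun x => f n x - g x) 2 μ).toReal * (eLpNorm g' 2 μ).toReal
      + (eLpNorm g 2 μ).toReal * (eLpNorm (fun x => f' n x - g' x) 2 μ).toReal := by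
    intro n
    have m1 : MemLp (fun x => f n x - g x) 2 μ := (h.1 n).sub h.2.1
    have m2 : MemLp (fun x => f' n x - g' x) 2 μ := (h'.1 n).sub h'.2.1
    have e : (∫ x, f n x * f' n x ∂μ) - ∫ x, g x * g' x ∂μ =
        (∫ x, (f n x - g x) * (f' n x - g' x) ∂μ) + (∫ x, (f n x - g x) * g' x ∂μ) +
          ∫ x, g x * (f' n x - g' x) ∂μ := by
      rw [← integral_sub, ← integral_add, ← integral_add]
      · congr 1; ext x; ring
      · exact (MemLp.integrable_mul' m1 m2).add (MemLp.integrable_mul' m1 h'.2.1)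
      · exact MemLp.integrable_mul' h.2.1 m2
      · exact MemLp.integrable_mul' m1 m2
      · exact MemLp.integrable_mul' m1 h'.2.1
      · exact MemLp.integrable_mul' (h.1 n) (h'.1 n)
      · exact MemLp.integrable_mul' h.2.1 h'.2.1
    rw [e]
    refine (norm_add₃_le).trans ?_
    gcongr
    · exact norm_integral_mul_le m1 m2
    · exact norm_integral_mul_le m1 h'.2.1
    · exact norm_integral_mul_le h.2.1 m2
  refine squeeze_zero (fun n => norm_nonneg _) hb ?_
  have := ((h.toReal.mul h'.toReal).add (h.toReal.mul_const (eLpNorm g' 2 μ).toReal)).add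
    (h'.toReal.const_mul (eLpNorm g 2 μ).toReal)
  simpa using this

theorem TendstoL2.const {g : α → ℂ} (hg : MemLp g 2 μ) : TendstoL2 μ (fun _ => g) g :=
  ⟨fun _ => hg, hg, by simp⟩

theorem TendstoL2.star {f : ℕ → α → ℂ} {g : α → ℂ} (h : TendstoL2 μ f g) :
    TendstoL2 μ (fun n x => star (f n x)) (fun x => star (g x)) := by
  refine ⟨fun n => (h.1 n).star, h.2.1.star, h.2.2.congr fun n => ?_⟩
  refine eLpNorm_congr_norm_ae (Filter.Eventually.of_forall fun x => ?_)
  rw [← star_sub, norm_star]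

theorem TendstoL2.restrict {f : ℕ → α → ℂ} {g : α → ℂ} (h : TendstoL2 μ f g) (s : Set α) :
    TendstoL2 (μ.restrict s) f g := by
  refine ⟨fun n => (h.1 n).restrict s, h.2.1.restrict s, ?_⟩
  exact tendsto_of_tendsto_of_tendsto_of_le_of_le tendsto_const_nhds h.2.2
    (fun n => zero_le) fun n => eLpNorm_mono_measure _ Measure.restrict_le_self

end L2

/-! ### Boundary values on the unit sphere -/

section Trace

variable {d : ℕ} {U V : Set (Euc d)}

/-- The function `u ∈ H¹(U)`, where `U ⊆ 𝔹`, has boundary values `f` on the unit sphere and `0` on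
the remaining part of the boundary of `U`. -/
def BdryTrace (u : H1 U) (f : Sph d → ℂ) : Prop :=
  MemLp f 2 (surf d) ∧
  ∀ (i : Fin d) (ψ : Euc d → ℂ), ContDiff ℝ ∞ ψ →
    ∫ x in U, (u.val x * partialD i ψ x + u.grad i x * ψ x) =
      ∫ x : Sph d, f x * ψ x * ((x : Euc d) i : ℂ) ∂(surf d)

/-- With zero data the integral over the boundary of the hole drops out. The holed problem and the
full-ball problem (where `HasTrace` unfolds to the same formula) thus become instances of one
condition and share all proofs below. -/
theorem bCHoled_eq_bdryTrace (C : Euc d) (R : ℝ) : BCHoled C R = BdryTrace := by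
  funext u f
  simp [BCHoled, HasTraces, BdryTrace]

theorem memLp_mul_of_continuousOn (hU : MeasurableSet U) (hUb : U ⊆ ball 0 1) {v φ : Euc d → ℂ}
    (hv : MemLp v 2 (volume.restrict U)) (hφ : ContinuousOn φ (closedBall 0 1)) :
    MemLp (fun x => v x * φ x) 2 (volume.restrict U) := by
  obtain ⟨M, hM⟩ := ((isCompact_closedBall (0 : Euc d) 1).image_of_continuousOn hφ).isBounded
    |>.exists_norm_le
  have hUc : U ⊆ closedBall 0 1 := hUb.trans ball_subset_closedBall
  refine MemLp.of_le_mul (c := M) hv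
    (hv.1.mul ((hφ.mono hUc).aestronglyMeasurable hU)) ?_
  filter_upwards [ae_restrict_mem hU] with x hx
  rw [norm_mul, mul_comm]
  gcongr
  exact hM _ ⟨x, hUc hx, rfl⟩

theorem memLp_of_continuousOn (hU : MeasurableSet U) (hUb : U ⊆ ball 0 1) {φ : Euc d → ℂ}
    (hφ : ContinuousOn φ (closedBall 0 1)) : MemLp φ 2 (volume.restrict U) := by
  have : IsFiniteMeasure ((volume : Measure (Euc d)).restrict U) :=
    ⟨by rw [Measure.restrict_apply_univ]
        exact (measure_mono hUb).trans_lt measure_ball_lt_top⟩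
  simpa using memLp_mul_of_continuousOn hU hUb (memLp_const (1 : ℂ)) hφ

theorem integrable_of_memLp (hUb : U ⊆ ball 0 1) {v : Euc d → ℂ}
    (hv : MemLp v 2 (volume.restrict U)) : Integrable v (volume.restrict U) := by
  have : IsFiniteMeasure ((volume : Measure (Euc d)).restrict U) :=
    ⟨by rw [Measure.restrict_apply_univ]
        exact (measure_mono hUb).trans_lt measure_ball_lt_top⟩
  exact hv.integrable (by norm_num)

theorem integrable_mul_of_continuousOn (hU : MeasurableSet U) (hUb : U ⊆ ball 0 1)
    {v φ : Euc d → ℂ} (hv : MemLp v 2 (volume.restrict U))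
    (hφ : ContinuousOn φ (closedBall 0 1)) :
    Integrable (fun x => v x * φ x) (volume.restrict U) :=
  integrable_of_memLp hUb (memLp_mul_of_continuousOn hU hUb hv hφ)

/-- Both sides see the test function only near the closed ball. This admits tests built from `g_a`
and `I_a`, whose singularity `â` lies outside the closed ball. -/
theorem BdryTrace.integral_smoothNear {u : H1 U} {f : Sph d → ℂ} (h : BdryTrace u f)
    (hU : MeasurableSet U) (hUb : U ⊆ ball 0 1) {ψ : Euc d → ℂ} (hψ : SmoothNear ψ) (i : Fin d) :
    ∫ x in U, (u.val x * partialD i ψ x + u.grad i x * ψ x) =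
      ∫ x : Sph d, f x * ψ x * coord i x ∂(surf d) := by
  obtain ⟨ψ', h1, -, h3⟩ := hψ.exists_contDiff
  have := h.2 i ψ' h1
  convert this using 1
  · refine setIntegral_congr_fun hU fun x hx => ?_
    have hx' := h3 x (ball_subset_closedBall (hUb hx))
    simp only [hx'.eq_of_nhds, partialD_congr i hx']
  · congr 1
    ext x
    rw [(h3 x (sphere_subset_closedBall x.2)).eq_of_nhds]; rfl

/-- The integration by parts formula with boundary values implies weak differentiability. -/
theorem weak_of_trace (hU : MeasurableSet U) (hUb : U ⊆ ball 0 1) {v g : Euc d → ℂ} {i : Fin d}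
    {f : Sph d → ℂ}
    (hv : MemLp v 2 (volume.restrict U)) (hg : MemLp g 2 (volume.restrict U))
    (h : ∀ ψ : Euc d → ℂ, ContDiff ℝ ∞ ψ → ∫ x in U, (v x * partialD i ψ x + g x * ψ x) =
      ∫ x : Sph d, f x * ψ x * ((x : Euc d) i : ℂ) ∂(surf d))
    (φ : Euc d → ℂ) (hφ : ContDiff ℝ ∞ φ) (hs : tsupport φ ⊆ U) :
    ∫ x in U, v x * partialD i φ x = - ∫ x in U, g x * φ x := by
  have h1 := h φ hφ
  rw [integral_add (integrable_mul_of_continuousOn hU hUb hv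
    (contDiff_partialD hφ i).continuous.continuousOn)
    (integrable_mul_of_continuousOn hU hUb hg hφ.continuous.continuousOn)] at h1
  have h2 : ∀ x : Sph d, φ x = 0 := by
    intro x
    by_contra hx
    have := hUb (hs (subset_tsupport φ hx))
    have hx : ‖(x : Euc d)‖ = 1 := by simp
    simp [hx] at this
  simp only [h2, mul_zero, zero_mul, integral_zero] at h1
  linear_combination h1

/-- Restriction of an `H¹` function to a smaller set, multiplied by a smooth function that
vanishes to first order on the difference of the two sets. -/
def H1.cutMul (u : H1 V) (hU : MeasurableSet U) (hV : MeasurableSet V) (hUV : U ⊆ V)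
    (hVb : V ⊆ ball 0 1) (m : Euc d → ℂ) (hm : SmoothNear m) : H1 U where
  val x := u.val x * m x
  grad i x := u.grad i x * m x + u.val x * partialD i m x
  memLp_val := memLp_mul_of_continuousOn hU (hUV.trans hVb)
    (u.memLp_val.mono_measure (Measure.restrict_mono hUV le_rfl)) hm.continuousOn
  memLp_grad i := (memLp_mul_of_continuousOn hU (hUV.trans hVb)
    ((u.memLp_grad i).mono_measure (Measure.restrict_mono hUV le_rfl)) hm.continuousOn).add
    (memLp_mul_of_continuousOn hU (hUV.trans hVb)
    (u.memLp_val.mono_measure (Measure.restrict_mono hUV le_rfl)) (hm.partialD i).continuousOn)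
  weak i φ hφ hc hs := by
    obtain ⟨m', h1, -, h3⟩ := hm.exists_contDiff
    have hUb := hUV.trans hVb
    have hs' : tsupport (fun x => m' x * φ x) ⊆ U :=
      (tsupport_mul_subset_right (f := m') (g := φ)).trans hs
    -- The product rule for `m u` is the weak identity of `u` tested with `m' φ`, where `m'` is a
    -- global smooth function agreeing with `m` near the closed ball.
    have hw := u.weak i (fun x => m' x * φ x) (h1.mul hφ) (hc.mul_left) (hs'.trans hUV)
    have key : ∀ F : Euc d → ℂ, (∀ x ∉ U, F x = 0) → ∫ x in V, F x = ∫ x in U, F x := by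
      intro F hF
      exact setIntegral_eq_of_subset_of_forall_sdiff_eq_zero hV hUV fun x hx => hF x hx.2
    have z1 : ∀ x ∉ U, φ x = 0 := fun x hx => by
      by_contra h
      exact hx (hs (subset_tsupport φ h))
    have z2 : ∀ x ∉ U, partialD i (fun x => m' x * φ x) x = 0 := fun x hx => by
      by_contra h
      exact hx (hs' (tsupport_partialD_subset _ i (subset_tsupport _ h)))
    rw [key _ fun x hx => by rw [z2 x hx, mul_zero],
      key _ fun x hx => by simp [z1 x hx]] at hw
    have mu := u.memLp_val.mono_measure (Measure.restrict_mono hUV (le_refl volume))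
    have mg := (u.memLp_grad i).mono_measure (Measure.restrict_mono hUV (le_refl volume))
    have c1 : ContinuousOn (fun x => m x * φ x) (closedBall 0 1) :=
      hm.continuousOn.mul hφ.continuous.continuousOn
    have c2 : ContinuousOn (fun x => partialD i m x * φ x) (closedBall 0 1) :=
      (hm.partialD i).continuousOn.mul hφ.continuous.continuousOn
    have c3 : ContinuousOn (fun x => m x * partialD i φ x) (closedBall 0 1) :=
      hm.continuousOn.mul (contDiff_partialD hφ i).continuous.continuousOn
    have e1 : ∫ x in U, u.val x * partialD i (fun x => m' x * φ x) x =
        (∫ x in U, u.val x * (partialD i m x * φ x)) +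
          ∫ x in U, u.val x * (m x * partialD i φ x) := by
      rw [← integral_add (integrable_mul_of_continuousOn hU hUb mu c2)
        (integrable_mul_of_continuousOn hU hUb mu c3)]
      refine setIntegral_congr_fun hU fun x hx => ?_
      have hx' := h3 x (ball_subset_closedBall (hUb hx))
      rw [partialD_mul i (h1.differentiable (by simp) x) (hφ.differentiable (by simp) x),
        partialD_congr i hx', hx'.eq_of_nhds]
      ring
    have e2 : ∫ x in U, u.grad i x * (m' x * φ x) = ∫ x in U, u.grad i x * (m x * φ x) := by
      refine setIntegral_congr_fun hU fun x hx => ?_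
      rw [(h3 x (ball_subset_closedBall (hUb hx))).eq_of_nhds]
    have e3 : ∫ x in U, (u.grad i x * m x + u.val x * partialD i m x) * φ x =
        (∫ x in U, u.grad i x * (m x * φ x)) + ∫ x in U, u.val x * (partialD i m x * φ x) := by
      rw [← integral_add (integrable_mul_of_continuousOn hU hUb mg c1)
        (integrable_mul_of_continuousOn hU hUb mu c2)]
      congr 1; ext x; ring
    have e4 : ∫ x in U, u.val x * m x * partialD i φ x =
        ∫ x in U, u.val x * (m x * partialD i φ x) := by
      congr 1; ext x; ring
    rw [e3, e4]
    rw [e1, e2] at hw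
    linear_combination hw

theorem memLp_mul_sphere {f g : Sph d → ℂ} (hf : MemLp f 2 (surf d)) (hg : Continuous g) :
    MemLp (fun x => f x * g x) 2 (surf d) := by
  obtain ⟨M, hM⟩ := (isCompact_range hg).isBounded.exists_norm_le
  refine MemLp.of_le_mul (c := M) hf (hf.1.mul hg.aestronglyMeasurable)
    (Filter.Eventually.of_forall fun x => ?_)
  rw [norm_mul, mul_comm]
  gcongr
  exact hM _ ⟨x, rfl⟩

/-- Test the identity for `u` with `m ψ`. Because `m` and its gradient vanish on `V \ U`, only the
integral over `U` survives, which encodes zero data on the new part of the boundary. -/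
theorem BdryTrace.cutMul {u : H1 V} {f : Sph d → ℂ} (h : BdryTrace u f) (hU : MeasurableSet U)
    (hV : MeasurableSet V) (hUV : U ⊆ V) (hVb : V ⊆ ball 0 1) {m : Euc d → ℂ}
    (hm : SmoothNear m) (h0 : ∀ x ∈ V \ U, m x = 0 ∧ ∀ i, partialD i m x = 0) :
    BdryTrace (u.cutMul hU hV hUV hVb m hm) (fun x => f x * m x) := by
  refine ⟨memLp_mul_sphere h.1 hm.continuous_sphere, fun i ψ hψ => ?_⟩
  have h1 := h.integral_smoothNear hV hVb (hm.mul (.of_contDiff hψ)) i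
  convert h1 using 1
  · rw [setIntegral_eq_of_subset_of_forall_sdiff_eq_zero (s := U) hV hUV]
    · refine setIntegral_congr_fun hU fun x hx => ?_
      simp only [H1.cutMul]
      rw [partialD_mul i (hm.differentiableAt (ball_subset_closedBall (hVb (hUV hx))))
        (hψ.differentiable (by simp) x)]
      ring
    · intro x hx
      rw [partialD_mul i (hm.differentiableAt (ball_subset_closedBall (hVb hx.1)))
        (hψ.differentiable (by simp) x), (h0 x hx).1, (h0 x hx).2]
      ring
  · congr 1; ext x; simp only [coord]; ring

end Trace

/-! ### Mollification -/

section Mollify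

variable {d : ℕ}

/-- A bump function on `ℝ^d` supported in the ball of radius `1/(n+1)`. -/
def bump (d n : ℕ) : ContDiffBump (0 : Euc d) where
  rIn := 1 / (2 * (n + 1))
  rOut := 1 / (n + 1)
  rIn_pos := by positivity
  rIn_lt_rOut := by
    rw [one_div_lt_one_div (by positivity) (by positivity)]
    have : (0 : ℝ) < n + 1 := by positivity
    linarith

/-- The normalized bump function. -/
def bumpN (d n : ℕ) : Euc d → ℝ := (bump d n).normed volume

/-- Mollification by the normalized bump function. -/
def mollify (n : ℕ) (f : Euc d → ℂ) : Euc d → ℂ :=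
  convolution (bumpN d n) f (ContinuousLinearMap.lsmul ℝ ℝ) volume

theorem contDiff_bumpN (n : ℕ) : ContDiff ℝ ∞ (bumpN d n) := (bump d n).contDiff_normed

theorem hasCompactSupport_bumpN (n : ℕ) : HasCompactSupport (bumpN d n) :=
  (bump d n).hasCompactSupport_normed

theorem contDiff_mollify (n : ℕ) {f : Euc d → ℂ} (hf : MemLp f 2 volume) :
    ContDiff ℝ ∞ (mollify n f) :=
  (hasCompactSupport_bumpN n).contDiff_convolution_left _ (contDiff_bumpN n)
    (hf.locallyIntegrable (by norm_num))

theorem mollify_apply (n : ℕ) (f : Euc d → ℂ) (x : Euc d) :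
    mollify n f x = ∫ t, bumpN d n t • f (x - t) := rfl

theorem mollify_apply' (n : ℕ) (f : Euc d → ℂ) (x : Euc d) :
    mollify n f x = ∫ t, bumpN d n (x - t) • f t := by
  rw [mollify, convolution_lsmul_swap]

/-- Differentiate the kernel, then use the hypothesis with the test function `t ↦ η(x - t)`. The
hypothesis ranges over all compactly supported tests on the whole space, so `g` is the global weak
derivative of `f`. -/
theorem partialD_mollify (n : ℕ) {f g : Euc d → ℂ} {i : Fin d} (hf : MemLp f 2 volume)
    (h : ∀ ψ : Euc d → ℂ, ContDiff ℝ ∞ ψ → HasCompactSupport ψ →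
      ∫ x, f x * partialD i ψ x = - ∫ x, g x * ψ x) (x : Euc d) :
    partialD i (mollify n f) x = mollify n g x := by
  have h1 := (hasCompactSupport_bumpN n).hasFDerivAt_convolution_left (μ := volume)
    (ContinuousLinearMap.lsmul ℝ ℝ) ((contDiff_bumpN (d := d) n).of_le (by simp))
    (hf.locallyIntegrable (by norm_num)) x
  have hsm : ContDiff ℝ ∞ (fun t => ((bumpN d n (x - t) : ℝ) : ℂ)) :=
    Complex.ofRealCLM.contDiff.comp ((contDiff_bumpN n).comp (contDiff_const.sub contDiff_id))
  have hcs : HasCompactSupport (fun t => ((bumpN d n (x - t) : ℝ) : ℂ)) := by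
    have : HasCompactSupport (fun t => bumpN d n (x - t)) :=
      (hasCompactSupport_bumpN n).comp_homeomorph (Homeomorph.subLeft x)
    exact this.comp_left (g := fun r : ℝ => (r : ℂ)) (by simp)
  -- The chain rule contributes a minus sign, which cancels the one from integration by parts.
  have hp : ∀ t, partialD i (fun t => ((bumpN d n (x - t) : ℝ) : ℂ)) t =
      -((fderiv ℝ (bumpN d n) (x - t) (EuclideanSpace.single i 1) : ℝ) : ℂ) := by
    intro t
    have e1 : HasFDerivAt (fun t => bumpN d n (x - t))
        ((fderiv ℝ (bumpN d n) (x - t)).comp (-ContinuousLinearMap.id ℝ (Euc d))) t :=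
      (((contDiff_bumpN n).differentiable (by simp)) (x - t)).hasFDerivAt.comp t
        ((hasFDerivAt_id t).const_sub x)
    have e2 := Complex.ofRealCLM.hasFDerivAt.comp t e1
    have e3 : fderiv ℝ (fun t => ((bumpN d n (x - t) : ℝ) : ℂ)) t = _ := e2.fderiv
    rw [partialD, e3]
    simp
  have h2 := h _ hsm hcs
  simp only [hp] at h2
  rw [partialD, show fderiv ℝ (mollify n f) x = _ from h1.fderiv, mollify_apply', ← convolution_flip]
  rw [convolution_def, ContinuousLinearMap.integral_apply]
  · simp only [ContinuousLinearMap.flip_apply, ContinuousLinearMap.precompL_apply,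
      ContinuousLinearMap.lsmul_apply, Complex.real_smul]
    have e4 : ∫ t, ((bumpN d n (x - t) : ℝ) : ℂ) * g t =
        ∫ t, g t * ((bumpN d n (x - t) : ℝ) : ℂ) := by congr 1; ext t; ring
    rw [e4, ← neg_eq_iff_eq_neg.2 h2, ← integral_neg]
    congr 1; ext t; ring
  · have hc : HasCompactSupport (fderiv ℝ (bumpN d n)) := (hasCompactSupport_bumpN n).fderiv ℝ
    have := hc.convolutionExists_left (μ := volume)
      (ContinuousLinearMap.precompL (Euc d) (ContinuousLinearMap.lsmul ℝ ℝ))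
      ((contDiff_bumpN n).continuous_fderiv (by simp)) (hf.locallyIntegrable (by norm_num)) x
    exact this.integrable_swap

/-- Translations act continuously on `L²`; the function is passed to its class in `Lp` and the
action is evaluated near the neutral element. -/
theorem tendsto_eLpNorm_translate {f : Euc d → ℂ} (hf : MemLp f 2 volume) :
    Filter.Tendsto (fun t : Euc d => eLpNorm (fun x => f (x - t) - f x) 2 volume) (nhds 0)
      (nhds 0) := by
  have : Fact ((2 : ENNReal) ≠ ⊤) := ⟨by simp⟩
  let F : Lp ℂ 2 (volume : Measure (Euc d)) := hf.toLp f
  have hc : Continuous fun t : Euc d => (DomAddAct.mk (-t)) +ᵥ F :=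
    (continuous_vadd.comp ((DomAddAct.continuous_mk.comp continuous_neg).prodMk continuous_const))
  have h1 : Filter.Tendsto (fun t : Euc d => ‖((DomAddAct.mk (-t)) +ᵥ F) - F‖ₑ) (nhds 0)
      (nhds 0) := by
    have := (hc.sub (continuous_const (y := F))).enorm.tendsto 0
    simpa using this
  refine h1.congr fun t => ?_
  rw [Lp.enorm_def]
  apply eLpNorm_congr_ae
  have mp : MeasurePreserving (fun x : Euc d => -t + x) volume volume :=
    measurePreserving_add_left _ _
  have e1 : (((DomAddAct.mk (-t)) +ᵥ F : Lp ℂ 2 (volume : Measure (Euc d))) : Euc d → ℂ)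
      =ᵐ[volume] fun x => F (-t + x) := Lp.coeFn_compMeasurePreserving _ mp
  have e2 : F =ᵐ[volume] f := hf.coeFn_toLp
  filter_upwards [Lp.coeFn_sub ((DomAddAct.mk (-t)) +ᵥ F) F, e1, e2,
    mp.quasiMeasurePreserving.ae_eq_comp e2] with x a1 a2 a3 a4
  simp only [Function.comp] at a4
  rw [a1, Pi.sub_apply, a2, a3, a4, neg_add_eq_sub]

theorem eLpNorm_two_sq {α : Type*} [MeasurableSpace α] (μ : Measure α) (g : α → ℂ) :
    eLpNorm g 2 μ ^ 2 = ∫⁻ x, ‖g x‖ₑ ^ 2 ∂μ := by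
  have h := eLpNorm_nnreal_pow_eq_lintegral (f := g) (μ := μ) (p := 2) (by norm_num)
  norm_cast at h
  simpa using h

theorem integral_mul_star {α : Type*} [MeasurableSpace α] (μ : Measure α) (g : α → ℂ) :
    ∫ x, g x * star (g x) ∂μ = ((∫ x, ‖g x‖ ^ 2 ∂μ : ℝ) : ℂ) := by
  rw [← integral_complex_ofReal]
  congr 1; ext x
  rw [Complex.star_def, Complex.mul_conj, Complex.normSq_eq_norm_sq]

theorem toReal_eLpNorm_two_sq {α : Type*} [MeasurableSpace α] {μ : Measure α} {g : α → ℂ}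
    (hg : MemLp g 2 μ) : (eLpNorm g 2 μ).toReal ^ 2 = ∫ x, ‖g x‖ ^ 2 ∂μ := by
  have e2 : ∀ x, ‖g x‖ₑ ^ 2 = ENNReal.ofReal (‖g x‖ ^ 2) := fun x => by
    rw [ENNReal.ofReal_pow (norm_nonneg _), ofReal_norm]
  rw [← ENNReal.toReal_pow, eLpNorm_two_sq]
  simp only [e2]
  rw [← ofReal_integral_eq_lintegral_ofReal (hg.integrable_norm_pow (by norm_num))
    (Filter.Eventually.of_forall fun x => by positivity),
    ENNReal.toReal_ofReal (integral_nonneg fun x => by positivity)]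

/-- The kernel is a probability density, so the mollification error is a mean of `f(x - t) - f(x)`;
its square is at most the mean of the squares, by comparing the `L¹` and `L²` norms. -/
theorem enorm_mollify_sub_sq_le (n : ℕ) {f : Euc d → ℂ} (hf : MemLp f 2 volume)
    (hm : StronglyMeasurable f) (x : Euc d) :
    ‖mollify n f x - f x‖ₑ ^ 2 ≤
      ∫⁻ t, ‖f (x - t) - f x‖ₑ ^ 2 * ENNReal.ofReal (bumpN d n t) := by
  have hη0 : ∀ t, 0 ≤ bumpN d n t := fun t => (bump d n).nonneg_normed t
  have hηi : Integrable (bumpN d n) volume :=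
    (contDiff_bumpN n).continuous.integrable_of_hasCompactSupport (hasCompactSupport_bumpN n)
  have hη1 : ∫ t, bumpN d n t = 1 := (bump d n).integral_normed
  have hmη : Measurable fun t => ENNReal.ofReal (bumpN d n t) :=
    (contDiff_bumpN n).continuous.measurable.ennreal_ofReal
  let ν := (volume : Measure (Euc d)).withDensity fun t => ENNReal.ofReal (bumpN d n t)
  have hν : IsProbabilityMeasure ν := ⟨by
    rw [withDensity_apply _ MeasurableSet.univ, Measure.restrict_univ,
      ← ofReal_integral_eq_lintegral_ofReal hηi (Filter.Eventually.of_forall hη0), hη1]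
    simp⟩
  have hh : Measurable fun t => f (x - t) - f x :=
    (hm.measurable.comp (measurable_const.sub measurable_id)).sub_const _
  have e1 : mollify n f x - f x = ∫ t, bumpN d n t • (f (x - t) - f x) := by
    simp only [smul_sub]
    rw [integral_sub, integral_smul_const, hη1, one_smul, mollify_apply]
    · exact (hasCompactSupport_bumpN n).convolutionExists_left (μ := volume)
        (ContinuousLinearMap.lsmul ℝ ℝ) (contDiff_bumpN n).continuous
        (hf.locallyIntegrable (by norm_num)) x
    · exact hηi.smul_const _
  have e2 : ‖mollify n f x - f x‖ₑ ≤ eLpNorm (fun t => f (x - t) - f x) 2 ν := by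
    refine le_trans ?_ (eLpNorm_le_eLpNorm_of_exponent_le (p := 1) (by norm_num)
      hh.aestronglyMeasurable)
    rw [e1, eLpNorm_one_eq_lintegral_enorm,
      lintegral_withDensity_eq_lintegral_mul _ hmη hh.enorm]
    refine (enorm_integral_le_lintegral_enorm _).trans (le_of_eq ?_)
    congr 1; ext t
    rw [enorm_smul, Pi.mul_apply, Real.enorm_of_nonneg (hη0 t)]
  calc _ ≤ eLpNorm (fun t => f (x - t) - f x) 2 ν ^ 2 := by gcongr
    _ = _ := by
      rw [eLpNorm_two_sq, lintegral_withDensity_eq_lintegral_mul _ hmη (hh.enorm.pow_const _)]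
      congr 1; ext t; simp [mul_comm]

/-- Integrate the pointwise bound in `x` and swap the integrals: the squared error is a mean of
squared translation errors over the support of the kernel. -/
theorem eLpNorm_mollify_sub_le {n : ℕ} {f : Euc d → ℂ} (hf : MemLp f 2 volume) {ε : ENNReal}
    (h : ∀ t : Euc d, ‖t‖ < 1 / (n + 1) → eLpNorm (fun x => f (x - t) - f x) 2 volume ≤ ε) :
    eLpNorm (fun x => mollify n f x - f x) 2 volume ≤ ε := by
  -- Both sides depend only on the almost everywhere class of `f`; a measurable representative gives
  -- the joint measurability required for the exchange of integrals.
  wlog hm : StronglyMeasurable f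
  · obtain ⟨g, hg, hfg⟩ := hf.1
    have e : ∀ t : Euc d, (fun x => f (x - t) - f x) =ᵐ[volume] fun x => g (x - t) - g x := by
      intro t
      have := (measurePreserving_sub_right (volume : Measure (Euc d)) t
        ).quasiMeasurePreserving.ae_eq_comp hfg
      filter_upwards [hfg, this] with x h1 h2
      simp only [Function.comp] at h2
      rw [h1, h2]
    have e' : (fun x => mollify n f x - f x) =ᵐ[volume] fun x => mollify n g x - g x := by
      filter_upwards [hfg] with x hx
      rw [hx]
      congr 1
      rw [mollify_apply', mollify_apply']
      refine integral_congr_ae ?_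
      filter_upwards [hfg] with t ht
      rw [ht]
    rw [eLpNorm_congr_ae e']
    refine this ((memLp_congr_ae hfg).1 hf) (fun t ht => ?_) hg
    rw [← eLpNorm_congr_ae (e t)]
    exact h t ht
  have hηi : Integrable (bumpN d n) volume :=
    (contDiff_bumpN n).continuous.integrable_of_hasCompactSupport (hasCompactSupport_bumpN n)
  have key : eLpNorm (fun x => mollify n f x - f x) 2 volume ^ 2 ≤ ε ^ 2 := by
    rw [eLpNorm_two_sq]
    calc ∫⁻ x, ‖mollify n f x - f x‖ₑ ^ 2
        ≤ ∫⁻ x, ∫⁻ t, ‖f (x - t) - f x‖ₑ ^ 2 * ENNReal.ofReal (bumpN d n t) :=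
          lintegral_mono fun x => enorm_mollify_sub_sq_le n hf hm x
      _ = ∫⁻ t, ∫⁻ x, ‖f (x - t) - f x‖ₑ ^ 2 * ENNReal.ofReal (bumpN d n t) := by
          refine lintegral_lintegral_swap (Measurable.aemeasurable ?_)
          refine Measurable.mul ((Measurable.enorm ?_).pow_const 2) ?_
          · exact (hm.measurable.comp (measurable_fst.sub measurable_snd)).sub
              (hm.measurable.comp measurable_fst)
          · exact ((contDiff_bumpN n).continuous.measurable.comp measurable_snd).ennreal_ofReal
      _ ≤ ∫⁻ t, ε ^ 2 * ENNReal.ofReal (bumpN d n t) := by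
          refine lintegral_mono fun t => ?_
          rw [lintegral_mul_const' _ _ ENNReal.ofReal_ne_top]
          by_cases ht : ‖t‖ < 1 / (n + 1)
          · rw [← eLpNorm_two_sq]
            gcongr
            exact h t ht
          · have : bumpN d n t = 0 := by
              have hs : Function.support (bumpN d n) = ball 0 (bump d n).rOut :=
                (bump d n).support_normed_eq
              rw [← Function.notMem_support, hs]
              simpa [bump] using ht
            simp [this]
      _ = ε ^ 2 := by
          rw [lintegral_const_mul _ (contDiff_bumpN n).continuous.measurable.ennreal_ofReal,
            ← ofReal_integral_eq_lintegral_ofReal hηi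
              (Filter.Eventually.of_forall fun t => (bump d n).nonneg_normed t),
            show ∫ t, bumpN d n t = 1 from (bump d n).integral_normed]
          simp
  exact (ENNReal.pow_le_pow_left_iff (by norm_num)).1 key

theorem tendstoL2_mollify {f : Euc d → ℂ} (hf : MemLp f 2 volume) :
    TendstoL2 volume (fun n => mollify n f) f := by
  have hb : ∀ ε : ENNReal, 0 < ε → ε ≠ ⊤ → ∃ N : ℕ, ∀ n ≥ N,
      eLpNorm (fun x => mollify n f x - f x) 2 volume ≤ ε := by
    intro ε hε _
    obtain ⟨δ, hδ, h⟩ := Metric.eventually_nhds_iff.1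
      ((tendsto_eLpNorm_translate hf).eventually_le_const hε)
    obtain ⟨N, hN⟩ := exists_nat_one_div_lt hδ
    refine ⟨N, fun n hn => eLpNorm_mollify_sub_le hf fun t ht => h ?_⟩
    rw [dist_zero_right]
    refine ht.trans_le ((Nat.one_div_le_one_div hn).trans hN.le)
  refine ⟨fun n => ?_, hf, ?_⟩
  · have hc := (contDiff_mollify n hf).continuous.aestronglyMeasurable (μ := volume)
    -- The crude translation bound `2 ‖f‖`, valid for every shift, already shows that the error is
    -- square integrable.
    have h1 : MemLp (fun x => mollify n f x - f x) 2 volume := by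
      refine ⟨hc.sub hf.1, lt_of_le_of_lt (b := eLpNorm f 2 volume + eLpNorm f 2 volume)
        (eLpNorm_mollify_sub_le hf fun t _ => ?_) (ENNReal.add_lt_top.2 ⟨hf.2, hf.2⟩)⟩
      have mp := measurePreserving_sub_right (volume : Measure (Euc d)) t
      refine (eLpNorm_sub_le (hf.1.comp_measurePreserving mp) hf.1 (by norm_num)).trans ?_
      rw [eLpNorm_comp_measurePreserving hf.1 mp]
    have := h1.add hf
    refine (memLp_congr_ae (Filter.Eventually.of_forall fun x => ?_)).1 this
    simp
  · rw [ENNReal.tendsto_atTop_zero]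
    intro ε hε
    by_cases hε' : ε = ⊤
    · exact ⟨0, fun n _ => by simp [hε']⟩
    · exact hb ε hε hε'

end Mollify

/-! ### Linear operations and smooth functions in `H¹` -/

section Linear

variable {d : ℕ} {U : Set (Euc d)}

theorem integrable_mul_test {v φ : Euc d → ℂ} (hv : MemLp v 2 (volume.restrict U))
    (hφ : ContDiff ℝ ∞ φ) (hc : HasCompactSupport φ) :
    Integrable (fun x => v x * φ x) (volume.restrict U) :=
  MemLp.integrable_mul' hv (hφ.continuous.memLp_of_hasCompactSupport hc)

/-- The linear combination `u + c v` in `H¹(U)`. -/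
def H1.combo (u : H1 U) (c : ℂ) (v : H1 U) : H1 U where
  val x := u.val x + c * v.val x
  grad i x := u.grad i x + c * v.grad i x
  memLp_val := u.memLp_val.add (v.memLp_val.const_mul c)
  memLp_grad i := (u.memLp_grad i).add ((v.memLp_grad i).const_mul c)
  weak i φ hφ hc hs := by
    have hp := contDiff_partialD hφ i
    have hpc := hasCompactSupport_partialD hc i
    simp only [add_mul, mul_assoc]
    rw [integral_add (integrable_mul_test u.memLp_val hp hpc)
        ((integrable_mul_test v.memLp_val hp hpc).const_mul c),
      integral_add (integrable_mul_test (u.memLp_grad i) hφ hc)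
        ((integrable_mul_test (v.memLp_grad i) hφ hc).const_mul c),
      integral_const_mul, integral_const_mul, u.weak i φ hφ hc hs, v.weak i φ hφ hc hs]
    ring

theorem partialD_star {φ : Euc d → ℂ} (i : Fin d) {x : Euc d} (h : DifferentiableAt ℝ φ x) :
    partialD i (fun x => star (φ x)) x = star (partialD i φ x) := by
  have h1 : HasFDerivAt (fun x => star (φ x)) (Complex.conjCLE.toContinuousLinearMap ∘L
      fderiv ℝ φ x) x := Complex.conjCLE.toContinuousLinearMap.hasFDerivAt.comp x h.hasFDerivAt
  rw [partialD, h1.fderiv]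
  rfl

theorem contDiff_star {φ : Euc d → ℂ} (h : ContDiff ℝ ∞ φ) :
    ContDiff ℝ ∞ (fun x => star (φ x)) :=
  Complex.conjCLE.toContinuousLinearMap.contDiff.comp h

theorem integral_star {α : Type*} [MeasurableSpace α] {μ : Measure α} (f : α → ℂ) :
    ∫ x, star (f x) ∂μ = star (∫ x, f x ∂μ) := integral_conj

/-- The complex conjugate of an `H¹` function. -/
def H1.conj (u : H1 U) : H1 U where
  val x := star (u.val x)
  grad i x := star (u.grad i x)
  memLp_val := u.memLp_val.star
  memLp_grad i := (u.memLp_grad i).star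
  weak i φ hφ hc hs := by
    have hs' : tsupport (fun x => star (φ x)) ⊆ U :=
      (closure_mono fun x hx => by simpa using hx).trans hs
    have h := u.weak i (fun x => star (φ x)) (contDiff_star hφ) (hc.comp_left (by simp)) hs'
    have h2 := congrArg star h
    rw [star_neg, ← integral_star, ← integral_star] at h2
    simp only [partialD_star i (hφ.differentiable (by simp) _), star_mul', star_star] at h2
    exact h2

theorem BdryTrace.combo {u v : H1 U} {f g : Sph d → ℂ} (hU : MeasurableSet U)
    (hUb : U ⊆ ball 0 1) (hu : BdryTrace u f) (c : ℂ) (hv : BdryTrace v g) :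
    BdryTrace (u.combo c v) (fun x => f x + c * g x) := by
  refine ⟨hu.1.add (hv.1.const_mul c), fun i ψ hψ => ?_⟩
  have i1 : ∀ w : H1 U, Integrable (fun x => w.val x * partialD i ψ x + w.grad i x * ψ x)
      (volume.restrict U) := fun w =>
    (integrable_mul_of_continuousOn hU hUb w.memLp_val
      (contDiff_partialD hψ i).continuous.continuousOn).add
    (integrable_mul_of_continuousOn hU hUb (w.memLp_grad i) hψ.continuous.continuousOn)
  have i2 : ∀ w : Sph d → ℂ, MemLp w 2 (surf d) →
      Integrable (fun x : Sph d => w x * ψ x * ((x : Euc d) i : ℂ)) (surf d) := fun w hw =>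
    (memLp_mul_sphere (memLp_mul_sphere hw (hψ.continuous.comp continuous_subtype_val))
      ((contDiff_coord i).continuous.comp continuous_subtype_val)).integrable (by norm_num)
  have e1 : ∀ x, (u.combo c v).val x * partialD i ψ x + (u.combo c v).grad i x * ψ x =
      (u.val x * partialD i ψ x + u.grad i x * ψ x) +
        c * (v.val x * partialD i ψ x + v.grad i x * ψ x) := fun x => by
    simp only [H1.combo]; ring
  have e2 : ∀ x : Sph d, (f x + c * g x) * ψ x * ((x : Euc d) i : ℂ) =
      f x * ψ x * ((x : Euc d) i : ℂ) + c * (g x * ψ x * ((x : Euc d) i : ℂ)) := fun x => by ring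
  simp only [e1, e2]
  rw [integral_add (i1 u) ((i1 v).const_mul c), integral_add (i2 f hu.1) ((i2 g hv.1).const_mul c),
    integral_const_mul, integral_const_mul, hu.2 i ψ hψ, hv.2 i ψ hψ]

theorem BdryTrace.conj {u : H1 U} {f : Sph d → ℂ} (hu : BdryTrace u f) :
    BdryTrace u.conj (fun x => star (f x)) := by
  refine ⟨hu.1.star, fun i ψ hψ => ?_⟩
  have h2 := congrArg star (hu.2 i (fun x => star (ψ x)) (contDiff_star hψ))
  rw [← integral_star, ← integral_star] at h2
  simp only [partialD_star i (hψ.differentiable (by simp) _), star_mul', star_add, star_star]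
    at h2
  refine h2.trans ?_
  simp

theorem BdryTrace.congr {u : H1 U} {f g : Sph d → ℂ} (hu : BdryTrace u f) (h : ∀ x, f x = g x) :
    BdryTrace u g := by
  rwa [← show f = g from funext h]

theorem BdryTrace.conj_zero {u : H1 U} (hu : BdryTrace u 0) : BdryTrace u.conj 0 :=
  hu.conj.congr fun _ => by simp

/-- The constant function `1` in `H¹(𝔹)`. -/
def H1.one [Nonempty (Fin d)] : H1 (ball (0 : Euc d) 1) where
  val _ := 1
  grad _ _ := 0
  memLp_val := memLp_of_continuousOn measurableSet_ball le_rfl continuousOn_const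
  memLp_grad _ := memLp_of_continuousOn measurableSet_ball le_rfl continuousOn_const
  weak i φ hφ _ hs := weak_of_trace (f := fun _ => 1) measurableSet_ball le_rfl
    (memLp_of_continuousOn measurableSet_ball le_rfl continuousOn_const)
    (memLp_of_continuousOn measurableSet_ball le_rfl continuousOn_const)
    (fun ψ hψ => by simpa [coord] using integral_ball_partialD hψ i) φ hφ hs

/-- For the constant function the trace identity is the divergence theorem itself. Multiplying by
smooth functions then gives traces of all of them. -/
theorem bdryTrace_one [Nonempty (Fin d)] : BdryTrace (H1.one (d := d)) (fun _ => 1) :=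
  ⟨memLp_const 1, fun i ψ hψ => by simpa [H1.one, coord] using integral_ball_partialD hψ i⟩

/-- A smooth function as an element of `H¹(U)`. -/
def H1.ofSmooth [Nonempty (Fin d)] (hU : MeasurableSet U) (hUb : U ⊆ ball 0 1) (m : Euc d → ℂ)
    (hm : SmoothNear m) : H1 U :=
  H1.one.cutMul hU measurableSet_ball hUb le_rfl m hm

theorem H1.ofSmooth_val [Nonempty (Fin d)] (hU : MeasurableSet U) (hUb : U ⊆ ball 0 1)
    {m : Euc d → ℂ} (hm : SmoothNear m) (x : Euc d) : (H1.ofSmooth hU hUb m hm).val x = m x :=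
  one_mul _

theorem H1.ofSmooth_grad [Nonempty (Fin d)] (hU : MeasurableSet U) (hUb : U ⊆ ball 0 1)
    {m : Euc d → ℂ} (hm : SmoothNear m) (i : Fin d) (x : Euc d) :
    (H1.ofSmooth hU hUb m hm).grad i x = partialD i m x := by
  simp [ofSmooth, cutMul, one]

theorem bdryTrace_ofSmooth [Nonempty (Fin d)] (hU : MeasurableSet U) (hUb : U ⊆ ball 0 1)
    {m : Euc d → ℂ} (hm : SmoothNear m)
    (h0 : ∀ x ∈ ball 0 1 \ U, m x = 0 ∧ ∀ i, partialD i m x = 0) :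
    BdryTrace (H1.ofSmooth hU hUb m hm) (fun x => m x) :=
  (bdryTrace_one.cutMul hU measurableSet_ball hUb le_rfl hm h0).congr fun _ => one_mul _

/-- An open subset of the unit ball that contains a neighbourhood of the unit sphere in the
ball. -/
structure IsShell (U : Set (Euc d)) : Prop where
  isOpen : IsOpen U
  subset : U ⊆ ball 0 1
  exists_lt : ∃ ρ < 1, ball 0 1 \ closedBall 0 ρ ⊆ U

/-- Cut off a local extension inside the complement of the closed ball of radius `ρ`; points of the
unit ball there belong to `U`, so the extension vanishes near the part of the ball removed by `U`.
-/
theorem IsShell.exists_extension (hU : IsShell U) (φ : Smooth d) :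
    ∃ m : Euc d → ℂ, ContDiff ℝ ∞ m ∧ (∀ x : Sph d, m x = (φ : Sph d → ℂ) x) ∧
      ∀ x ∈ ball 0 1 \ U, m x = 0 ∧ ∀ i, partialD i m x = 0 := by
  obtain ⟨ρ, hρ, hs⟩ := hU.exists_lt
  obtain ⟨O, Φ, hO, hSO, hΦ, h⟩ := φ.2
  obtain ⟨m, h1, -, h2, h3⟩ := exists_contDiff_eventuallyEq (isCompact_sphere (0 : Euc d) 1)
    (hO.inter (isClosed_closedBall (x := (0 : Euc d)) (ε := ρ)).isOpen_compl)
    (fun x hx => ⟨hSO hx, by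
      have : ‖x‖ = 1 := by simpa using hx
      simpa [this] using hρ⟩) (hΦ.mono inter_subset_left)
  refine ⟨m, h1, fun x => by rw [(h3 x x.2).eq_of_nhds, h x], fun x hx => ?_⟩
  have hx' : x ∉ tsupport m := fun hm => hx.2 (hs ⟨hx.1, (h2 hm).2⟩)
  exact ⟨image_eq_zero_of_notMem_tsupport hx', fun i =>
    image_eq_zero_of_notMem_tsupport fun hm => hx' (tsupport_partialD_subset m i hm)⟩

end Linear

/-! ### Products of `H¹` functions -/

section Product

variable {d : ℕ} {U : Set (Euc d)}

theorem integral_add_add {α : Type*} [MeasurableSpace α] {μ : Measure α} {f g h : α → ℂ}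
    (hf : Integrable f μ) (hg : Integrable g μ) (hh : Integrable h μ) :
    ∫ x, (f x + g x + h x) ∂μ = (∫ x, f x ∂μ) + (∫ x, g x ∂μ) + ∫ x, h x ∂μ := by
  rw [← integral_add hf hg]
  exact integral_add (hf.add hg) hh

theorem TendstoL2.mul_of_continuousOn {f : ℕ → Euc d → ℂ} {g φ : Euc d → ℂ}
    (hU : MeasurableSet U) (hUb : U ⊆ ball 0 1) (h : TendstoL2 (volume.restrict U) f g)
    {p : Euc d → ℂ} (hp : MemLp p 2 (volume.restrict U))
    (hφ : ContinuousOn φ (closedBall 0 1)) :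
    Filter.Tendsto (fun n => ∫ x in U, p x * φ x * f n x) Filter.atTop
      (nhds (∫ x in U, p x * φ x * g x)) :=
  (TendstoL2.const (memLp_mul_of_continuousOn hU hUb hp hφ)).integral_mul h

/-- Approximation of functions with zero boundary values by smooth functions. -/
theorem BdryTrace.exists_approx [Nonempty (Fin d)] {v : H1 U} (hv : BdryTrace v 0)
    (hU : MeasurableSet U) (hUb : U ⊆ ball 0 1) :
    ∃ w : ℕ → Euc d → ℂ, (∀ n, ContDiff ℝ ∞ (w n)) ∧
      TendstoL2 (volume.restrict U) w v.val ∧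
      (∀ i, TendstoL2 (volume.restrict U) (fun n => partialD i (w n)) (v.grad i)) ∧
      TendstoL2 (surf d) (fun n x => w n x) 0 := by
  -- Zero boundary values allow integration by parts against every smooth function without a
  -- boundary term. Hence the extension of `v` by zero is weakly differentiable on the whole space,
  -- with the extended gradient.
  have mv : MemLp (U.indicator v.val) 2 volume := (memLp_indicator_iff_restrict hU).2 v.memLp_val
  have mg : ∀ i, MemLp (U.indicator (v.grad i)) 2 volume := fun i =>
    (memLp_indicator_iff_restrict hU).2 (v.memLp_grad i)
  have hp : ∀ n i, partialD i (mollify n (U.indicator v.val)) =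
      mollify n (U.indicator (v.grad i)) := fun n i => by
    funext x
    refine partialD_mollify n mv (fun ψ hψ _ => ?_) x
    have h := hv.2 i ψ hψ
    rw [integral_add (integrable_mul_of_continuousOn hU hUb v.memLp_val
      (contDiff_partialD hψ i).continuous.continuousOn)
      (integrable_mul_of_continuousOn hU hUb (v.memLp_grad i) hψ.continuous.continuousOn)] at h
    simp only [Pi.zero_apply, zero_mul, integral_zero] at h
    have e : ∀ (a b : Euc d → ℂ), ∫ x, U.indicator a x * b x = ∫ x in U, a x * b x := fun a b => by
      rw [← integral_indicator hU]
      congr 1; ext x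
      by_cases hx : x ∈ U <;> simp [hx]
    rw [e, e]
    linear_combination h
  set w : ℕ → Euc d → ℂ := fun n => mollify n (U.indicator v.val) with hw
  have hwc : ∀ n, ContDiff ℝ ∞ (w n) := fun n => contDiff_mollify n mv
  have t1 : TendstoL2 volume w (U.indicator v.val) := tendstoL2_mollify mv
  have t2 : ∀ i, TendstoL2 volume (fun n => partialD i (w n)) (U.indicator (v.grad i)) :=
    fun i => by simpa only [hw, hp] using tendstoL2_mollify (mg i)
  have congr_ind : ∀ {f : ℕ → Euc d → ℂ} {g : Euc d → ℂ}, TendstoL2 volume f (U.indicator g) →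
      TendstoL2 (volume.restrict U) f g := by
    intro f g h
    have h' := h.restrict U
    have hae : U.indicator g =ᵐ[volume.restrict U] g := indicator_ae_eq_restrict hU
    refine ⟨h'.1, (memLp_congr_ae hae).1 h'.2.1, h'.2.2.congr fun n => eLpNorm_congr_ae ?_⟩
    filter_upwards [hae] with x hx
    rw [hx]
  refine ⟨w, hwc, congr_ind t1, fun i => congr_ind (t2 i), ?_⟩
  -- the boundary values tend to zero
  have hS : ∀ n, Continuous fun x : Sph d => w n x :=
    fun n => (hwc n).continuous.comp continuous_subtype_val
  have mS : ∀ n, MemLp (fun x : Sph d => w n x) 2 (surf d) := fun n => by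
    simpa using memLp_mul_sphere (memLp_const (1 : ℂ)) (hS n)
  refine ⟨mS, MemLp.zero, ?_⟩
  have hX : ∀ i : Fin d, ∃ X : Euc d → ℂ, ContDiff ℝ ∞ X ∧ HasCompactSupport X ∧
      ∀ x ∈ closedBall (0 : Euc d) 1, X =ᶠ[nhds x] coord i :=
    fun i => (smoothNear_coord i).exists_contDiff
  choose X X1 X2 X3 using hX
  -- The divergence theorem writes `∫_S |w|²` as the integral of `div(|w|² x)` over the ball.
  -- Replacing `x` by the compactly supported field `X` changes nothing there and makes the integral
  -- of the divergence over the whole space vanish.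
  let Q : ℕ → Fin d → Euc d → ℂ := fun n i x =>
    partialD i (fun x => w n x * star (w n x) * X i x) x
  have hQ : ∀ n i x, Q n i x = X i x * partialD i (w n) x * star (w n x) +
      X i x * star (partialD i (w n) x) * w n x + partialD i (X i) x * w n x * star (w n x) := by
    intro n i x
    have h1 := (hwc n).differentiable (by simp) x
    have h2 := (contDiff_star (hwc n)).differentiable (by simp) x
    simp only [Q]
    rw [partialD_mul i (h1.fun_mul h2) ((X1 i).differentiable (by simp) x),
      partialD_mul i h1 h2, partialD_star i h1]
    ring
  have hlim : ∀ (i : Fin d) (s : Set (Euc d)), Filter.Tendsto (fun n => ∫ x in s, Q n i x)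
      Filter.atTop (nhds (∫ x in s, (X i x * U.indicator (v.grad i) x * star (U.indicator v.val x) +
      X i x * star (U.indicator (v.grad i) x) * U.indicator v.val x +
      partialD i (X i) x * U.indicator v.val x * star (U.indicator v.val x)))) := by
    intro i s
    have bd : ∀ (Y : Euc d → ℂ), ContDiff ℝ ∞ Y → HasCompactSupport Y →
        ∀ {f : ℕ → Euc d → ℂ} {g : Euc d → ℂ}, TendstoL2 volume f g →
        TendstoL2 volume (fun n x => Y x * f n x) (fun x => Y x * g x) := by
      intro Y hY hYc f g h
      obtain ⟨M, hM⟩ := hYc.exists_bound_of_continuous hY.continuous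
      have hm : ∀ {f : Euc d → ℂ}, MemLp f 2 volume → MemLp (fun x => Y x * f x) 2 volume :=
        fun {f} hf => MemLp.of_le_mul (c := M) hf (hY.continuous.aestronglyMeasurable.mul hf.1)
          (Filter.Eventually.of_forall fun x => by rw [norm_mul]; gcongr; exact hM x)
      refine ⟨fun n => hm (h.1 n), hm h.2.1, ?_⟩
      have h3 : Filter.Tendsto (fun n => ENNReal.ofReal M * eLpNorm (fun x => f n x - g x) 2 volume)
          Filter.atTop (nhds 0) := by
        simpa using ENNReal.Tendsto.const_mul h.2.2 (Or.inr ENNReal.ofReal_ne_top)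
      refine tendsto_of_tendsto_of_tendsto_of_le_of_le tendsto_const_nhds h3
        (fun n => zero_le) fun n => ?_
      refine eLpNorm_le_mul_eLpNorm_of_ae_le_mul (Filter.Eventually.of_forall fun x => ?_) 2
      rw [← mul_sub, norm_mul]; gcongr; exact hM x
    simp only [hQ]
    have T1 := bd (X i) (X1 i) (X2 i) (t2 i)
    have T2 := bd (X i) (X1 i) (X2 i) (t2 i).star
    have T3 := bd _ (contDiff_partialD (X1 i) i) (hasCompactSupport_partialD (X2 i) i) t1
    have I : ∀ {f g : Euc d → ℂ}, MemLp f 2 volume → MemLp g 2 volume →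
        Integrable (fun x => f x * g x) (volume.restrict s) :=
      fun hf hg => (MemLp.integrable_mul' hf hg).restrict
    have R := ((T1.restrict s).integral_mul (t1.star.restrict s)).add
      ((T2.restrict s).integral_mul (t1.restrict s))
    have R' := R.add ((T3.restrict s).integral_mul (t1.star.restrict s))
    rw [← integral_add_add (I T1.2.1 t1.star.2.1) (I T2.2.1 t1.2.1) (I T3.2.1 t1.star.2.1)] at R'
    refine R'.congr fun n => ?_
    rw [← integral_add_add (I (T1.1 n) (t1.star.1 n)) (I (T2.1 n) (t1.1 n))
        (I (T3.1 n) (t1.star.1 n))]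
  -- The limit over the whole space is zero because each approximant has integral zero. The limiting
  -- integrand is supported in `U`, so its integral over the ball is the same number.
  have hz : ∀ i, ∫ x in ball (0 : Euc d) 1, (X i x * U.indicator (v.grad i) x *
      star (U.indicator v.val x) + X i x * star (U.indicator (v.grad i) x) * U.indicator v.val x +
      partialD i (X i) x * U.indicator v.val x * star (U.indicator v.val x)) = 0 := by
    intro i
    have h1 := hlim i univ
    have h2 : ∀ n, ∫ x in univ, Q n i x = 0 := fun n => by
      rw [setIntegral_univ]
      exact integral_partialD_eq_zero (((hwc n).mul (contDiff_star (hwc n))).mul (X1 i))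
        (X2 i).mul_left i
    simp only [h2] at h1
    have h3 := tendsto_nhds_unique h1 tendsto_const_nhds
    rw [← h3]
    symm
    refine setIntegral_eq_of_subset_of_forall_sdiff_eq_zero MeasurableSet.univ (subset_univ _) ?_
    intro x hx
    have : x ∉ U := fun h => hx.2 (hUb h)
    simp [this]
  have hsum : ∀ n, ∫ x : Sph d, w n x * star (w n x) ∂(surf d) =
      ∑ i, ∫ x in ball (0 : Euc d) 1, Q n i x := by
    intro n
    have hc := ((hwc n).mul (contDiff_star (hwc n)))
    simp only [Q]
    simp only [fun i => integral_ball_partialD (hc.mul (X1 i)) i]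
    rw [← integral_finsetSum]
    · congr 1; ext x
      have : ∀ i, X i x = coord i x := fun i =>
        (X3 i x (sphere_subset_closedBall x.2)).eq_of_nhds
      simp only [this, mul_assoc, ← Finset.mul_sum]
      rw [sum_coord_mul_coord]
      simp
    · intro i _
      have : Continuous fun x : Sph d => w n x * star (w n x) * X i x * coord i x :=
        ((hc.mul (X1 i)).mul (contDiff_coord i)).continuous.comp continuous_subtype_val
      simpa using (memLp_mul_sphere (memLp_const (1 : ℂ)) this).integrable (by norm_num)
  have hfin : Filter.Tendsto (fun n => ∫ x : Sph d, w n x * star (w n x) ∂(surf d)) Filter.atTop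
      (nhds 0) := by
    simp only [hsum]
    have := tendsto_finsetSum Finset.univ fun i (_ : i ∈ Finset.univ) => hlim i (ball 0 1)
    simpa only [hz, Finset.sum_const_zero] using this
  have hsq : ∀ n, (eLpNorm (fun x : Sph d => w n x) 2 (surf d)).toReal =
      Real.sqrt ‖∫ x : Sph d, w n x * star (w n x) ∂(surf d)‖ := by
    intro n
    rw [integral_mul_star, ← toReal_eLpNorm_two_sq (mS n), Complex.norm_real, norm_pow,
      Real.sqrt_sq (norm_nonneg _), Real.norm_of_nonneg ENNReal.toReal_nonneg]
  have hlim' := (Real.continuous_sqrt.tendsto _).comp hfin.norm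
  simp only [Function.comp_def, ← hsq, norm_zero, Real.sqrt_zero] at hlim'
  simp only [Pi.zero_apply, sub_zero]
  rw [← ENNReal.toReal_zero] at hlim'
  exact (ENNReal.tendsto_toReal_iff (fun n => (mS n).2.ne) ENNReal.zero_ne_top).1 hlim'

/-- Integration by parts for the product of two `H¹` functions. -/
theorem BdryTrace.integral_mul_mul [Nonempty (Fin d)] {u v : H1 U} {f : Sph d → ℂ} {φ : Smooth d}
    (hU : IsShell U) (hu : BdryTrace u f) (hv : BdryTrace v φ)
    {ζ : Euc d → ℂ} (hζ : SmoothNear ζ) (i : Fin d) :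
    ∫ x in U, (u.val x * v.val x * partialD i ζ x +
        (u.grad i x * v.val x + u.val x * v.grad i x) * ζ x) =
      ∫ x : Sph d, f x * (φ : Sph d → ℂ) x * ζ x * coord i x ∂(surf d) := by
  have hm := hU.isOpen.measurableSet
  have hb := hU.subset
  obtain ⟨m, h1, h2, h3⟩ := hU.exists_extension φ
  have hms := SmoothNear.of_contDiff h1
  have ho := bdryTrace_ofSmooth hm hb hms h3
  -- Split `v` into a smooth extension `m` of its trace and a remainder with zero trace. Only the
  -- remainder needs approximation.
  have hv0 : BdryTrace (v.combo (-1) (H1.ofSmooth hm hb m hms)) 0 :=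
    (hv.combo hm hb (-1) ho).congr fun x => by simp [h2]
  obtain ⟨w, w1, w2, w3, w4⟩ := hv0.exists_approx hm hb
  -- the identity for the smooth part
  have key : ∀ w : Euc d → ℂ, ContDiff ℝ ∞ w →
      (∫ x in U, u.val x * partialD i ζ x * w x) + (∫ x in U, u.grad i x * ζ x * w x) +
        (∫ x in U, u.val x * ζ x * partialD i w x) =
      ∫ x : Sph d, f x * ζ x * coord i x * w x ∂(surf d) := by
    intro w hw
    have h := hu.integral_smoothNear hm hb (hζ.mul (.of_contDiff hw)) i
    rw [← integral_add, ← integral_add]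
    · convert h using 1
      · refine setIntegral_congr_fun hm fun x hx => ?_
        rw [partialD_mul i (hζ.differentiableAt (ball_subset_closedBall (hb hx)))
          (hw.differentiable (by simp) x)]
        ring
      · congr 1; ext x; ring
    · exact (integrable_mul_of_continuousOn hm hb (memLp_mul_of_continuousOn hm hb u.memLp_val
        (hζ.partialD i).continuousOn) hw.continuous.continuousOn).add
        (integrable_mul_of_continuousOn hm hb (memLp_mul_of_continuousOn hm hb (u.memLp_grad i)
        hζ.continuousOn) hw.continuous.continuousOn)
    · exact integrable_mul_of_continuousOn hm hb (memLp_mul_of_continuousOn hm hb u.memLp_val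
        hζ.continuousOn) (contDiff_partialD hw i).continuous.continuousOn
    · exact integrable_mul_of_continuousOn hm hb (memLp_mul_of_continuousOn hm hb u.memLp_val
        (hζ.partialD i).continuousOn) hw.continuous.continuousOn
    · exact integrable_mul_of_continuousOn hm hb (memLp_mul_of_continuousOn hm hb (u.memLp_grad i)
        hζ.continuousOn) hw.continuous.continuousOn
  have lim := ((w2.mul_of_continuousOn hm hb u.memLp_val (hζ.partialD i).continuousOn).add
    (w2.mul_of_continuousOn hm hb (u.memLp_grad i) hζ.continuousOn)).add
    ((w3 i).mul_of_continuousOn hm hb u.memLp_val hζ.continuousOn)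
  simp only [fun n => key (w n) (w1 n)] at lim
  have limS := (TendstoL2.const (memLp_mul_sphere (memLp_mul_sphere hu.1 hζ.continuous_sphere)
    (smoothNear_coord i).continuous_sphere)).integral_mul w4
  have e0 := tendsto_nhds_unique lim limS
  have e1 := key m h1
  have I : ∀ {p q ζ : Euc d → ℂ}, MemLp p 2 (volume.restrict U) → MemLp q 2 (volume.restrict U) →
      ContinuousOn ζ (closedBall 0 1) →
      Integrable (fun x => p x * ζ x * q x) (volume.restrict U) := fun hp hq hζ =>
    MemLp.integrable_mul' (memLp_mul_of_continuousOn hm hb hp hζ) hq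
  have mm := memLp_of_continuousOn hm hb hms.continuousOn
  have mm' := memLp_of_continuousOn hm hb (hms.partialD i).continuousOn
  have split : ∀ {p ζ q r : Euc d → ℂ}, MemLp p 2 (volume.restrict U) →
      ContinuousOn ζ (closedBall 0 1) → MemLp q 2 (volume.restrict U) →
      MemLp r 2 (volume.restrict U) → ∫ x in U, p x * ζ x * (q x + -1 * r x) =
      (∫ x in U, p x * ζ x * q x) - ∫ x in U, p x * ζ x * r x := by
    intro p ζ q r hp hζ hq hr
    rw [← integral_sub (I hp hq hζ) (I hp hr hζ)]
    congr 1; ext x; ring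
  simp only [H1.combo, H1.ofSmooth_val, H1.ofSmooth_grad, Pi.zero_apply, mul_zero,
    integral_zero] at e0
  rw [split u.memLp_val (hζ.partialD i).continuousOn v.memLp_val mm,
    split (u.memLp_grad i) hζ.continuousOn v.memLp_val mm,
    split u.memLp_val hζ.continuousOn (v.memLp_grad i) mm'] at e0
  have e2 : ∫ x in U, (u.val x * v.val x * partialD i ζ x +
        (u.grad i x * v.val x + u.val x * v.grad i x) * ζ x) =
      (∫ x in U, u.val x * partialD i ζ x * v.val x) + (∫ x in U, u.grad i x * ζ x * v.val x) +
        (∫ x in U, u.val x * ζ x * v.grad i x) := by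
    rw [← integral_add_add (I u.memLp_val v.memLp_val (hζ.partialD i).continuousOn)
      (I (u.memLp_grad i) v.memLp_val hζ.continuousOn)
      (I u.memLp_val (v.memLp_grad i) hζ.continuousOn)]
    congr 1; ext x; ring
  have e3 : ∫ x : Sph d, f x * (φ : Sph d → ℂ) x * ζ x * coord i x ∂(surf d) =
      ∫ x : Sph d, f x * ζ x * coord i x * m x ∂(surf d) := by
    congr 1; ext x; rw [h2]; ring
  rw [e2, e3]
  linear_combination e0 + e1

end Product

/-! ### Well-posedness of the Dirichlet problem -/

section WellPosed

variable {d : ℕ} {U : Set (Euc d)}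

theorem eLpNorm_mul_le {U : Set (Euc d)} (hU : MeasurableSet U) {v φ : Euc d → ℂ} {M : ℝ}
    (hv : MemLp v 2 (volume.restrict U)) (hM0 : 0 ≤ M) (hM : ∀ x ∈ U, ‖φ x‖ ≤ M) :
    (eLpNorm (fun x => v x * φ x) 2 (volume.restrict U)).toReal ≤
      M * (eLpNorm v 2 (volume.restrict U)).toReal := by
  have h : eLpNorm (fun x => v x * φ x) 2 (volume.restrict U) ≤
      ENNReal.ofReal M * eLpNorm v 2 (volume.restrict U) := by
    refine eLpNorm_le_mul_eLpNorm_of_ae_le_mul ?_ 2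
    filter_upwards [ae_restrict_mem hU] with x hx
    rw [norm_mul, mul_comm]
    gcongr
    exact hM x hx
  refine (ENNReal.toReal_mono (ENNReal.mul_ne_top ENNReal.ofReal_ne_top hv.2.ne) h).trans ?_
  rw [ENNReal.toReal_mul, ENNReal.toReal_ofReal hM0]

/-- The Poincaré inequality. -/
theorem BdryTrace.poincare [Nonempty (Fin d)] (hU : IsShell U) {v : H1 U} (hv : BdryTrace v 0)
    (i : Fin d) : (eLpNorm v.val 2 (volume.restrict U)).toReal ≤
      2 * (eLpNorm (v.grad i) 2 (volume.restrict U)).toReal := by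
  have hm := hU.isOpen.measurableSet
  have hb := hU.subset
  -- The product formula for `v`, its conjugate and `ζ = x_i`: as `∂_i x_i = 1`, it expresses `∫
  -- |v|²` through terms that each contain one derivative of `v`.
  have h := BdryTrace.integral_mul_mul (φ := 0) hU hv hv.conj_zero (smoothNear_coord i) i
  have hc := (smoothNear_coord (d := d) i).continuousOn
  have mv := v.memLp_val
  have mg := v.memLp_grad i
  have mvx := memLp_mul_of_continuousOn hm hb mv hc
  have mgx := memLp_mul_of_continuousOn hm hb mg hc
  have mvs : MemLp (fun x => star (v.val x)) 2 (volume.restrict U) := mv.star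
  have mgs : MemLp (fun x => star (v.grad i x)) 2 (volume.restrict U) := mg.star
  have e : ∫ x in U, (v.val x * v.conj.val x * partialD i (coord i) x +
        (v.grad i x * v.conj.val x + v.val x * v.conj.grad i x) * coord i x) =
      (∫ x in U, v.val x * star (v.val x)) + (∫ x in U, (v.grad i x * coord i x) * star (v.val x)) +
        ∫ x in U, (v.val x * coord i x) * star (v.grad i x) := by
    rw [← integral_add_add (MemLp.integrable_mul' mv mvs) (MemLp.integrable_mul' mgx mvs)
      (MemLp.integrable_mul' mvx mgs)]
    congr 1; ext x
    simp only [H1.conj, partialD_coord, if_true]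
    ring
  rw [e, integral_mul_star, ← toReal_eLpNorm_two_sq mv] at h
  simp only [Pi.zero_apply, zero_mul, integral_zero] at h
  set A := (eLpNorm v.val 2 (volume.restrict U)).toReal
  set B := (eLpNorm (v.grad i) 2 (volume.restrict U)).toReal
  have hA0 : 0 ≤ A := ENNReal.toReal_nonneg
  have hB0 : 0 ≤ B := ENNReal.toReal_nonneg
  have hx1 : ∀ x ∈ U, ‖coord i x‖ ≤ 1 := fun x hx => by
    have h1 : ‖x‖ < 1 := by simpa using hb hx
    rw [coord, Complex.norm_real]
    exact (PiLp.norm_apply_le x i).trans h1.le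
  have n1 : (eLpNorm (fun x => star (v.val x)) 2 (volume.restrict U)).toReal = A := by
    congr 1
    exact eLpNorm_congr_norm_ae (Filter.Eventually.of_forall fun x => norm_star _)
  have n2 : (eLpNorm (fun x => star (v.grad i x)) 2 (volume.restrict U)).toReal = B := by
    congr 1
    exact eLpNorm_congr_norm_ae (Filter.Eventually.of_forall fun x => norm_star _)
  have b1 : ‖∫ x in U, (v.grad i x * coord i x) * star (v.val x)‖ ≤ B * A := by
    refine (norm_integral_mul_le mgx mvs).trans ?_
    rw [n1]
    have := eLpNorm_mul_le hm mg zero_le_one hx1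
    rw [one_mul] at this
    gcongr
  have b2 : ‖∫ x in U, (v.val x * coord i x) * star (v.grad i x)‖ ≤ A * B := by
    refine (norm_integral_mul_le mvx mgs).trans ?_
    rw [n2]
    have := eLpNorm_mul_le hm mv zero_le_one hx1
    rw [one_mul] at this
    gcongr
  -- Since `|x_i| ≤ 1` in the ball, Cauchy–Schwarz bounds each of the two derivative terms by `A B`,
  -- whence the constant `2`.
  have hfin : A ^ 2 ≤ B * A + A * B := by
    have : ((A ^ 2 : ℝ) : ℂ) = -(∫ x in U, (v.grad i x * coord i x) * star (v.val x)) -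
        ∫ x in U, (v.val x * coord i x) * star (v.grad i x) := by linear_combination h
    have h2 := congrArg norm this
    rw [Complex.norm_real, Real.norm_of_nonneg (by positivity)] at h2
    rw [h2]
    refine (norm_sub_le _ _).trans ?_
    rw [norm_neg]
    exact add_le_add b1 b2
  by_contra hlt
  nlinarith

theorem dirichlet_eq_sum (u v : H1 U) :
    dirichlet u v = ∑ i, ∫ x in U, u.grad i x * v.grad i x :=
  integral_finsetSum _ fun i _ => MemLp.integrable_mul' (u.memLp_grad i) (v.memLp_grad i)

theorem dirichlet_comm (u v : H1 U) : dirichlet u v = dirichlet v u := by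
  simp only [dirichlet, mul_comm]

theorem dirichlet_combo_right (u v w : H1 U) (c : ℂ) :
    dirichlet u (v.combo c w) = dirichlet u v + c * dirichlet u w := by
  simp only [dirichlet_eq_sum]
  rw [Finset.mul_sum, ← Finset.sum_add_distrib]
  refine Finset.sum_congr rfl fun i _ => ?_
  rw [← integral_const_mul, ← integral_add
    (MemLp.integrable_mul' (u.memLp_grad i) (v.memLp_grad i))
    ((MemLp.integrable_mul' (u.memLp_grad i) (w.memLp_grad i)).const_mul c)]
  congr 1; ext x
  simp only [H1.combo]; ring

theorem dirichlet_combo_left (u v w : H1 U) (c : ℂ) :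
    dirichlet (v.combo c w) u = dirichlet v u + c * dirichlet w u := by
  rw [dirichlet_comm, dirichlet_combo_right, dirichlet_comm u v, dirichlet_comm u w]

/-! ### Solving the Dirichlet problem by orthogonal projection of gradients. -/

/-- `L²(U)`. -/
abbrev L2Space (U : Set (Euc d)) := Lp ℂ 2 ((volume : Measure (Euc d)).restrict U)

/-- Square integrable vector fields on `U`. -/
abbrev L2Fields (U : Set (Euc d)) := PiLp 2 fun _ : Fin d => L2Space U

theorem tendstoL2_of_tendsto {α : Type*} [MeasurableSpace α] {μ : Measure α} {f : ℕ → Lp ℂ 2 μ}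
    {g : Lp ℂ 2 μ} (h : Filter.Tendsto f Filter.atTop (nhds g)) :
    TendstoL2 μ (fun n => f n) g := by
  refine ⟨fun n => Lp.memLp _, Lp.memLp _, ?_⟩
  exact (Lp.tendsto_Lp_iff_tendsto_eLpNorm' f g).1 h

theorem continuous_integral_mul {α : Type*} [MeasurableSpace α] {μ : Measure α} {g : α → ℂ}
    (hg : MemLp g 2 μ) : Continuous fun f : Lp ℂ 2 μ => ∫ x, f x * g x ∂μ := by
  rw [continuous_iff_seqContinuous]
  intro f f' h
  exact (tendstoL2_of_tendsto h).integral_mul (TendstoL2.const hg)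

/-- The pairs `(v, ∇v)` of a function `v ∈ H¹(U)` with zero boundary values and its gradient. -/
def zeroTrace (hU : IsShell U) : Submodule ℂ (L2Space U × L2Fields U) where
  carrier := {p | ∀ (i : Fin d) (ψ : Euc d → ℂ), ContDiff ℝ ∞ ψ →
    (∫ x in U, p.1 x * partialD i ψ x) + ∫ x in U, p.2 i x * ψ x = 0}
  zero_mem' i ψ _ := by
    have e : ∀ φ : Euc d → ℂ, ∫ x in U, (0 : L2Space U) x * φ x = 0 := fun φ => by
      refine integral_eq_zero_of_ae ?_
      filter_upwards [Lp.coeFn_zero ℂ 2 ((volume : Measure (Euc d)).restrict U)] with x hx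
      rw [hx]; simp
    have e2 := e ψ
    have e1 := e (partialD i ψ)
    simp only [Prod.fst_zero, Prod.snd_zero, PiLp.zero_apply, e1, e2, add_zero]
  add_mem' {p q} hp hq i ψ hψ := by
    have e : ∀ (f g : L2Space U) (φ : Euc d → ℂ), ContDiff ℝ ∞ φ → ∫ x in U, (f + g) x * φ x =
        (∫ x in U, f x * φ x) + ∫ x in U, g x * φ x := fun f g φ hφ => by
      have mφ := memLp_of_continuousOn hU.isOpen.measurableSet hU.subset hφ.continuous.continuousOn
      rw [← integral_add (MemLp.integrable_mul' (Lp.memLp f) mφ)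
        (MemLp.integrable_mul' (Lp.memLp g) mφ)]
      refine integral_congr_ae ?_
      filter_upwards [Lp.coeFn_add f g] with x hx
      rw [hx, Pi.add_apply, add_mul]
    have h1 := hp i ψ hψ
    have h2 := hq i ψ hψ
    simp only [Prod.fst_add, Prod.snd_add, PiLp.add_apply]
    rw [e _ _ _ (contDiff_partialD hψ i), e _ _ _ hψ]
    linear_combination h1 + h2
  smul_mem' c p hp i ψ hψ := by
    have e : ∀ (f : L2Space U) (φ : Euc d → ℂ), ∫ x in U, (c • f) x * φ x =
        c * ∫ x in U, f x * φ x := fun f φ => by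
      rw [← integral_const_mul]
      refine integral_congr_ae ?_
      filter_upwards [Lp.coeFn_smul c f] with x hx
      rw [hx, Pi.smul_apply, smul_eq_mul, mul_assoc]
    have h1 := hp i ψ hψ
    simp only [Prod.smul_fst, Prod.smul_snd, PiLp.smul_apply]
    rw [e, e]
    linear_combination c * h1

theorem isClosed_zeroTrace (hU : IsShell U) :
    IsClosed (zeroTrace hU : Set (L2Space U × L2Fields U)) := by
  have : (zeroTrace hU : Set (L2Space U × L2Fields U)) =
      ⋂ (i : Fin d) (ψ : Euc d → ℂ) (_ : ContDiff ℝ ∞ ψ),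
        {p | (∫ x in U, p.1 x * partialD i ψ x) + ∫ x in U, p.2 i x * ψ x = 0} := by
    ext p
    simp only [mem_iInter]
    rfl
  rw [this]
  refine isClosed_iInter fun i => isClosed_iInter fun ψ => isClosed_iInter fun hψ =>
    isClosed_eq (Continuous.add ?_ ?_) continuous_const
  · exact (continuous_integral_mul (memLp_of_continuousOn hU.isOpen.measurableSet hU.subset
      (contDiff_partialD hψ i).continuous.continuousOn)).comp continuous_fst
  · exact (continuous_integral_mul (memLp_of_continuousOn hU.isOpen.measurableSet hU.subset
      hψ.continuous.continuousOn)).comp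
        ((PiLp.continuous_apply 2 (fun _ : Fin d => L2Space U) i).comp continuous_snd)

theorem exists_of_mem_zeroTrace (hU : IsShell U) {p : L2Space U × L2Fields U}
    (hp : p ∈ zeroTrace hU) : ∃ v : H1 U, BdryTrace v 0 ∧ v.val = p.1 ∧ ∀ i, v.grad i = p.2 i := by
  have hm := hU.isOpen.measurableSet
  have h : ∀ (i : Fin d) (ψ : Euc d → ℂ), ContDiff ℝ ∞ ψ →
      ∫ x in U, (p.1 x * partialD i ψ x + p.2 i x * ψ x) =
        ∫ x : Sph d, (0 : Sph d → ℂ) x * ψ x * ((x : Euc d) i : ℂ) ∂(surf d) := fun i ψ hψ => by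
    rw [integral_add (integrable_mul_of_continuousOn hm hU.subset (Lp.memLp p.1)
      (contDiff_partialD hψ i).continuous.continuousOn)
      (integrable_mul_of_continuousOn hm hU.subset (Lp.memLp (p.2 i)) hψ.continuous.continuousOn),
      hp i ψ hψ]
    simp
  exact ⟨⟨p.1, fun i => p.2 i, Lp.memLp _, fun i => Lp.memLp _, fun i φ hφ _ hs =>
    weak_of_trace hm hU.subset (Lp.memLp _) (Lp.memLp _) (h i) φ hφ hs⟩,
    ⟨MemLp.zero, h⟩, rfl, fun i => rfl⟩

/-- The gradient of an `H¹` function as an element of a Hilbert space. -/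
def H1.gradL2 (v : H1 U) : L2Fields U := WithLp.toLp 2 fun i => (v.memLp_grad i).toLp _

theorem BdryTrace.mem_zeroTrace (hU : IsShell U) {v : H1 U} (hv : BdryTrace v 0) :
    (v.memLp_val.toLp _, v.gradL2) ∈ zeroTrace hU := by
  intro i ψ hψ
  have hm := hU.isOpen.measurableSet
  have h := hv.2 i ψ hψ
  rw [integral_add (integrable_mul_of_continuousOn hm hU.subset v.memLp_val
      (contDiff_partialD hψ i).continuous.continuousOn)
      (integrable_mul_of_continuousOn hm hU.subset (v.memLp_grad i)
        hψ.continuous.continuousOn)] at h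
  simp only [Pi.zero_apply, zero_mul, integral_zero] at h
  have e : ∀ (f φ : Euc d → ℂ) (hf : MemLp f 2 (volume.restrict U)),
      ∫ x in U, hf.toLp f x * φ x = ∫ x in U, f x * φ x := fun f φ hf => by
    refine integral_congr_ae ?_
    filter_upwards [hf.coeFn_toLp] with x hx
    rw [hx]
  simp only [H1.gradL2]
  rw [e, e, h]

/-- The Poincaré inequality makes the projection from pairs to gradients antilipschitz on a complete
space, so its range is closed. Closedness is what allows orthogonal projection onto this range. -/
theorem isClosed_map_zeroTrace [Nonempty (Fin d)] (hU : IsShell U) :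
    IsClosed ((zeroTrace hU).map (LinearMap.snd ℂ (L2Space U) (L2Fields U)) :
      Set (L2Fields U)) := by
  let T : zeroTrace hU →L[ℂ] L2Fields U :=
    (ContinuousLinearMap.snd ℂ (L2Space U) (L2Fields U)).comp (zeroTrace hU).subtypeL
  have hc : CompleteSpace (zeroTrace hU) := (isClosed_zeroTrace hU).completeSpace_coe
  have hanti : AntilipschitzWith 2 T := by
    refine AddMonoidHomClass.antilipschitz_of_bound T fun p => ?_
    obtain ⟨v, hv, h1, h2⟩ := exists_of_mem_zeroTrace hU p.2
    let i : Fin d := Classical.arbitrary _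
    have h := hv.poincare hU i
    rw [h1, h2, ← Lp.norm_def, ← Lp.norm_def] at h
    have h3 : ‖(p : L2Space U × L2Fields U).2 i‖ ≤ ‖(p : L2Space U × L2Fields U).2‖ :=
      PiLp.norm_apply_le _ i
    have h4 : ‖p‖ = max ‖(p : L2Space U × L2Fields U).1‖ ‖(p : L2Space U × L2Fields U).2‖ := rfl
    rw [h4]
    change _ ≤ ((2 : NNReal) : ℝ) * ‖(p : L2Space U × L2Fields U).2‖
    have := norm_nonneg (p : L2Space U × L2Fields U).2
    simp only [NNReal.coe_ofNat]
    exact max_le (by linarith) (by linarith)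
  have := hanti.isClosed_range T.uniformContinuous
  have e : ((zeroTrace hU).map (LinearMap.snd ℂ (L2Space U) (L2Fields U)) :
      Set (L2Fields U)) = range T := by
    refine Set.ext fun q => ⟨?_, ?_⟩
    · rintro ⟨p, hp, h⟩
      exact ⟨⟨p, hp⟩, h⟩
    · rintro ⟨p, h⟩
      exact ⟨p, p.2, h⟩
  rwa [e]

/-- Solution of the weak Dirichlet problem with given extension of the boundary values. -/
theorem exists_weak_solution [Nonempty (Fin d)] (hU : IsShell U) (u : H1 U) :
    ∃ w : H1 U, BdryTrace w 0 ∧ ∀ v : H1 U, BdryTrace v 0 → dirichlet (u.combo (-1) w) v = 0 := by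
  set K := (zeroTrace hU).map (LinearMap.snd ℂ (L2Space U) (L2Fields U))
  have hK : CompleteSpace K := (isClosed_map_zeroTrace hU).completeSpace_coe
  -- The correction `w` is a zero-trace function whose gradient is the orthogonal projection of
  -- `∇u`; then `∇(u - w)` is orthogonal to all gradients of zero-trace functions.
  obtain ⟨p, hp, hpe⟩ : K.starProjection u.gradL2 ∈ K := Submodule.starProjection_apply_mem _ _
  obtain ⟨w, hw, -, hw2⟩ := exists_of_mem_zeroTrace hU hp
  refine ⟨w, hw, fun v hv => ?_⟩
  -- The inner product is sesquilinear while the Dirichlet form is bilinear, so orthogonality is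
  -- applied to the conjugate of `v`, which again has zero trace.
  have hmem : v.conj.gradL2 ∈ K := ⟨_, hv.conj_zero.mem_zeroTrace hU, rfl⟩
  have hin := K.starProjection_inner_eq_zero u.gradL2 _ hmem
  rw [← inner_conj_symm, map_eq_zero, ← hpe, PiLp.inner_apply] at hin
  rw [dirichlet_eq_sum, ← hin]
  refine Finset.sum_congr rfl fun i _ => ?_
  rw [L2.inner_def]
  refine integral_congr_ae ?_
  filter_upwards [(u.memLp_grad i).coeFn_toLp, (v.conj.memLp_grad i).coeFn_toLp,
    Lp.coeFn_sub (u.gradL2 i) (p.2 i)] with x h1 h2 h3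
  have e1 : (u.gradL2 - (LinearMap.snd ℂ (L2Space U) (L2Fields U)) p) i =
    u.gradL2 i - p.2 i := rfl
  rw [e1, h3, Pi.sub_apply]
  have e2 : (u.gradL2 i : Euc d → ℂ) x = u.grad i x := h1
  have e3 : (v.conj.gradL2 i : Euc d → ℂ) x = star (v.grad i x) := h2
  rw [e2, e3, ← hw2]
  simp only [H1.combo, RCLike.inner_apply, starRingEnd_apply, star_star]
  ring

/-! ### Existence and uniqueness of the Neumann trace. -/

theorem dirichlet_eq_of_trace (hU : IsShell U) {u v w : H1 U} {f : Sph d → ℂ}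
    (hu : ∀ v : H1 U, BdryTrace v 0 → dirichlet u v = 0) (hv : BdryTrace v f)
    (hw : BdryTrace w f) : dirichlet u v = dirichlet u w := by
  have h := hu _ ((hv.combo hU.isOpen.measurableSet hU.subset (-1) hw).congr
    (g := 0) fun x => by simp)
  rw [dirichlet_combo_right] at h
  linear_combination h

theorem toReal_eLpNorm_le_norm (v : H1 U) :
    (eLpNorm v.val 2 (volume.restrict U)).toReal ≤ v.norm ∧
      ∀ i, (eLpNorm (v.grad i) 2 (volume.restrict U)).toReal ≤ v.norm := by
  have i1 : Integrable (fun x => ‖v.val x‖ ^ 2) (volume.restrict U) :=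
    v.memLp_val.integrable_norm_pow (by norm_num)
  have i2 : ∀ i, Integrable (fun x => ‖v.grad i x‖ ^ 2) (volume.restrict U) := fun i =>
    (v.memLp_grad i).integrable_norm_pow (by norm_num)
  have i3 : Integrable (fun x => ‖v.val x‖ ^ 2 + ∑ i, ‖v.grad i x‖ ^ 2) (volume.restrict U) :=
    i1.add (integrable_finsetSum _ fun i _ => i2 i)
  refine ⟨Real.le_sqrt_of_sq_le ?_, fun i => Real.le_sqrt_of_sq_le ?_⟩
  · rw [toReal_eLpNorm_two_sq v.memLp_val]
    refine integral_mono i1 i3 fun x => ?_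
    have : 0 ≤ ∑ i, ‖v.grad i x‖ ^ 2 := Finset.sum_nonneg fun i _ => by positivity
    simp only
    linarith
  · rw [toReal_eLpNorm_two_sq (v.memLp_grad i)]
    refine integral_mono (i2 i) i3 fun x => ?_
    have : ‖v.grad i x‖ ^ 2 ≤ ∑ i, ‖v.grad i x‖ ^ 2 :=
      Finset.single_le_sum (f := fun i => ‖v.grad i x‖ ^ 2) (fun i _ => by positivity)
        (Finset.mem_univ i)
    simp only
    nlinarith [sq_nonneg ‖v.val x‖]

theorem norm_dirichlet_le (u v : H1 U) : ‖dirichlet u v‖ ≤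
    ∑ i, (eLpNorm (u.grad i) 2 (volume.restrict U)).toReal *
      (eLpNorm (v.grad i) 2 (volume.restrict U)).toReal := by
  rw [dirichlet_eq_sum]
  exact (norm_sum_le _ _).trans (Finset.sum_le_sum fun i _ =>
    norm_integral_mul_le (u.memLp_grad i) (v.memLp_grad i))

/-- Bounds the cutoff map from functions on the ball to functions on `U` by the product rule. It
turns an arbitrary extension to the whole ball into an admissible one on `U`, as needed for
boundedness in the `H^{1/2}` quotient norm. -/
theorem exists_cutMul_bound (hU : IsShell U) {m : Euc d → ℂ} (hm : SmoothNear m) (i : Fin d) :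
    ∃ M : ℝ, ∀ v : H1 (ball (0 : Euc d) 1),
      (eLpNorm ((v.cutMul hU.isOpen.measurableSet measurableSet_ball hU.subset le_rfl m hm).grad i)
        2 (volume.restrict U)).toReal ≤ M * v.norm := by
  have bd : ∀ φ : Euc d → ℂ, SmoothNear φ → ∃ M, 0 ≤ M ∧ ∀ x ∈ U, ‖φ x‖ ≤ M := fun φ hφ => by
    obtain ⟨M, hM⟩ := ((isCompact_closedBall (0 : Euc d) 1).image_of_continuousOn
      hφ.continuousOn).isBounded.exists_norm_le
    exact ⟨max M 0, le_max_right _ _, fun x hx => (hM _ ⟨x, ball_subset_closedBall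
      (hU.subset hx), rfl⟩).trans (le_max_left _ _)⟩
  obtain ⟨M, hM0, hM⟩ := bd m hm
  obtain ⟨N, hN0, hN⟩ := bd _ (hm.partialD i)
  refine ⟨M + N, fun v => ?_⟩
  have hUm := hU.isOpen.measurableSet
  have hle : (volume : Measure (Euc d)).restrict U ≤ volume.restrict (ball 0 1) :=
    Measure.restrict_mono hU.subset le_rfl
  have mv := v.memLp_val.mono_measure hle
  have mg := (v.memLp_grad i).mono_measure hle
  have m1 := memLp_mul_of_continuousOn hUm hU.subset mg hm.continuousOn
  have m2 := memLp_mul_of_continuousOn hUm hU.subset mv (hm.partialD i).continuousOn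
  have h1 := eLpNorm_mul_le hUm mg hM0 hM
  have h2 := eLpNorm_mul_le hUm mv hN0 hN
  have h3 : (eLpNorm v.val 2 (volume.restrict U)).toReal ≤ v.norm :=
    (ENNReal.toReal_mono v.memLp_val.2.ne (eLpNorm_mono_measure _ hle)).trans
      (toReal_eLpNorm_le_norm v).1
  have h4 : (eLpNorm (v.grad i) 2 (volume.restrict U)).toReal ≤ v.norm :=
    (ENNReal.toReal_mono (v.memLp_grad i).2.ne (eLpNorm_mono_measure _ hle)).trans
      ((toReal_eLpNorm_le_norm v).2 i)
  have h5 := ENNReal.toReal_mono (ENNReal.add_lt_top.2 ⟨m1.2, m2.2⟩).ne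
    (eLpNorm_add_le m1.1 m2.1 (by norm_num))
  rw [ENNReal.toReal_add m1.2.ne m2.2.ne] at h5
  refine h5.trans ?_
  rw [add_mul]
  exact add_le_add (h1.trans (mul_le_mul_of_nonneg_left h4 hM0))
    (h2.trans (mul_le_mul_of_nonneg_left h3 hN0))

theorem one_mem_smooth : (fun _ => 1 : Sph d → ℂ) ∈ Smooth d :=
  (SmoothNear.const (1 : ℂ)).mem_smooth

/-- Every boundary datum extends to a weak solution of the Laplace equation. -/
theorem exists_harmonic [Nonempty (Fin d)] (hU : IsShell U) {f : Sph d → ℂ} (hf : MemHHalf f) :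
    ∃ u : H1 U, BdryTrace u f ∧ ∀ v : H1 U, BdryTrace v 0 → dirichlet u v = 0 := by
  obtain ⟨u, hu⟩ := hf
  -- A cutoff equal to `1` on the unit sphere and vanishing to first order off `U`: multiplying by
  -- it keeps the data `f` and imposes zero data on the hole.
  obtain ⟨m, h1, h2, h3⟩ := hU.exists_extension ⟨_, one_mem_smooth⟩
  have hm := hU.isOpen.measurableSet
  have hu1 := BdryTrace.cutMul (u := u) hu hm measurableSet_ball hU.subset le_rfl
    (.of_contDiff h1) h3
  obtain ⟨w, hw, hs⟩ := exists_weak_solution hU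
    (u.cutMul hm measurableSet_ball hU.subset le_rfl m (.of_contDiff h1))
  exact ⟨_, (hu1.combo hm hU.subset (-1) hw).congr fun x => by simp [h2], hs⟩

theorem exists_bdryTrace_smooth [Nonempty (Fin d)] (hU : IsShell U) (φ : Smooth d) :
    ∃ v : H1 U, BdryTrace v φ := by
  obtain ⟨m, h1, h2, h3⟩ := hU.exists_extension φ
  exact ⟨_, (bdryTrace_ofSmooth hU.isOpen.measurableSet hU.subset (.of_contDiff h1) h3).congr h2⟩

/-- Define the functional by Green's formula with one chosen extension of each test function. As `u`
is harmonic, any other extension gives the same value; this independence yields linearity, Green's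
formula for all extensions, and, with cut-off extensions, the norm bound. -/
theorem exists_isDN [Nonempty (Fin d)] (hU : IsShell U) {f : Sph d → ℂ} (hf : MemHHalf f) :
    ∃ g, IsDN (BdryTrace (U := U)) f g := by
  have hm := hU.isOpen.measurableSet
  obtain ⟨u, hu, hs⟩ := exists_harmonic hU hf
  choose v hv using exists_bdryTrace_smooth (d := d) hU
  refine ⟨{ toFun := fun φ => dirichlet u (v φ), map_add' := fun φ ψ => ?_,
            map_smul' := fun c φ => ?_ }, ?_, u, hu, hs, fun φ w hw => ?_⟩
  · have h := (hv φ).combo hm hU.subset 1 (hv ψ)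
    rw [dirichlet_eq_of_trace hU hs (hv (φ + ψ)) (h.congr fun x => by simp),
      dirichlet_combo_right, one_mul]
  · have h := (hv φ).combo hm hU.subset (c - 1) (hv φ)
    rw [dirichlet_eq_of_trace hU hs (hv (c • φ)) (h.congr fun x => by simp; ring),
      dirichlet_combo_right, RingHom.id_apply, smul_eq_mul]
    ring
  · obtain ⟨m, h1, h2, h3⟩ := hU.exists_extension ⟨_, one_mem_smooth⟩
    choose M hM using exists_cutMul_bound hU (.of_contDiff h1)
    refine ⟨∑ i, (eLpNorm (u.grad i) 2 (volume.restrict U)).toReal * M i, fun φ w hw => ?_⟩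
    have hw1 := BdryTrace.cutMul (u := w) hw hm measurableSet_ball hU.subset le_rfl
      (.of_contDiff h1) h3
    change ‖dirichlet u (v φ)‖ ≤ _
    rw [dirichlet_eq_of_trace hU hs (hv φ) (hw1.congr fun x => by simp [h2])]
    refine (norm_dirichlet_le _ _).trans ?_
    rw [Finset.sum_mul]
    refine Finset.sum_le_sum fun i _ => ?_
    rw [mul_assoc]
    exact mul_le_mul_of_nonneg_left (hM i w) ENNReal.toReal_nonneg
  · exact dirichlet_eq_of_trace hU hs (hv φ) hw

/-- The difference of two solutions has zero trace. Testing it with its own conjugate shows that its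
gradient vanishes, which already forces the Neumann traces to agree. -/
theorem isDN_unique [Nonempty (Fin d)] (hU : IsShell U) {f : Sph d → ℂ} {g g' : Functional d}
    (hg : IsDN (BdryTrace (U := U)) f g) (hg' : IsDN (BdryTrace (U := U)) f g') : g = g' := by
  have hm := hU.isOpen.measurableSet
  obtain ⟨-, u, hu, hs, hd⟩ := hg
  obtain ⟨-, u', hu', hs', hd'⟩ := hg'
  have hw : BdryTrace (u.combo (-1) u') 0 := (hu.combo hm hU.subset (-1) hu').congr fun x => by simp
  set w := u.combo (-1) u'
  have hz : dirichlet w w.conj = 0 := by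
    rw [dirichlet_combo_left, hs _ hw.conj_zero, hs' _ hw.conj_zero]; simp
  have hgrad : ∀ i, (eLpNorm (w.grad i) 2 (volume.restrict U)).toReal = 0 := by
    rw [dirichlet_eq_sum] at hz
    have e : ∀ i, ∫ x in U, w.grad i x * w.conj.grad i x =
        (((eLpNorm (w.grad i) 2 (volume.restrict U)).toReal ^ 2 : ℝ) : ℂ) := fun i => by
      rw [toReal_eLpNorm_two_sq (w.memLp_grad i), ← integral_mul_star]; rfl
    simp only [e] at hz
    rw [← Complex.ofReal_sum, Complex.ofReal_eq_zero,
      Finset.sum_eq_zero_iff_of_nonneg fun i _ => by positivity] at hz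
    exact fun i => by simpa using hz i (Finset.mem_univ i)
  ext φ
  obtain ⟨v, hv⟩ := exists_bdryTrace_smooth hU φ
  have h0 : dirichlet w v = 0 := by
    have := norm_dirichlet_le w v
    simp only [hgrad, zero_mul, Finset.sum_const_zero] at this
    exact norm_le_zero_iff.1 this
  rw [dirichlet_combo_left] at h0
  rw [hd φ v hv, hd' φ v hv]
  linear_combination h0

theorem existsUnique_isDN [Nonempty (Fin d)] (hU : IsShell U) {f : Sph d → ℂ}
    (hf : MemHHalf f) : ∃! g, IsDN (BdryTrace (U := U)) f g := by
  obtain ⟨g, hg⟩ := exists_isDN hU hf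
  exact ⟨g, hg, fun g' hg' => isDN_unique hU hg' hg⟩

end WellPosed

/-! ### Differential calculus of the inversion -/

section Inversion

variable {d : ℕ} (a : PBall d)

/-- The coordinates of `x - â`. -/
def disp (i : Fin d) (x : Euc d) : ℂ := coord i x - coord i (hat a)

/-- `|x - â|⁻²`. -/
def invDistSq (x : Euc d) : ℂ := (((‖x - hat a‖ ^ 2)⁻¹ : ℝ) : ℂ)

/-- `g_a` as a complex valued function. -/
def gC (x : Euc d) : ℂ := (gFun a x : ℂ)

/-- The entries of the reflection along `x - â`. -/
def refl (i j : Fin d) (x : Euc d) : ℂ :=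
  (if i = j then 1 else 0) - 2 * (disp a i x * disp a j x * invDistSq a x)

theorem bRad_pos : 0 < bRad a := by
  have h1 := bRad_sq a
  have h2 := one_lt_norm_hat a
  have h3 : 0 ≤ bRad a := Real.sqrt_nonneg _
  have h4 : 0 < bRad a ^ 2 := by rw [h1]; nlinarith
  exact lt_of_le_of_ne h3 fun h => by rw [← h] at h4; simp at h4

theorem hat_notMem_closedBall : hat a ∉ closedBall (0 : Euc d) 1 := by
  simpa using one_lt_norm_hat a

theorem ne_hat_of_mem {x : Euc d} (hx : x ∈ closedBall (0 : Euc d) 1) : x ≠ hat a :=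
  fun h => hat_notMem_closedBall a (h ▸ hx)

theorem disp_eq_coord (i : Fin d) (x : Euc d) : disp a i x = coord i (x - hat a) := by
  simp [disp, coord]

variable {a} in
theorem sum_disp_sq {x : Euc d} (hx : x ≠ hat a) :
    (∑ i, disp a i x * disp a i x) * invDistSq a x = 1 := by
  simp only [disp_eq_coord, sum_coord_mul_coord, invDistSq]
  rw [← Complex.ofReal_mul, mul_inv_cancel₀, Complex.ofReal_one]
  exact pow_ne_zero 2 (norm_ne_zero_iff.2 (sub_ne_zero.2 hx))

theorem gC_sq (x : Euc d) : gC a x ^ 2 = (bRad a : ℂ) ^ 2 * invDistSq a x := by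
  simp [gC, gFun, invDistSq, div_eq_mul_inv, mul_pow]

variable {a} in
theorem gFun_pos {x : Euc d} (hx : x ≠ hat a) : 0 < gFun a x :=
  div_pos (bRad_pos a) (norm_pos_iff.2 (sub_ne_zero.2 hx))

variable {a} in
theorem gC_ne_zero {x : Euc d} (hx : x ≠ hat a) : gC a x ≠ 0 := by
  rw [gC, Complex.ofReal_ne_zero]
  exact (gFun_pos hx).ne'

theorem invA_sub_hat (x : Euc d) : invA a x - hat a = gFun a x ^ 2 • (x - hat a) := by
  simp [invA, EuclideanGeometry.inversion, gFun, dist_eq_norm]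

theorem disp_invA (i : Fin d) (x : Euc d) : disp a i (invA a x) = gC a x ^ 2 * disp a i x := by
  rw [disp_eq_coord, invA_sub_hat, disp_eq_coord]
  simp [coord, gC]

theorem coord_invA (i : Fin d) (x : Euc d) :
    coord i (invA a x) = coord i (hat a) + gC a x ^ 2 * disp a i x := by
  rw [← disp_invA, disp]; ring

theorem invA_invA (x : Euc d) : invA a (invA a x) = x :=
  EuclideanGeometry.inversion_inversion _ (bRad_pos a).ne' x

theorem invA_injective : Function.Injective (invA a) :=
  EuclideanGeometry.inversion_injective _ (bRad_pos a).ne'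

variable {a} in
theorem invA_ne_hat {x : Euc d} (hx : x ≠ hat a) : invA a x ≠ hat a := fun h =>
  hx ((EuclideanGeometry.inversion_eq_center (bRad_pos a).ne').1 h)

variable {a} in
theorem gFun_invA {x : Euc d} (hx : x ≠ hat a) : gFun a (invA a x) = (gFun a x)⁻¹ := by
  have hn : ‖x - hat a‖ ≠ 0 := norm_ne_zero_iff.2 (sub_ne_zero.2 hx)
  have hb := (bRad_pos a).ne'
  rw [gFun, invA_sub_hat, norm_smul, norm_pow, Real.norm_of_nonneg (gFun_pos hx).le, gFun]
  field_simp

variable {a} in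
theorem gC_invA {x : Euc d} (hx : x ≠ hat a) : gC a (invA a x) = (gC a x)⁻¹ := by
  rw [gC, gFun_invA hx, gC, Complex.ofReal_inv]

variable {a} in
theorem invDistSq_invA {x : Euc d} (hx : x ≠ hat a) :
    invDistSq a (invA a x) * gC a x ^ 4 = invDistSq a x := by
  have hb : (bRad a : ℂ) ^ 2 ≠ 0 := pow_ne_zero 2 (by simpa using (bRad_pos a).ne')
  have h1 := gC_sq a (invA a x)
  rw [gC_invA hx] at h1
  have h2 := gC_sq a x
  have h3 := gC_ne_zero hx
  apply mul_left_cancel₀ hb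
  rw [← mul_assoc, ← h1, ← h2]
  field_simp

variable {a} in
theorem refl_invA (i j : Fin d) {x : Euc d} (hx : x ≠ hat a) :
    refl a i j (invA a x) = refl a i j x := by
  rw [refl, refl, disp_invA, disp_invA, ← invDistSq_invA hx]
  ring

theorem refl_symm (i j : Fin d) (x : Euc d) : refl a i j x = refl a j i x := by
  simp only [refl, eq_comm, mul_comm (disp a i x)]

theorem sum_refl_mul (i : Fin d) (x : Euc d) (v : Fin d → ℂ) :
    ∑ j, refl a i j x * v j =
      v i - 2 * disp a i x * invDistSq a x * ∑ j, disp a j x * v j := by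
  simp only [refl, sub_mul, Finset.sum_sub_distrib, ite_mul, one_mul, zero_mul,
    Finset.sum_ite_eq, Finset.mem_univ, if_true, Finset.mul_sum]
  congr 1
  exact Finset.sum_congr rfl fun j _ => by ring

-- A reflection is an involution; `∑ disp² · invDistSq = 1` is the normalisation of its axis.
variable {a} in
theorem sum_refl_refl_mul (i : Fin d) {x : Euc d} (hx : x ≠ hat a) (v : Fin d → ℂ) :
    ∑ j, refl a i j x * ∑ k, refl a j k x * v k = v i := by
  simp only [sum_refl_mul]
  set S := ∑ k, disp a k x * v k
  have h1 : ∀ j, disp a j x * (v j - 2 * disp a j x * invDistSq a x * S) =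
      disp a j x * v j - (2 * invDistSq a x * S) * (disp a j x * disp a j x) := fun j => by ring
  simp only [h1]
  rw [Finset.sum_sub_distrib, ← Finset.mul_sum]
  linear_combination (4 * disp a i x * invDistSq a x * S) * sum_disp_sq hx

variable {a} in
theorem sum_refl_disp (i : Fin d) {x : Euc d} (hx : x ≠ hat a) :
    ∑ j, refl a i j x * disp a j x = - disp a i x := by
  rw [sum_refl_mul]
  linear_combination (-2 * disp a i x) * sum_disp_sq hx

/-- Orthogonality of the inversion sphere and the unit sphere, `|â|² = b² + 1`, makes the defect
`|x|² - 1` scale by the positive factor `g²`. Hence interior, sphere and exterior are each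
preserved. -/
theorem norm_invA_sq {x : Euc d} (hx : x ≠ hat a) :
    ‖invA a x‖ ^ 2 - 1 = gFun a x ^ 2 * (‖x‖ ^ 2 - 1) := by
  have hn : ‖x - hat a‖ ^ 2 ≠ 0 := pow_ne_zero 2 (norm_ne_zero_iff.2 (sub_ne_zero.2 hx))
  have e : invA a x = gFun a x ^ 2 • (x - hat a) + hat a := by
    rw [← invA_sub_hat, sub_add_cancel]
  have h2 : ‖x‖ ^ 2 = ‖x - hat a‖ ^ 2 + 2 * inner ℝ (x - hat a) (hat a) + ‖hat a‖ ^ 2 := by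
    rw [← norm_add_sq_real, sub_add_cancel]
  have h3 : gFun a x ^ 2 * ‖x - hat a‖ ^ 2 = bRad a ^ 2 := by
    rw [gFun, div_pow, div_mul_cancel₀ _ hn]
  have h4 := bRad_sq a
  rw [e, norm_add_sq_real, norm_smul, real_inner_smul_left, Real.norm_of_nonneg (by positivity), h2]
  linear_combination gFun a x ^ 2 * h3 + gFun a x ^ 2 * h4 - h3 - h4

theorem invA_mem_ball {x : Euc d} (hx : x ∈ ball (0 : Euc d) 1) : invA a x ∈ ball (0 : Euc d) 1 := by
  have hx' : x ≠ hat a := ne_hat_of_mem a (ball_subset_closedBall hx)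
  have h1 : ‖x‖ < 1 := by simpa using hx
  have h := norm_invA_sq a hx'
  have h3 : gFun a x ^ 2 * (‖x‖ ^ 2 - 1) < 0 :=
    mul_neg_of_pos_of_neg (pow_pos (gFun_pos hx') 2) (by nlinarith [norm_nonneg x])
  rw [mem_ball_zero_iff]
  nlinarith [norm_nonneg (invA a x)]

/-- On the unit sphere the reflection maps the normal at `y` to the normal at `I_a y`. -/
theorem sum_refl_coord (i : Fin d) (y : Sph d) :
    ∑ j, refl a i j y * coord j y = coord i (invA a y) := by
  have hy := ne_hat a y
  have hn : ‖(y : Euc d)‖ = 1 := by simp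
  have e1 : ∑ j, disp a j y * coord j y =
      ((inner ℝ ((y : Euc d) - hat a) (y : Euc d) : ℝ) : ℂ) := by
    simp only [disp_eq_coord, coord, PiLp.inner_apply, RCLike.inner_apply, conj_trivial]
    push_cast
    exact Finset.sum_congr rfl fun j _ => by ring
  -- Expanding `|â|² = |y - (y - â)|²` with `|y| = 1` and `|â|² = 1 + b²` evaluates `2 y·(y - â)/|y
  -- - â|²` as `1 - g²`. The reflected normal is then `y - (1 - g²)(y - â) = â + g² (y - â)`, which
  -- is the inverted point.
  have e2 : ‖hat a‖ ^ 2 = 1 - 2 * inner ℝ ((y : Euc d) - hat a) (y : Euc d) +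
      ‖(y : Euc d) - hat a‖ ^ 2 := by
    have : hat a = (y : Euc d) - ((y : Euc d) - hat a) := by abel
    conv_lhs => rw [this, norm_sub_sq_real, hn, real_inner_comm]
    ring
  have e3 := bRad_sq a
  have e4 : (2 * ((inner ℝ ((y : Euc d) - hat a) (y : Euc d) : ℝ) : ℂ)) * invDistSq a y =
      1 - gC a y ^ 2 := by
    rw [gC_sq, invDistSq]
    have hq : ‖(y : Euc d) - hat a‖ ^ 2 ≠ 0 :=
      pow_ne_zero 2 (norm_ne_zero_iff.2 (sub_ne_zero.2 hy))
    have : 2 * inner ℝ ((y : Euc d) - hat a) (y : Euc d) * (‖(y : Euc d) - hat a‖ ^ 2)⁻¹ =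
        1 - bRad a ^ 2 * (‖(y : Euc d) - hat a‖ ^ 2)⁻¹ := by
      have h2 : 2 * inner ℝ ((y : Euc d) - hat a) (y : Euc d) =
          ‖(y : Euc d) - hat a‖ ^ 2 - bRad a ^ 2 := by linarith
      rw [h2, sub_mul, mul_inv_cancel₀ hq]
    exact_mod_cast congrArg (fun r : ℝ => (r : ℂ)) this
  rw [sum_refl_mul, e1, coord_invA, disp]
  rw [show coord i (y : Euc d) - 2 * (coord i (y : Euc d) - coord i (hat a)) * invDistSq a y *
    ((inner ℝ ((y : Euc d) - hat a) (y : Euc d) : ℝ) : ℂ) = coord i (y : Euc d) -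
    (coord i (y : Euc d) - coord i (hat a)) * ((2 *
    ((inner ℝ ((y : Euc d) - hat a) (y : Euc d) : ℝ) : ℂ)) * invDistSq a y) by ring, e4]
  ring

/-! Derivatives. -/

variable {a}

theorem differentiableAt_disp (i : Fin d) (x : Euc d) : DifferentiableAt ℝ (disp a i) x :=
  ((contDiff_coord i).differentiable (by simp) x).sub_const _

theorem partialD_disp (i j : Fin d) (x : Euc d) :
    partialD i (disp a j) x = if i = j then 1 else 0 := by
  rw [← partialD_coord i j x, partialD, partialD]
  congr 1
  exact fderiv_sub_const _

theorem hasFDerivAt_invDistSq {x : Euc d} (hx : x ≠ hat a) :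
    HasFDerivAt (invDistSq a) (Complex.ofRealCLM ∘L
      ((-((‖x - hat a‖ ^ 2) ^ 2)⁻¹) • (2 • (innerSL ℝ (x - hat a))))) x := by
  have hq : ‖x - hat a‖ ^ 2 ≠ 0 := pow_ne_zero 2 (norm_ne_zero_iff.2 (sub_ne_zero.2 hx))
  have h1 : HasFDerivAt (fun x => ‖x - hat a‖ ^ 2) (2 • (innerSL ℝ (x - hat a))) x := by
    have := (hasStrictFDerivAt_norm_sq (x - hat a)).hasFDerivAt.comp x
      ((hasFDerivAt_id x).sub_const (hat a))
    simpa [Function.comp_def] using this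
  exact Complex.ofRealCLM.hasFDerivAt.comp x ((hasDerivAt_inv hq).comp_hasFDerivAt x h1)

theorem differentiableAt_invDistSq {x : Euc d} (hx : x ≠ hat a) :
    DifferentiableAt ℝ (invDistSq a) x := (hasFDerivAt_invDistSq hx).differentiableAt

theorem partialD_invDistSq (i : Fin d) {x : Euc d} (hx : x ≠ hat a) :
    partialD i (invDistSq a) x = -2 * disp a i x * invDistSq a x ^ 2 := by
  rw [partialD, (hasFDerivAt_invDistSq hx).fderiv, disp_eq_coord]
  simp [coord, invDistSq, EuclideanSpace.inner_single_right]
  ring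

theorem differentiableAt_gC {x : Euc d} (hx : x ≠ hat a) : DifferentiableAt ℝ (gC a) x :=
  ((contDiffOn_gFun a).contDiffAt (isOpen_compl_singleton.mem_nhds hx)).differentiableAt (by simp)

/-- Obtained by differentiating `g² = b² |x - â|⁻²` and cancelling `2 g`. -/
theorem partialD_gC (i : Fin d) {x : Euc d} (hx : x ≠ hat a) :
    partialD i (gC a) x = - (disp a i x * invDistSq a x) * gC a x := by
  have h1 := partialD_mul i (differentiableAt_gC hx) (differentiableAt_gC hx)
  have h2 : (fun x => gC a x * gC a x) = fun x => (bRad a : ℂ) ^ 2 * invDistSq a x := by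
    funext x; rw [← gC_sq, pow_two]
  rw [h2, partialD_mul i (differentiableAt_const _) (differentiableAt_invDistSq hx),
    partialD_const, partialD_invDistSq i hx] at h1
  apply mul_left_cancel₀ (mul_ne_zero two_ne_zero (gC_ne_zero hx))
  have h3 := gC_sq a x
  linear_combination -h1 + 2 * disp a i x * invDistSq a x * h3

theorem partialD_pow {φ : Euc d → ℂ} {x : Euc d} (i : Fin d) (hφ : DifferentiableAt ℝ φ x)
    (n : ℕ) : partialD i (fun x => φ x ^ n) x = n * φ x ^ (n - 1) * partialD i φ x := by
  rw [partialD, (hφ.hasFDerivAt.pow n).fderiv]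
  simp [partialD]

theorem partialD_gC_pow (i : Fin d) (n : ℕ) {x : Euc d} (hx : x ≠ hat a) :
    partialD i (fun x => gC a x ^ n) x = - n * (disp a i x * invDistSq a x) * gC a x ^ n := by
  rw [partialD_pow i (differentiableAt_gC hx), partialD_gC i hx]
  rcases n with _ | n
  · simp
  · simp only [Nat.add_sub_cancel]; ring

theorem contDiffOn_gC : ContDiffOn ℝ ∞ (gC a) {hat a}ᶜ := contDiffOn_gFun a

theorem contDiffOn_disp (i : Fin d) : ContDiffOn ℝ ∞ (disp a i) {hat a}ᶜ :=
  ((contDiff_coord i).sub contDiff_const).contDiffOn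

theorem contDiffOn_invDistSq : ContDiffOn ℝ ∞ (invDistSq a) {hat a}ᶜ := by
  refine Complex.ofRealCLM.contDiff.comp_contDiffOn (ContDiffOn.inv ?_ fun x hx =>
    pow_ne_zero 2 (norm_ne_zero_iff.2 (sub_ne_zero.2 hx)))
  exact ((contDiff_norm_sq ℝ).comp (contDiff_id.sub contDiff_const)).contDiffOn

theorem contDiffOn_refl (i j : Fin d) : ContDiffOn ℝ ∞ (refl a i j) {hat a}ᶜ :=
  contDiffOn_const.sub (contDiffOn_const.mul
    (((contDiffOn_disp i).mul (contDiffOn_disp j)).mul contDiffOn_invDistSq))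

theorem smoothNear_of_contDiffOn {φ : Euc d → ℂ} (h : ContDiffOn ℝ ∞ φ {hat a}ᶜ) :
    SmoothNear φ :=
  ⟨{hat a}ᶜ, isOpen_compl_singleton, fun _ hx => ne_hat_of_mem a hx, h⟩

/-- Conformality of the inversion: its derivative is `g²` times the reflection in the hyperplane
orthogonal to `x - â`, recorded together with the matrix entries of that map. -/
theorem fderiv_invA_single (i j : Fin d) {x : Euc d} (hx : x ≠ hat a) :
    HasFDerivAt (invA a) (gFun a x ^ 2 •
      ((Submodule.span ℝ {x - hat a})ᗮ.reflection : Euc d →L[ℝ] Euc d)) x ∧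
    coord j ((gFun a x ^ 2 • ((Submodule.span ℝ {x - hat a})ᗮ.reflection :
      Euc d →L[ℝ] Euc d)) (EuclideanSpace.single i 1)) = gC a x ^ 2 * refl a i j x := by
  refine ⟨?_, ?_⟩
  · have := EuclideanGeometry.hasFDerivAt_inversion (R := bRad a) hx
    rwa [dist_eq_norm] at this
  · have : ((Submodule.span ℝ {x - hat a})ᗮ.reflection : Euc d →L[ℝ] Euc d)
        (EuclideanSpace.single i 1) = EuclideanSpace.single i 1 -
          (2 * ((x - hat a) i / ‖x - hat a‖ ^ 2)) • (x - hat a) := by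
      change (Submodule.span ℝ {x - hat a})ᗮ.reflection (EuclideanSpace.single i 1) = _
      rw [Submodule.reflection_orthogonal_apply, Submodule.reflection_singleton_apply]
      simp [EuclideanSpace.inner_single_right, two_smul, two_mul, add_smul]
    rw [smul_apply, this]
    simp only [coord, PiLp.smul_apply, PiLp.sub_apply, smul_eq_mul, refl, disp_eq_coord, invDistSq,
      gC, PiLp.single_apply, eq_comm (a := j)]
    push_cast
    split_ifs <;> push_cast <;> ring

theorem partialD_comp_invA (i : Fin d) {ψ : Euc d → ℂ} {x : Euc d} (hx : x ≠ hat a)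
    (hψ : DifferentiableAt ℝ ψ (invA a x)) :
    partialD i (fun x => ψ (invA a x)) x =
      ∑ j, gC a x ^ 2 * refl a i j x * partialD j ψ (invA a x) := by
  have h : HasFDerivAt (fun x => ψ (invA a x)) _ x :=
    hψ.hasFDerivAt.comp x (fderiv_invA_single i i hx).1
  rw [partialD, h.fderiv, ContinuousLinearMap.comp_apply, fderiv_eq_sum]
  exact Finset.sum_congr rfl fun j _ => by rw [(fderiv_invA_single i j hx).2]

/-- A reflection has determinant of modulus one, so only the scaling by `g²` in dimension `d`
counts. -/
theorem abs_det_fderiv_invA (x : Euc d) :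
    |(gFun a x ^ 2 • ((Submodule.span ℝ {x - hat a})ᗮ.reflection : Euc d →L[ℝ] Euc d)).det| =
      gFun a x ^ (2 * d) := by
  have h : ((gFun a x ^ 2 • ((Submodule.span ℝ {x - hat a})ᗮ.reflection :
      Euc d →L[ℝ] Euc d)).det) = (gFun a x ^ 2) ^ d *
        LinearMap.det ((Submodule.span ℝ {x - hat a})ᗮ.reflection.toLinearMap) := by
    rw [ContinuousLinearMap.det]
    have := LinearMap.det_smul (gFun a x ^ 2)
      ((Submodule.span ℝ {x - hat a})ᗮ.reflection.toLinearMap)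
    rw [finrank_euclideanSpace_fin] at this
    exact this
  have h2 := Submodule.det_reflection (𝕜 := ℝ) (Submodule.span ℝ {x - hat a})ᗮ
  rw [h, h2]
  simp only [abs_mul, abs_pow, abs_neg, abs_one, one_pow, mul_one, sq_abs]
  rw [pow_mul]

end Inversion

/-! ### Transformation of integrals under the inversion -/

section Pullback

variable {d : ℕ} {a : PBall d} {U : Set (Euc d)}

theorem differentiableAt_refl (i j : Fin d) {x : Euc d} (hx : x ≠ hat a) :
    DifferentiableAt ℝ (refl a i j) x :=
  ((contDiffOn_refl i j).contDiffAt (isOpen_compl_singleton.mem_nhds hx)).differentiableAt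
    (by simp)

theorem partialD_refl (i j k : Fin d) {x : Euc d} (hx : x ≠ hat a) :
    partialD k (refl a i j) x = -2 * ((if k = i then 1 else 0) * disp a j x * invDistSq a x +
      disp a i x * (if k = j then 1 else 0) * invDistSq a x -
        2 * disp a i x * disp a j x * disp a k x * invDistSq a x ^ 2) := by
  have hi := differentiableAt_disp (a := a) i x
  have hj := differentiableAt_disp (a := a) j x
  have hp := differentiableAt_invDistSq hx
  have h1 : partialD k (refl a i j) x =
      partialD k (fun x => (-2 : ℂ) * (disp a i x * disp a j x * invDistSq a x)) x := by
    have e : refl a i j = fun x => (if i = j then (1 : ℂ) else 0) +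
        (-2 : ℂ) * (disp a i x * disp a j x * invDistSq a x) := by
      funext x; rw [refl]; ring
    rw [e, partialD_add k (differentiableAt_const _)
      ((differentiableAt_const _).fun_mul ((hi.fun_mul hj).fun_mul hp)), partialD_const, zero_add]
  rw [h1, partialD_mul k (differentiableAt_const _) ((hi.fun_mul hj).fun_mul hp), partialD_const,
    partialD_mul k (hi.fun_mul hj) hp, partialD_mul k hi hj, partialD_disp, partialD_disp,
    partialD_invDistSq k hx]
  ring

/-- The Piola identity for the inversion. -/
theorem sum_partialD_piola (hd : 1 ≤ d) (i : Fin d) {ψ : Euc d → ℂ} (hψ : ContDiff ℝ ∞ ψ)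
    {x : Euc d} (hx : x ≠ hat a) :
    ∑ j, partialD j (fun x => gC a x ^ (2 * (d - 1)) * refl a i j x * ψ (invA a x)) x =
      gC a x ^ (2 * d) * partialD i ψ (invA a x) := by
  have hg : DifferentiableAt ℝ (fun x => gC a x ^ (2 * (d - 1))) x :=
    (differentiableAt_gC hx).fun_pow _
  have hI : DifferentiableAt ℝ (invA a) x := (fderiv_invA_single i i hx).1.differentiableAt
  have hψI : DifferentiableAt ℝ (fun x => ψ (invA a x)) x :=
    (hψ.differentiable (by simp) (invA a x)).comp x hI
  have e : ∀ j, partialD j (fun x => gC a x ^ (2 * (d - 1)) * refl a i j x * ψ (invA a x)) x =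
      gC a x ^ (2 * (d - 1)) * (refl a i j x * partialD j (fun x => ψ (invA a x)) x) +
      (gC a x ^ (2 * (d - 1)) * ψ (invA a x) * invDistSq a x) *
        (-2 * ((if j = i then 1 else 0) * disp a j x) - 2 * disp a i x +
          (4 * disp a i x * invDistSq a x) * (disp a j x * disp a j x) -
          (2 * (d - 1)) * (refl a i j x * disp a j x)) := by
    intro j
    rw [partialD_mul j (hg.fun_mul (differentiableAt_refl i j hx)) hψI,
      partialD_mul j hg (differentiableAt_refl i j hx), partialD_gC_pow j _ hx,
      partialD_refl i j j hx]
    push_cast [Nat.cast_pred hd]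
    simp only [if_true]
    ring
  have e2 : ∀ j, partialD j (fun x => ψ (invA a x)) x =
      gC a x ^ 2 * ∑ k, refl a j k x * partialD k ψ (invA a x) := by
    intro j
    rw [partialD_comp_invA j hx (hψ.differentiable (by simp) _), Finset.mul_sum]
    exact Finset.sum_congr rfl fun k _ => by ring
  have e3 : ∑ j, refl a i j x * partialD j (fun x => ψ (invA a x)) x =
      gC a x ^ 2 * partialD i ψ (invA a x) := by
    simp only [e2, mul_left_comm _ (gC a x ^ 2)]
    rw [← Finset.mul_sum, sum_refl_refl_mul i hx]
  simp only [e]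
  rw [Finset.sum_add_distrib, ← Finset.mul_sum, ← Finset.mul_sum, e3]
  -- The four groups contribute `-2`, `-2d`, `4` and `2(d - 1)` times `disp a i x`, using that the
  -- reflection negates `x - â`; they add to zero. This is the divergence-free property of the
  -- cofactor matrix.
  have e4 : ∑ j, (-2 * ((if j = i then 1 else 0) * disp a j x) - 2 * disp a i x +
          (4 * disp a i x * invDistSq a x) * (disp a j x * disp a j x) -
          (2 * (d - 1)) * (refl a i j x * disp a j x)) = 0 := by
    rw [Finset.sum_sub_distrib, Finset.sum_add_distrib, Finset.sum_sub_distrib, ← Finset.mul_sum,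
      ← Finset.mul_sum, ← Finset.mul_sum, ← Finset.mul_sum, sum_refl_disp i hx]
    simp only [ite_mul, one_mul, zero_mul, Finset.sum_ite_eq', Finset.mem_univ, if_true,
      Finset.sum_const, Finset.card_univ, Fintype.card_fin, nsmul_eq_mul]
    linear_combination (4 * disp a i x) * sum_disp_sq hx
  rw [e4, mul_zero, add_zero, ← mul_assoc, ← pow_add]
  congr 2
  omega

theorem integral_image_invA [Nonempty (Fin d)] (hU : MeasurableSet U) (hUb : U ⊆ ball 0 1) (F : Euc d → ℂ) :
    ∫ x in invA a '' U, F x = ∫ x in U, gC a x ^ (2 * d) * F (invA a x) := by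
  have hne : ∀ x ∈ U, x ≠ hat a := fun x hx => ne_hat_of_mem a (ball_subset_closedBall (hUb hx))
  let i : Fin d := Classical.arbitrary _
  rw [integral_image_eq_integral_abs_det_fderiv_smul volume hU
    (fun x hx => (fderiv_invA_single i i (hne x hx)).1.hasFDerivWithinAt)
    ((invA_injective a).injOn)]
  refine setIntegral_congr_fun hU fun x _ => ?_
  simp only [abs_det_fderiv_invA, gC, Complex.real_smul, Complex.ofReal_pow]

theorem integrableOn_image_invA [Nonempty (Fin d)] (hU : MeasurableSet U) (hUb : U ⊆ ball 0 1)
    (F : Euc d → ℂ) :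
    IntegrableOn F (invA a '' U) ↔ IntegrableOn (fun x => gC a x ^ (2 * d) * F (invA a x)) U := by
  have hne : ∀ x ∈ U, x ≠ hat a := fun x hx => ne_hat_of_mem a (ball_subset_closedBall (hUb hx))
  let i : Fin d := Classical.arbitrary _
  rw [integrableOn_image_iff_integrableOn_abs_det_fderiv_smul volume hU
    (fun x hx => (fderiv_invA_single i i (hne x hx)).1.hasFDerivWithinAt)
    ((invA_injective a).injOn)]
  refine integrableOn_congr_fun (fun x _ => ?_) hU
  simp only [abs_det_fderiv_invA, gC, Complex.real_smul, Complex.ofReal_pow]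

theorem smoothNear_comp_invA {ψ : Euc d → ℂ} (hψ : ContDiff ℝ ∞ ψ) :
    SmoothNear fun x => ψ (invA a x) :=
  smoothNear_of_contDiffOn (a := a) (hψ.comp_contDiffOn (contDiffOn_inv a))

/-- After the change of variables the left side is the sum over `j` of the trace identities of `u`
tested with the components of the Piola field. On the sphere the reflection takes the normal at `y`
to the normal at its image, which gives the boundary factor. -/
theorem integral_pullback [Nonempty (Fin d)] (hd : 1 ≤ d) (hU : MeasurableSet U) (hUb : U ⊆ ball 0 1)
    {u : H1 U} {f : Sph d → ℂ} (hu : BdryTrace u f) {ψ : Euc d → ℂ} (hψ : ContDiff ℝ ∞ ψ)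
    (i : Fin d) :
    ∫ x in invA a '' U, (u.val (invA a x) * partialD i ψ x +
        (∑ j, gC a x ^ 2 * refl a i j x * u.grad j (invA a x)) * ψ x) =
      ∫ y : Sph d, f y * (gC a y ^ (2 * (d - 1)) * (ψ (invA a y) * coord i (invA a y)))
        ∂(surf d) := by
  have hP : ∀ j, SmoothNear fun x => gC a x ^ (2 * (d - 1)) * refl a i j x * ψ (invA a x) :=
    fun j => ((smoothNear_of_contDiffOn (a := a) (contDiffOn_gC.pow _)).mul
      (smoothNear_of_contDiffOn (a := a) (contDiffOn_refl i j))).mul (smoothNear_comp_invA hψ)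
  have hsum := Finset.sum_congr (s₁ := Finset.univ) rfl fun j (_ : j ∈ Finset.univ) =>
    hu.integral_smoothNear hU hUb (hP j) j
  rw [← integral_finsetSum, ← integral_finsetSum] at hsum
  · rw [integral_image_invA hU hUb]
    convert hsum using 1
    · refine setIntegral_congr_fun hU fun x hx => ?_
      have hx' : x ≠ hat a := ne_hat_of_mem a (ball_subset_closedBall (hUb hx))
      simp only [invA_invA, refl_invA _ _ hx', gC_invA hx']
      rw [Finset.sum_add_distrib, ← Finset.mul_sum, sum_partialD_piola hd i hψ hx', mul_add,
        Finset.sum_mul, Finset.mul_sum]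
      congr 1
      · ring
      · refine Finset.sum_congr rfl fun j _ => ?_
        have hg := gC_ne_zero hx'
        have e : gC a x ^ (2 * d) = gC a x ^ (2 * (d - 1)) * gC a x ^ 2 := by
          rw [← pow_add]; congr 1; omega
        rw [e]
        field_simp
    · congr 1; ext y
      rw [← sum_refl_coord a i y, Finset.mul_sum, Finset.mul_sum, Finset.mul_sum]
      exact Finset.sum_congr rfl fun j _ => by ring
  · intro j _
    exact (memLp_mul_sphere (memLp_mul_sphere hu.1 (hP j).continuous_sphere)
      (smoothNear_coord j).continuous_sphere).integrable (by norm_num)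
  · intro j _
    exact (integrable_mul_of_continuousOn hU hUb u.memLp_val ((hP j).partialD j).continuousOn).add
      (integrable_mul_of_continuousOn hU hUb (u.memLp_grad j) (hP j).continuousOn)

theorem image_invA_ball : invA a '' ball (0 : Euc d) 1 = ball 0 1 := by
  refine Subset.antisymm (image_subset_iff.2 fun x hx => invA_mem_ball a hx) fun x hx => ?_
  exact ⟨invA a x, invA_mem_ball a hx, invA_invA a x⟩

/-! ### The surface measure under the inversion. -/

theorem invSph_invSph (y : Sph d) : invSph a (invSph a y) = y := Subtype.ext (invA_invA a y)

theorem continuous_invSph : Continuous (invSph a) :=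
  Continuous.subtype_mk ((contDiffOn_inv a).continuousOn.comp_continuous continuous_subtype_val
    fun y => ne_hat a y) _

/-- Change of variables on the sphere for smooth functions. -/
theorem integral_invSph_smooth [Nonempty (Fin d)] (hd : 1 ≤ d) (φ : Smooth d) :
    ∫ y : Sph d, (φ : Sph d → ℂ) y ∂(surf d) =
      ∫ y : Sph d, gC a y ^ (2 * (d - 1)) * (φ : Sph d → ℂ) (invSph a y) ∂(surf d) := by
  obtain ⟨O, Φ, hO, hs, hΦ, h⟩ := φ.2
  obtain ⟨h, h1, -, -, h3⟩ := exists_contDiff_eventuallyEq (isCompact_sphere (0 : Euc d) 1) hO hs hΦ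
  have hφ : ∀ y : Sph d, (φ : Sph d → ℂ) y = h y := fun y => by
    rw [(h3 y y.2).eq_of_nhds]; apply_assumption
  have key : ∀ ψ : Euc d → ℂ, ContDiff ℝ ∞ ψ → ∀ i, ∫ y : Sph d, ψ y * coord i y ∂(surf d) =
      ∫ y : Sph d, gC a y ^ (2 * (d - 1)) * (ψ (invA a y) * coord i (invA a y)) ∂(surf d) := by
    intro ψ hψ i
    -- With `u = 1` the pullback formula has boundary terms on both sides, so it computes the
    -- Jacobian of the inversion on the sphere without charts.
    have e := integral_pullback (a := a) hd measurableSet_ball le_rfl bdryTrace_one hψ i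
    rw [image_invA_ball] at e
    rw [← integral_ball_partialD hψ]
    simpa [H1.one] using e
  have hc : ∀ y : Sph d, ∑ i, coord i (y : Euc d) * coord i (y : Euc d) = 1 := fun y => by
    rw [sum_coord_mul_coord]; simp
  -- As `∑ y_i² = 1`, every function on the sphere is a sum of normal components `(h y_i) y_i`, the
  -- form handled by `key`.
  have e1 : ∀ y : Sph d, (φ : Sph d → ℂ) y =
      ∑ i, (h (y : Euc d) * coord i (y : Euc d)) * coord i (y : Euc d) := fun y => by
    simp only [mul_assoc]
    rw [← Finset.mul_sum, hc y, mul_one, hφ]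
  simp only [e1]
  have hcont : ∀ i : Fin d, ContDiff ℝ ∞ fun x => h x * coord i x :=
    fun i => h1.mul (contDiff_coord i)
  have int : ∀ {F : Sph d → ℂ}, Continuous F → Integrable F (surf d) := fun hF => by
    simpa using (memLp_mul_sphere (memLp_const (1 : ℂ)) hF).integrable (by norm_num)
  have int1 : ∀ i ∈ Finset.univ, Integrable (fun y : Sph d =>
      (h (y : Euc d) * coord i (y : Euc d)) * coord i (y : Euc d)) (surf d) := fun i _ =>
    int (((hcont i).mul (contDiff_coord i)).continuous.comp continuous_subtype_val)
  rw [integral_finsetSum _ int1]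
  simp only [fun i => key _ (hcont i) i, Finset.mul_sum]
  rw [integral_finsetSum _ fun i _ => ?_]
  · rfl
  · refine int ?_
    have := ((smoothNear_of_contDiffOn (a := a) (contDiffOn_gC.pow (2 * (d - 1)))).mul
      (smoothNear_comp_invA (a := a) ((hcont i).mul (contDiff_coord i)))).continuous_sphere
    exact this

theorem comp_invSph_mem_smooth (φ : Smooth d) :
    (fun y => (φ : Sph d → ℂ) (invSph a y)) ∈ Smooth d := by
  obtain ⟨O, Φ, hO, hs, hΦ, h⟩ := φ.2
  exact ⟨{hat a}ᶜ ∩ invA a ⁻¹' O, fun x => Φ (invA a x),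
    (contDiffOn_inv a).continuousOn.isOpen_inter_preimage isOpen_compl_singleton hO,
    fun x hx => ⟨ne_hat a ⟨x, hx⟩, hs (inv_mem a ⟨x, hx⟩)⟩,
    hΦ.comp ((contDiffOn_inv a).mono inter_subset_left) fun _ hx => hx.2, fun y => h _⟩

/-- Measures on the sphere are determined by the integrals of smooth functions. -/
theorem measure_ext_smooth {μ ν : Measure (Sph d)} [IsFiniteMeasure μ] [IsFiniteMeasure ν]
    (h : ∀ φ : Smooth d, ∫ y, (φ : Sph d → ℂ) y ∂μ = ∫ y, (φ : Sph d → ℂ) y ∂ν) : μ = ν := by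
  have hmul : ∀ {φ ψ : Sph d → ℂ}, φ ∈ Smooth d → ψ ∈ Smooth d → φ * ψ ∈ Smooth d := by
    rintro φ ψ ⟨U, Φ, hU, hs, hΦ, h⟩ ⟨V, Ψ, hV, ht, hΨ, k⟩
    exact ⟨U ∩ V, fun x => Φ x * Ψ x, hU.inter hV, subset_inter hs ht,
      (hΦ.mono inter_subset_left).mul (hΨ.mono inter_subset_right),
      fun x => by simp [h x, k x]⟩
  have hconst : ∀ c : ℂ, (fun _ => c : Sph d → ℂ) ∈ Smooth d := fun c =>
    (SmoothNear.const c).mem_smooth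
  -- Smooth functions form a star subalgebra that separates points through the coordinates, hence
  -- determine a finite measure.
  let A : StarSubalgebra ℂ (BoundedContinuousFunction (Sph d) ℂ) :=
    { carrier := {g | (g : Sph d → ℂ) ∈ Smooth d}
      mul_mem' := fun hf hg => hmul hf hg
      one_mem' := hconst 1
      add_mem' := fun hf hg => (Smooth d).add_mem hf hg
      zero_mem' := (Smooth d).zero_mem
      algebraMap_mem' := fun c => hconst c
      star_mem' := by
        rintro g ⟨U, Φ, hU, hs, hΦ, h⟩
        exact ⟨U, fun x => star (Φ x), hU, hs,
          Complex.conjCLE.toContinuousLinearMap.contDiff.comp_contDiffOn hΦ,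
          fun x => by simp [h x]⟩ }
  refine ext_of_forall_mem_subalgebra_integral_eq_of_pseudoEMetric_complete_countable (𝕜 := ℂ)
    (A := A) ?_ fun g hg => h ⟨g, hg⟩
  intro x y hxy
  have : ∃ i, (x : Euc d) i ≠ (y : Euc d) i := by
    by_contra hcon
    push Not at hcon
    exact hxy (Subtype.ext (PiLp.ext hcon))
  obtain ⟨i, hi⟩ := this
  let g : BoundedContinuousFunction (Sph d) ℂ :=
    BoundedContinuousFunction.mkOfCompact ⟨fun x => coord i x,
      (smoothNear_coord i).continuous_sphere⟩
  have hg : g ∈ A := (smoothNear_coord i).mem_smooth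
  refine ⟨_, ⟨_, ⟨g, hg, rfl⟩, rfl⟩, ?_⟩
  simpa [g, coord] using hi

variable (a) in
theorem continuous_gFun_pow (n : ℕ) : Continuous fun y : Sph d => gFun a y ^ n :=
  Continuous.pow (Complex.continuous_re.comp
    (smoothNear_of_contDiffOn (a := a) contDiffOn_gC).continuous_sphere) n

/-- Upgrades the change of variables from smooth functions to an identity of measures, so that it
applies to square integrable traces. -/
theorem map_invSph_surf [Nonempty (Fin d)] (hd : 1 ≤ d) :
    (surf d).map (invSph a) =
      (surf d).withDensity fun y => ENNReal.ofReal (gFun a y ^ (2 * (d - 1))) := by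
  have hgc := continuous_gFun_pow a (2 * (d - 1))
  have hg0 : ∀ y : Sph d, 0 ≤ gFun a y ^ (2 * (d - 1)) := fun y =>
    pow_nonneg (gFun_pos (ne_hat a y)).le _
  have hfin : IsFiniteMeasure
      ((surf d).withDensity fun y => ENNReal.ofReal (gFun a y ^ (2 * (d - 1)))) := by
    refine isFiniteMeasure_withDensity_ofReal (Integrable.hasFiniteIntegral (f := fun y : Sph d => gFun a y ^ (2 * (d - 1))) ?_)
    exact hgc.integrable_of_hasCompactSupport (HasCompactSupport.of_compactSpace _)
  refine measure_ext_smooth fun φ => ?_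
  rw [integral_map continuous_invSph.measurable.aemeasurable
    (smooth_continuous φ).aestronglyMeasurable,
    integral_withDensity_eq_integral_toReal_smul hgc.measurable.ennreal_ofReal (by simp)]
  have h := integral_invSph_smooth (a := a) hd ⟨_, comp_invSph_mem_smooth (a := a) φ⟩
  refine h.trans ?_
  congr 1; ext y
  simp only [invSph_invSph, ENNReal.toReal_ofReal (hg0 y), Complex.real_smul, gC,
    Complex.ofReal_pow]

/-- The pushed-forward surface measure has a bounded density, so composition preserves square
integrability. -/
theorem memLp_comp_invSph [Nonempty (Fin d)] (hd : 1 ≤ d) {f : Sph d → ℂ}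
    (hf : MemLp f 2 (surf d)) : MemLp (fun y => f (invSph a y)) 2 (surf d) := by
  have hgc := continuous_gFun_pow a (2 * (d - 1))
  have hm : AEMeasurable (invSph a) (surf d) := continuous_invSph.measurable.aemeasurable
  have hac : (surf d).map (invSph a) ≪ surf d := by
    rw [map_invSph_surf hd]; exact withDensity_absolutelyContinuous _ _
  refine MemLp.comp_of_map (f := invSph a) (g := f) ?_ hm
  rw [memLp_two_iff_integrable_sq_norm (hf.1.mono_ac hac), map_invSph_surf hd,
    integrable_withDensity_iff_integrable_smul' (hgc.measurable.ennreal_ofReal) (by simp)]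
  have h2 := (memLp_two_iff_integrable_sq_norm hf.1).1 hf
  obtain ⟨M, hM⟩ := (isCompact_range hgc).isBounded.exists_norm_le
  refine (h2.bdd_mul (c := M) hgc.aestronglyMeasurable
    (Filter.Eventually.of_forall fun x => hM _ ⟨x, rfl⟩)).congr ?_
  refine Filter.Eventually.of_forall fun y => ?_
  simp [ENNReal.toReal_ofReal (pow_nonneg (gFun_pos (ne_hat a y)).le _)]

theorem integral_comp_invSph [Nonempty (Fin d)] (hd : 1 ≤ d) {f : Sph d → ℂ}
    (hf : AEStronglyMeasurable f (surf d)) :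
    ∫ y, f (invSph a y) ∂(surf d) = ∫ y : Sph d, gC a y ^ (2 * (d - 1)) * f y ∂(surf d) := by
  have hac : (surf d).map (invSph a) ≪ surf d := by
    rw [map_invSph_surf hd]; exact withDensity_absolutelyContinuous _ _
  rw [← integral_map continuous_invSph.measurable.aemeasurable (hf.mono_ac hac),
    map_invSph_surf hd, integral_withDensity_eq_integral_toReal_smul
      (continuous_gFun_pow a _).measurable.ennreal_ofReal (by simp)]
  congr 1; ext y
  simp [ENNReal.toReal_ofReal (pow_nonneg (gFun_pos (ne_hat a y)).le _), gC]

end Pullback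

/-! ### The Kelvin transformation of Sobolev functions -/

section Kelvin

variable {d : ℕ} {a : PBall d} {U U' : Set (Euc d)}

/-- The Jacobian `g^(2d)` is bounded on the closed ball, so the change of variables preserves
integrability of `f` and of `|f|²`. -/
theorem memLp_comp_invA [Nonempty (Fin d)] (hU : MeasurableSet U) (hUb : U ⊆ ball 0 1)
    {f : Euc d → ℂ} (hf : MemLp f 2 (volume.restrict U)) :
    MemLp (fun x => f (invA a x)) 2 (volume.restrict (invA a '' U)) := by
  have hg : ContinuousOn (fun x => gC a x ^ (2 * d)) (closedBall 0 1) :=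
    (smoothNear_of_contDiffOn (a := a) (contDiffOn_gC.pow (2 * d))).continuousOn
  have key : ∀ F : Euc d → ℂ, IntegrableOn F U →
      IntegrableOn (fun x => F (invA a x)) (invA a '' U) := by
    intro F hF
    rw [integrableOn_image_invA hU hUb]
    simp only [invA_invA]
    obtain ⟨M, hM⟩ := ((isCompact_closedBall (0 : Euc d) 1).image_of_continuousOn hg).isBounded
      |>.exists_norm_le
    have hUc : U ⊆ closedBall 0 1 := hUb.trans ball_subset_closedBall
    refine hF.bdd_mul (c := M) ((hg.mono hUc).aestronglyMeasurable hU) ?_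
    exact (ae_restrict_mem hU).mono fun x hx => hM _ ⟨x, hUc hx, rfl⟩
  have h1 := (key f (integrable_of_memLp hUb hf)).aestronglyMeasurable
  rw [memLp_two_iff_integrable_sq_norm h1]
  have h2 := key _ ((memLp_two_iff_integrable_sq_norm hf.1).1 hf).ofReal
  exact h2.re

/-- The composition of a Sobolev function with the inversion. -/
theorem exists_comp_invA [Nonempty (Fin d)] (hd : 1 ≤ d) (hU : MeasurableSet U)
    (hUb : U ⊆ ball 0 1) (hU' : MeasurableSet U') (hUU' : U' = invA a '' U) {u : H1 U}
    {f : Sph d → ℂ} (hu : BdryTrace u f) :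
    ∃ w : H1 U', (∀ x, w.val x = u.val (invA a x)) ∧
      (∀ i x, w.grad i x = ∑ j, gC a x ^ 2 * refl a i j x * u.grad j (invA a x)) ∧
      BdryTrace w (fun y => f (invSph a y)) := by
  subst hUU'
  have hUb' : invA a '' U ⊆ ball 0 1 := image_subset_iff.2 fun x hx => invA_mem_ball a (hUb hx)
  have hs : ∀ i j, ContinuousOn (fun x => gC a x ^ 2 * refl a i j x) (closedBall 0 1) := fun i j =>
    ((smoothNear_of_contDiffOn (a := a) (contDiffOn_gC.pow 2)).mul
      (smoothNear_of_contDiffOn (a := a) (contDiffOn_refl i j))).continuousOn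
  have hv := memLp_comp_invA (a := a) hU hUb u.memLp_val
  have hg : ∀ i, MemLp (fun x => ∑ j, gC a x ^ 2 * refl a i j x * u.grad j (invA a x)) 2
      (volume.restrict (invA a '' U)) := fun i => by
    refine memLp_finsetSum _ fun j _ => ?_
    simpa only [mul_comm] using
      memLp_mul_of_continuousOn hU' hUb' (memLp_comp_invA (a := a) hU hUb (u.memLp_grad j)) (hs i j)
  have ht : ∀ (i : Fin d) (ψ : Euc d → ℂ), ContDiff ℝ ∞ ψ →
      ∫ x in invA a '' U, (u.val (invA a x) * partialD i ψ x +
        (∑ j, gC a x ^ 2 * refl a i j x * u.grad j (invA a x)) * ψ x) =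
      ∫ y : Sph d, f (invSph a y) * ψ y * ((y : Euc d) i : ℂ) ∂(surf d) := by
    intro i ψ hψ
    rw [integral_pullback hd hU hUb hu hψ i]
    have hc : Continuous fun y : Sph d => ψ (invA a y) * coord i (invA a y) :=
      (smoothNear_comp_invA (a := a) (hψ.mul (contDiff_coord i))).continuous_sphere
    -- The boundary term from the pullback sits at the inverted point with weight `g^(2(d-1))`; this
    -- moves it back to the composed trace.
    have e := integral_comp_invSph (a := a) hd (memLp_mul_sphere hu.1 hc).1
    convert e.symm using 1
    · congr 1; ext y; ring
    · congr 1; ext y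
      change _ = f (invSph a y) * (ψ (invA a (invA a y)) * coord i (invA a (invA a y)))
      rw [invA_invA, mul_assoc]
      rfl
  exact ⟨{  val := fun x => u.val (invA a x)
            grad := fun i x => ∑ j, gC a x ^ 2 * refl a i j x * u.grad j (invA a x)
            memLp_val := hv
            memLp_grad := hg
            weak := fun i φ hφ _ hs => weak_of_trace hU' hUb' hv (hg i) (ht i) φ hφ hs },
    fun _ => rfl, fun _ _ => rfl, memLp_comp_invSph hd hu.1, ht⟩

theorem smoothNear_gC_pow (n : ℕ) : SmoothNear fun x => gC a x ^ n :=
  smoothNear_of_contDiffOn (a := a) (contDiffOn_gC.pow n)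

/-- The Kelvin transformation of a Sobolev function. -/
theorem exists_kelvin [Nonempty (Fin d)] (hd : 1 ≤ d) (hU : MeasurableSet U)
    (hUb : U ⊆ ball 0 1) (hU' : MeasurableSet U') (hUU' : U' = invA a '' U) {u : H1 U}
    {f : Sph d → ℂ} (hu : BdryTrace u f) :
    ∃ w v : H1 U', (∀ x, w.val x = u.val (invA a x)) ∧
      (∀ i x, w.grad i x = ∑ j, gC a x ^ 2 * refl a i j x * u.grad j (invA a x)) ∧
      BdryTrace w (fun y => f (invSph a y)) ∧ BdryTrace v (kelvin a f) ∧
      (∀ i x, v.grad i x = w.grad i x * gC a x ^ (d - 2) +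
        w.val x * partialD i (fun x => gC a x ^ (d - 2)) x) := by
  obtain ⟨w, h1, h2, h3⟩ := exists_comp_invA hd hU hUb hU' hUU' hu
  have hUb' : U' ⊆ ball 0 1 := by
    rw [hUU']; exact image_subset_iff.2 fun x hx => invA_mem_ball a (hUb hx)
  refine ⟨w, w.cutMul hU' hU' le_rfl hUb' _ (smoothNear_gC_pow (a := a) (d - 2)), h1, h2, h3,
    ?_, fun _ _ => rfl⟩
  refine (h3.cutMul hU' hU' le_rfl hUb' (smoothNear_gC_pow (a := a) (d - 2)) ?_).congr ?_
  · simp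
  · intro y
    simp only [kelvin, gC, mul_comm]

theorem kelvin_kelvin (f : Sph d → ℂ) : kelvin a (kelvin a f) = f := by
  ext y
  have h := gC_ne_zero (ne_hat a y)
  have h1 : (gFun a (invSph a y) : ℂ) = (gC a y)⁻¹ := gC_invA (ne_hat a y)
  simp only [kelvin, invSph_invSph, h1]
  change gC a y ^ (d - 2) * _ = _
  rw [← mul_assoc, ← mul_pow, mul_inv_cancel₀ h, one_pow, one_mul]

theorem MemHHalf.kelvin [Nonempty (Fin d)] (hd : 1 ≤ d) {f : Sph d → ℂ} (hf : MemHHalf f) :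
    MemHHalf (kelvin a f) := by
  obtain ⟨u, hu⟩ := hf
  obtain ⟨-, v, -, -, -, hv, -⟩ := exists_kelvin (a := a) hd measurableSet_ball le_rfl
    measurableSet_ball image_invA_ball.symm hu
  exact ⟨v, hv⟩

theorem hMul_eq (f : Sph d → ℂ) (y : Sph d) :
    hMul a f y = (∑ i, coord i y * disp a i y) * invDistSq a y * f y := by
  have : (inner ℝ (y : Euc d) ((y : Euc d) - hat a) : ℂ) = ∑ i, coord i y * disp a i y := by
    rw [PiLp.inner_apply]
    push_cast
    refine Finset.sum_congr rfl fun i _ => ?_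
    simp [disp_eq_coord, coord, mul_comm]
  rw [hMul, div_eq_mul_inv, Complex.ofReal_mul, this, invDistSq]

/-- The field `g_a^{d-2} (x - â) / |x - â|²`, a multiple of the gradient of `g_a^{d-2}`, is
divergence free. -/
theorem sum_partialD_gradient (hd : 2 ≤ d) {x : Euc d} (hx : x ≠ hat a) :
    ∑ i, partialD i (fun x => gC a x ^ (d - 2) * (disp a i x * invDistSq a x)) x = 0 := by
  -- Differentiating `g^(d-2)` and `|x - â|⁻²` contributes `-(d - 2)` and `-2`, hence the
  -- coefficient `-d`; summation over `i` then gives `d - d = 0`.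
  have e : ∀ i, partialD i (fun x => gC a x ^ (d - 2) * (disp a i x * invDistSq a x)) x =
      gC a x ^ (d - 2) * invDistSq a x *
        (1 - d * invDistSq a x * (disp a i x * disp a i x)) := by
    intro i
    rw [partialD_mul i ((differentiableAt_gC hx).fun_pow _)
      ((differentiableAt_disp i x).fun_mul (differentiableAt_invDistSq hx)),
      partialD_mul i (differentiableAt_disp i x) (differentiableAt_invDistSq hx),
      partialD_gC_pow i _ hx, partialD_disp, partialD_invDistSq i hx]
    push_cast [Nat.cast_sub hd]
    simp only [if_true]
    ring
  simp only [e]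
  rw [← Finset.mul_sum, Finset.sum_sub_distrib, ← Finset.mul_sum]
  have : (d : ℂ) * invDistSq a x * ∑ i, disp a i x * disp a i x = d := by
    linear_combination (d : ℂ) * sum_disp_sq hx
  rw [this]
  simp

/-- The pointwise form of the Dirichlet identity. Here `A` is the reflection with axis `z = x - â`,
`l = g²`, `n = g^(d-2)`, `p = |x - â|⁻²`, `c = d - 2`; `v` is the gradient of `u`, `w` the gradient
of the other function at the inverted point, and `u'` its value there. Symmetry of `A` moves it
between the gradients, and `A z = -z` fixes the sign of the remaining term. -/
theorem kelvin_gradient_algebra {A : Fin d → Fin d → ℂ} {z : Fin d → ℂ}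
    (hA : ∀ i j, A i j = A j i) (hz : ∀ i, ∑ j, A i j * z j = - z i) (v w : Fin d → ℂ)
    (u u' l n p c : ℂ) :
    ∑ i, ((∑ j, l * A i j * v j) * n - c * (n * l * u * p * z i)) * w i =
      ∑ i, v i * ((∑ j, l * A i j * w j) * n - u' * (c * (z i * p * n))) +
        c * ∑ i, (v i * u' + u * ∑ j, l * A i j * w j) * (n * (z i * p)) := by
  have e1 : ∑ i, (∑ j, l * A i j * v j) * w i = ∑ i, v i * ∑ j, l * A i j * w j := by
    simp only [Finset.sum_mul, Finset.mul_sum]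
    rw [Finset.sum_comm]
    refine Finset.sum_congr rfl fun i _ => Finset.sum_congr rfl fun j _ => ?_
    rw [hA j i]; ring
  have e2 : ∑ i, z i * ∑ j, l * A i j * w j = - l * ∑ i, z i * w i := by
    simp only [Finset.mul_sum]
    rw [Finset.sum_comm]
    refine Finset.sum_congr rfl fun i _ => ?_
    have : ∑ j, z j * (l * A j i * w i) = l * w i * ∑ j, A i j * z j := by
      rw [Finset.mul_sum]
      exact Finset.sum_congr rfl fun j _ => by rw [hA j i]; ring
    rw [this, hz]; ring
  have h1 : ∑ i, ((∑ j, l * A i j * v j) * n - c * (n * l * u * p * z i)) * w i =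
      n * (∑ i, (∑ j, l * A i j * v j) * w i) - c * n * l * u * p * ∑ i, z i * w i := by
    rw [Finset.mul_sum, Finset.mul_sum, ← Finset.sum_sub_distrib]
    exact Finset.sum_congr rfl fun i _ => by ring
  have h2 : ∑ i, v i * ((∑ j, l * A i j * w j) * n - u' * (c * (z i * p * n))) +
        c * ∑ i, (v i * u' + u * ∑ j, l * A i j * w j) * (n * (z i * p)) =
      n * (∑ i, v i * ∑ j, l * A i j * w j) +
        c * u * n * p * ∑ i, z i * ∑ j, l * A i j * w j := by
    rw [Finset.mul_sum, Finset.mul_sum, Finset.mul_sum, ← Finset.sum_add_distrib,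
      ← Finset.sum_add_distrib]
    exact Finset.sum_congr rfl fun i _ => by ring
  rw [h1, h2, e1, e2]
  ring

/-- Transformation of the Dirichlet form under the Kelvin transformation. -/
theorem exists_dirichlet_kelvin [Nonempty (Fin d)] (hd : 2 ≤ d) (hU : IsShell U)
    (hU' : IsShell U') (hUU' : U' = invA a '' U) {u : H1 U} {f : Sph d → ℂ} (hu : BdryTrace u f)
    {w : H1 U'} {ψ : Smooth d} (hw : BdryTrace w ψ) :
    ∃ (u₁ : H1 U') (w₁ : H1 U), BdryTrace u₁ (kelvin a f) ∧ BdryTrace w₁ (kelvin a ψ) ∧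
      dirichlet u₁ w = dirichlet u w₁ +
        (d - 2) * ∫ y, hMul a f y * kelvin a ψ y ∂(surf d) := by
  have hUm := hU.isOpen.measurableSet
  have hU'U : U = invA a '' U' := by
    rw [hUU', image_image]; simp only [invA_invA, image_id']
  obtain ⟨u₀, u₁, hu1, hu2, -, hu4, hu5⟩ := exists_kelvin (by omega) hUm hU.subset
    hU'.isOpen.measurableSet hUU' hu
  obtain ⟨w₀, w₁, hw1, hw2, hw3, hw4, hw5⟩ := exists_kelvin (by omega) hU'.isOpen.measurableSet
    hU'.subset hUm hU'U hw
  refine ⟨u₁, w₁, hu4, hw4, ?_⟩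
  let ζ : Fin d → Euc d → ℂ := fun i x => gC a x ^ (d - 2) * (disp a i x * invDistSq a x)
  have hζ : ∀ i, SmoothNear (ζ i) := fun i => (smoothNear_gC_pow _).mul
    ((smoothNear_of_contDiffOn (a := a) (contDiffOn_disp i)).mul
      (smoothNear_of_contDiffOn (a := a) contDiffOn_invDistSq))
  have hw3' : BdryTrace w₀ (⟨_, comp_invSph_mem_smooth (a := a) ψ⟩ : Smooth d) := hw3
  have hne : ∀ x ∈ U, x ≠ hat a := fun x hx =>
    ne_hat_of_mem a (ball_subset_closedBall (hU.subset hx))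
  have hint : ∀ i, Integrable (fun x => u.val x * w₀.val x * partialD i (ζ i) x +
      (u.grad i x * w₀.val x + u.val x * w₀.grad i x) * ζ i x) (volume.restrict U) := by
    intro i
    have e : ∀ {p q : Euc d → ℂ} {s : Euc d → ℂ}, MemLp p 2 (volume.restrict U) →
        MemLp q 2 (volume.restrict U) → SmoothNear s →
        Integrable (fun x => p x * (q x * s x)) (volume.restrict U) := fun hp hq hs =>
      MemLp.integrable_mul' hp (memLp_mul_of_continuousOn hUm hU.subset hq hs.continuousOn)
    refine ((e u.memLp_val w₀.memLp_val ((hζ i).partialD i)).add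
      ((e (u.memLp_grad i) w₀.memLp_val (hζ i)).add
        (e u.memLp_val (w₀.memLp_grad i) (hζ i)))).congr ?_
    refine Filter.Eventually.of_forall fun x => ?_
    simp only [Pi.add_apply]
    ring
  -- The product integration by parts, applied to `u`, `w ∘ I_a` and each component of `ζ`. On the
  -- sphere `∑ ζ_i y_i` is the multiplier of `H_a` times `g^(d-2)`.
  have hS : ∫ x in U, ∑ i, (u.val x * w₀.val x * partialD i (ζ i) x +
      (u.grad i x * w₀.val x + u.val x * w₀.grad i x) * ζ i x) =
      ∫ y, hMul a f y * kelvin a ψ y ∂(surf d) := by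
    rw [integral_finsetSum _ fun i _ => hint i,
      Finset.sum_congr rfl fun i _ => hu.integral_mul_mul hU hw3' (hζ i) i, ← integral_finsetSum]
    · congr 1; ext y
      rw [hMul_eq, Finset.sum_mul, Finset.sum_mul, Finset.sum_mul]
      refine Finset.sum_congr rfl fun i _ => ?_
      simp only [kelvin, ζ, gC]
      ring
    · intro i _
      exact (memLp_mul_sphere (memLp_mul_sphere (memLp_mul_sphere hu.1
        (smooth_continuous ⟨_, comp_invSph_mem_smooth (a := a) ψ⟩)) (hζ i).continuous_sphere)
        (smoothNear_coord i).continuous_sphere).integrable (by norm_num)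
  have hD : Integrable (fun x => ∑ i, u.grad i x * w₁.grad i x) (volume.restrict U) :=
    integrable_finsetSum _ fun i _ => MemLp.integrable_mul' (u.memLp_grad i) (w₁.memLp_grad i)
  have hV : ∀ F : Euc d → ℂ, ∫ x in U', F x = ∫ x in U, gC a x ^ (2 * d) * F (invA a x) :=
    fun F => by rw [hUU', integral_image_invA hUm hU.subset]
  rw [← hS, ← integral_const_mul, dirichlet, dirichlet, ← integral_add hD
    ((integrable_finsetSum _ fun i _ => hint i).const_mul _), hV]
  refine setIntegral_congr_fun hUm fun x hx => ?_
  have hx' := hne x hx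
  have hg := gC_ne_zero hx'
  have hgd := pow_ne_zero (d - 2) hg
  have hp : invDistSq a (invA a x) = invDistSq a x / gC a x ^ 4 := by
    rw [eq_div_iff (pow_ne_zero 4 hg), invDistSq_invA hx']
  have hpow : gC a x ^ (2 * d) = (gC a x ^ (d - 2)) ^ 2 * gC a x ^ 4 := by
    rw [← pow_mul, ← pow_add]; congr 1; omega
  -- The Jacobian `g^(2d) = (g^(d-2))² g⁴` absorbs the negative powers of `g` that appear because
  -- `g_a ∘ I_a = 1/g_a`.
  have h1 : gC a x ^ (2 * d) * ∑ i, u₁.grad i (invA a x) * w.grad i (invA a x) =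
      ∑ i, ((∑ j, gC a x ^ 2 * refl a i j x * u.grad j x) * gC a x ^ (d - 2) -
        (d - 2) * (gC a x ^ (d - 2) * gC a x ^ 2 * u.val x * invDistSq a x * disp a i x)) *
        w.grad i (invA a x) := by
    rw [Finset.mul_sum]
    refine Finset.sum_congr rfl fun i _ => ?_
    rw [hu5, hu2, hu1, partialD_gC_pow i _ (invA_ne_hat hx'), invA_invA, disp_invA, hp,
      gC_invA hx', hpow, Nat.cast_sub hd]
    simp only [inv_pow, refl_invA _ _ hx', mul_assoc, ← Finset.mul_sum]
    field_simp
    push_cast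
    ring
  have h2 : ∀ i, w₁.grad i x = (∑ j, gC a x ^ 2 * refl a i j x * w.grad j (invA a x)) *
      gC a x ^ (d - 2) - w₀.val x * ((d - 2) * (disp a i x * invDistSq a x * gC a x ^ (d - 2))) := by
    intro i
    rw [hw5, hw2, partialD_gC_pow i _ hx', Nat.cast_sub hd]
    push_cast
    ring
  -- The term containing `div ζ` vanishes; only `∇(u (w ∘ I_a)) · ζ` remains.
  have h3 : ∑ i, (u.val x * w₀.val x * partialD i (ζ i) x +
      (u.grad i x * w₀.val x + u.val x * w₀.grad i x) * ζ i x) =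
      ∑ i, (u.grad i x * w₀.val x + u.val x *
        ∑ j, gC a x ^ 2 * refl a i j x * w.grad j (invA a x)) *
          (gC a x ^ (d - 2) * (disp a i x * invDistSq a x)) := by
    rw [Finset.sum_add_distrib, ← Finset.mul_sum, sum_partialD_gradient hd hx', mul_zero, zero_add]
    simp only [hw2, ζ]
  simp only [h1, h2, h3]
  exact kelvin_gradient_algebra (fun i j => refl_symm a i j x) (fun i => sum_refl_disp i hx') _ _ _ _
    _ _ _ _

theorem integrable_hMul {f : Sph d → ℂ} (hf : MemLp f 2 (surf d)) :
    Integrable (hMul a f) (surf d) := by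
  have h : Continuous fun y : Sph d => (∑ i, coord i (y : Euc d) * disp a i y) * invDistSq a y :=
    (continuous_finsetSum _ fun i _ => (smoothNear_coord i).continuous_sphere.mul
      (smoothNear_of_contDiffOn (a := a) (contDiffOn_disp i)).continuous_sphere).mul
      (smoothNear_of_contDiffOn (a := a) contDiffOn_invDistSq).continuous_sphere
  refine ((memLp_mul_sphere hf h).integrable (by norm_num)).congr
    (Filter.Eventually.of_forall fun y => ?_)
  simp only [hMul_eq]
  ring

theorem isShell_ball : IsShell (ball (0 : Euc d) 1) :=
  ⟨isOpen_ball, le_rfl, 0, one_pos, sdiff_subset⟩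

/-- Transformation of the Dirichlet-to-Neumann functional under the Kelvin transformation. -/
theorem isDN_kelvin [Nonempty (Fin d)] (hd : 2 ≤ d) (hU : IsShell U) (hU' : IsShell U')
    (hUU' : U' = invA a '' U) {f : Sph d → ℂ} {g g' : Functional d}
    (hg : IsDN (BdryTrace (U := U)) f g) (hg' : IsDN (BdryTrace (U := U')) (kelvin a f) g') :
    g = gDual a (gDual a (kelvinDual a g')) + (2 - (d : ℂ)) • ofFun (hMul a f) := by
  obtain ⟨-, u, hu, -, hgu⟩ := hg
  obtain ⟨-, u', hu', -, hgu'⟩ := hg'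
  ext φ
  obtain ⟨v, hv⟩ := exists_bdryTrace_smooth (U := ball (0 : Euc d) 1) isShell_ball (kelvinTest a φ)
  -- The extension of `K_a φ` is chosen harmonic, so that pairing with it depends only on the trace
  -- of the other factor.
  obtain ⟨w, hw, hw0⟩ := exists_harmonic hU' ⟨v, hv⟩
  obtain ⟨u₁, w₁, hu1, hw1, h⟩ := exists_dirichlet_kelvin hd hU hU' hUU' hu hw
  have hk : kelvin a (kelvinTest a φ : Smooth d) = (φ : Sph d → ℂ) := kelvin_kelvin _
  rw [hk] at hw1 h
  -- The solution `u'` and the Kelvin transform `u₁` of `u` have the same trace, so they pair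
  -- equally with the harmonic `w`.
  have e1 : g' (kelvinTest a φ) = dirichlet u₁ w := by
    rw [hgu' _ w hw, dirichlet_comm, dirichlet_comm u₁]
    exact dirichlet_eq_of_trace hU' hw0 hu' hu1
  -- The two outer factors `g²` cancel the inner ones, since `g_a ∘ I_a = 1/g_a` on the sphere.
  -- Dually, `G_a² K_a` acts on a functional by testing it with `K_a φ`.
  have e2 : gTest a (gTest a (kelvinTest a (gTest a (gTest a φ)))) = kelvinTest a φ := by
    ext y
    have h0 := gC_ne_zero (ne_hat a y)
    have h1 : (gFun a (invSph a y) : ℂ) = (gC a y)⁻¹ := gC_invA (ne_hat a y)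
    change gC a y * (gC a y * (gC a y ^ (d - 2) * ((gFun a (invSph a y) : ℂ) *
      ((gFun a (invSph a y) : ℂ) * (φ : Sph d → ℂ) (invSph a y))))) =
      gC a y ^ (d - 2) * (φ : Sph d → ℂ) (invSph a y)
    rw [h1]
    field_simp
  have e3 : ofFun (hMul a f) φ = ∫ y, hMul a f y * (φ : Sph d → ℂ) y ∂(surf d) := by
    rw [ofFun, dif_pos (integrable_hMul hu.1)]
    rfl
  have e4 : gDual a (gDual a (kelvinDual a g')) φ = g' (kelvinTest a φ) := by
    rw [← e2]; rfl
  rw [LinearMap.add_apply, LinearMap.smul_apply, smul_eq_mul, e3, e4, e1, h, hgu φ w₁ hw1]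
  ring

/-! ### Holed balls, their inversion, and the selected Dirichlet-to-Neumann functionals. -/

theorem isShell_holed {C : Euc d} {R : ℝ} (h : closedBall C R ⊆ ball 0 1) :
    IsShell (holed C R) := by
  obtain ⟨ρ, hρ, hs⟩ := exists_lt_subset_ball isClosed_closedBall h
  exact ⟨isOpen_ball.sdiff isClosed_closedBall, sdiff_subset, ρ, hρ, fun x hx =>
    ⟨hx.1, fun hxC => hx.2 (ball_subset_closedBall (hs hxC))⟩⟩

/-- Take closures in the identity of open balls. The radius `R` is positive because the image is
nonempty, and the image of the compact closed ball is closed by continuity away from `â`. -/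
theorem closedBall_eq_image_invA {r : ℝ} (hr : r ∈ Ioo (0 : ℝ) 1) {C : Euc d} {R : ℝ}
    (hCR : ball C R = invA a '' ball 0 r) : closedBall C R = invA a '' closedBall 0 r := by
  have hne : (ball C R).Nonempty := by
    rw [hCR]; exact (nonempty_ball.2 hr.1).image _
  have hc : ContinuousOn (invA a) (closedBall 0 r) := (contDiffOn_inv a).continuousOn.mono
    fun x hx => ne_hat_of_mem a (closedBall_subset_closedBall hr.2.le hx)
  rw [← closure_ball C (nonempty_ball.1 hne).ne', hCR, ← closure_ball (0 : Euc d) hr.1.ne']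
  rw [← closure_ball (0 : Euc d) hr.1.ne'] at hc
  refine Subset.antisymm (closure_minimal (image_mono subset_closure) ?_) hc.image_closure
  refine (IsCompact.image_of_continuousOn ?_ hc).isClosed
  rw [closure_ball (0 : Euc d) hr.1.ne']
  exact isCompact_closedBall _ _

theorem holed_eq_image_invA {r : ℝ} (hr : r ∈ Ioo (0 : ℝ) 1) {C : Euc d} {R : ℝ}
    (hCR : ball C R = invA a '' ball 0 r) : holed C R = invA a '' holed 0 r := by
  rw [holed, holed, image_sdiff (invA_injective a), image_invA_ball,
    closedBall_eq_image_invA hr hCR]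

theorem isDN_dnMap [Nonempty (Fin d)] {C : Euc d} {R : ℝ} (h : IsShell (holed C R))
    {f : Sph d → ℂ} (hf : MemHHalf f) :
    IsDN (BdryTrace (U := holed C R)) f (dnMap C R f) := by
  have e : ∃ g, IsDN (BCHoled C R) f g := by
    rw [bCHoled_eq_bdryTrace]; exact (existsUnique_isDN h hf).exists
  rw [dnMap, dif_pos e, ← bCHoled_eq_bdryTrace]
  exact e.choose_spec

theorem isDN_dnMapOne [Nonempty (Fin d)] {f : Sph d → ℂ} (hf : MemHHalf f) :
    IsDN (BdryTrace (U := ball (0 : Euc d) 1)) f (dnMapOne f) := by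
  have e : ∃ g, IsDN (HasTrace (d := d)) f g := (existsUnique_isDN isShell_ball hf).exists
  rw [dnMapOne, dif_pos e]
  exact e.choose_spec

theorem gDual_gDual_kelvinDual_sub (g g' : Functional d) :
    gDual a (gDual a (kelvinDual a (g - g'))) =
      gDual a (gDual a (kelvinDual a g)) - gDual a (gDual a (kelvinDual a g')) := rfl

end Kelvin

end DNKelvin

end

/-! ### The transformation laws. -/

theorem theorem3p1 (d : ℕ) (hd : 2 ≤ d) (a : PBall d) (r : ℝ) (hr : r ∈ Set.Ioo (0 : ℝ) 1)
    (C : Euc d) (R : ℝ) (hCR : Metric.ball C R = invA a '' Metric.ball 0 r) :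
    (∀ f : Sph d → ℂ, MemHHalf f →
      MemHHalf (kelvin a f) ∧
      (∃! g, IsDN (BCHoled C R) f g) ∧
      (∃! g, IsDN (BCHoled 0 r) f g) ∧
      (∃! g, IsDN (HasTrace (d := d)) f g)) ∧
    (∀ f : Sph d → ℂ, MemHHalf f →
      dnMap C R f =
        gDual a (gDual a (kelvinDual a (dnMap 0 r (kelvin a f)))) +
          (2 - (d : ℂ)) • ofFun (hMul a f)) ∧
    (∀ f : Sph d → ℂ, MemHHalf f →
      dnMap C R f - dnMapOne f =
        gDual a (gDual a (kelvinDual a (dnMap 0 r (kelvin a f) - dnMapOne (kelvin a f))))) ∧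
    (∀ f : Sph d → ℂ, MemHHalf f →
      dnMap 0 r f - dnMapOne f =
        gDual a (gDual a (kelvinDual a (dnMap C R (kelvin a f) - dnMapOne (kelvin a f))))) := by
  have : Nonempty (Fin d) := ⟨⟨0, by omega⟩⟩
  have hd1 : 1 ≤ d := by omega
  have hr1 : Metric.closedBall (0 : Euc d) r ⊆ Metric.ball 0 1 := Metric.closedBall_subset_ball hr.2
  have hC1 : Metric.closedBall C R ⊆ Metric.ball 0 1 := by
    rw [closedBall_eq_image_invA hr hCR]
    exact Set.image_subset_iff.2 fun x hx => invA_mem_ball a (hr1 hx)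
  have hU := isShell_holed hr1
  have hV := isShell_holed hC1
  have hUV := holed_eq_image_invA hr hCR
  -- The inversion is an involution, so the two holed domains play symmetric roles and the same law
  -- serves in both directions.
  have hVU : holed 0 r = invA a '' holed C R := by
    rw [hUV, Set.image_image]
    simp only [invA_invA, Set.image_id']
  have hball := image_invA_ball (a := a).symm
  have main : ∀ f : Sph d → ℂ, MemHHalf f → dnMap C R f =
      gDual a (gDual a (kelvinDual a (dnMap 0 r (kelvin a f)))) +
        (2 - (d : ℂ)) • ofFun (hMul a f) := fun f hf =>
    isDN_kelvin hd hV hU hVU (isDN_dnMap hV hf) (isDN_dnMap hU (hf.kelvin hd1))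
  have main_inv : ∀ f : Sph d → ℂ, MemHHalf f → dnMap 0 r f =
      gDual a (gDual a (kelvinDual a (dnMap C R (kelvin a f)))) +
        (2 - (d : ℂ)) • ofFun (hMul a f) := fun f hf =>
    isDN_kelvin hd hU hV hUV (isDN_dnMap hU hf) (isDN_dnMap hV (hf.kelvin hd1))
  -- The full ball is its own image, so the inclusion-free map obeys the same law with the same term
  -- in `H_a`; subtraction removes that term.
  have main_one : ∀ f : Sph d → ℂ, MemHHalf f → dnMapOne f =
      gDual a (gDual a (kelvinDual a (dnMapOne (kelvin a f)))) +
        (2 - (d : ℂ)) • ofFun (hMul a f) := fun f hf =>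
    isDN_kelvin hd isShell_ball isShell_ball hball (isDN_dnMapOne hf)
      (isDN_dnMapOne (hf.kelvin hd1))
  refine ⟨fun f hf => ⟨hf.kelvin hd1, ?_, ?_, ?_⟩, main, fun f hf => ?_, fun f hf => ?_⟩
  · rw [bCHoled_eq_bdryTrace]
    exact existsUnique_isDN hV hf
  · rw [bCHoled_eq_bdryTrace]
    exact existsUnique_isDN hU hf
  · exact existsUnique_isDN isShell_ball hf
  · rw [main f hf, main_one f hf, gDual_gDual_kelvinDual_sub, add_sub_add_right_eq_sub]
  · rw [main_inv f hf, main_one f hf, gDual_gDual_kelvinDual_sub, add_sub_add_right_eq_sub]
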